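/- **Setting.** *Programs.* Octal is a typed assembly language based on x86-64, with the instructions movq, addq, cmpq, leaq, pushq, popq (and pushsecq, popsecq), jne, jmp, callq, retq, halt. A program $P$ maps function names to functions, a function maps labels to instruction sequences; it has an entry block and an exit block consisting of retq (of halt for the top-level function main, which is never called). Words have 64 bits, memory accesses have 8 bytes, and addresses are read modulo $2^{64}$. Memory operands, pushes and pops carry a slot $s$ and a taint type $\tau$; branches carry a substitution $\sigma$ of the block variables of the target; calls carry $(\sigma_{call},\sigma_{ret})$. *Types.* Dependent types $e$ are built from type variables, constants, $\top$ (absorbing) and operators; taint types $\tau$ from taint variables, $0$, $1$ and $\vee$. Variables are input variables (shared by all blocks of a function; all taint variables are such) or block variables; some are pointers; some, among them $sp$ (the value of rsp at function entry), are marked as not changed by the transformation. $\mathrm{isNonChangeExp}(e)$, under a context $\Delta$, means: for every valuation satisfying $\Delta$, the value of $e$ stays the same when only unmarked variables are changed. A slot is an address range $[x+e_1,x+e_2)$ with base pointer $x=\mathrm{getPtr}(s)$, and is a spill slot (including the area reserved for callees), a local stack object (both are "local", with base $sp$), or external. A state type $(\Delta,\mathcal R,\mathcal M)$ consists of constraints,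 a partial map from registers to pairs $(e,\tau)$ and a partial map from slots to $(s^{valid},(e,\tau))$. A program type $\mathcal P$ gives a state type for every block. *Typing.* $\vdash P:\mathcal P$ means that every block is typed from its state type, instruction by instruction, by the following rules. An access to $[a,a+8)$ through $s$ needs an untainted known address with $\mathrm{isNonChangeExp}(a-\mathrm{getPtr}(s))$. A load needs $[a,a+8)\subseteq s^{valid}$, and yields $e$ if these sets are equal and otherwise $\top$ (if $e$ is NonChange). A store needs $[a,a+8)\subseteq s$ and data taint $\Rightarrow\tau$; in a spill slot it replaces valid region and type; in another slot it keeps the taint type, enlarges the valid region by $[a,a+8)$, and yields the stored type if the old valid region is covered and otherwise $\top$ (if both types are NonChange). pushq and popq use spill slots with $\tau\neq0$. An arithmetic result $\top$ needs NonChange operands. jne needs an untainted flag with a NonChange condition. Jumps need the current state type (with the branch condition) to be a subtype of the $\sigma$-instance of the target's state type. Subtyping asks: entailment of contexts; register types equal (stably under changing unmarked variables) or NonChange versus $\top$, with implied taint; each slot contained in one of the source's slots with the same base pointer, not a spill slot unless that one is, with contained valid region, the same kind of relation of the dependent types (equality of non-$\top$ types includes equality of valid regions), and equal taint, where the dependent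 types may be unrelated if the target's valid region is empty and the taints too if moreover the source slot is a spill slot. callq needs an untainted rsp equal to $sp+c$, an uninitialized untainted slot with base $sp$ for the return address, pointer arguments at NonChange offset from their base pointers, and the subtype relation with the $\sigma_{call}$-instance of the callee's entry type; the resulting type is the $(\sigma_{call}\cup\sigma_{ret})$-instance of the callee's exit type, with $\sigma_{ret}$ renaming block variables to fresh ones, and memory type updateMem: the caller's slots that contain callee slots are either spill slots, uninitialized on both sides, or non-spill slots containing exactly one (non-spill, equally tainted) callee slot $s_1$, whose valid region becomes $(s_0^{valid}\setminus s_1)\cup s_1^{valid}$, with the callee's type if that is $s_1^{valid}$ and otherwise $\top$ (both types being NonChange). Each function satisfies: rsp has type $(sp,0)$ at entry and exit; its slots avoid $[sp,sp+8)$ at entry and exit; local slots are uninitialized there; callee-saved registers have the same variable as type at entry and exit; other registers and initialized slots have NonChange type at exit; the entry context is contained in every block's context; entry types use input variables only; slots are described by input variables, have pointer bases, and are pairwise disjoint; all blocks have the same slots, with the same taint for non-spill slots, and with valid regions contained in the slots. *Memory layout.* Fixed are $sp_{init}$, $\delta$ and four pairwise disjoint regions: $s_{stackPub}=[sp_{init}+\delta,sp_{init})$,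 $s_{stackSec}=[sp_{init}+2\delta,sp_{init}+\delta)$, $s_{otherPub}$, $s_{otherSec}$. *Machine.* A state $S=(R,M,\Phi)$ has registers and memory with a taint bit for each register and each byte, and a stack $\Phi$ of frames $(pc,(\sigma_f,\sigma_b))$ with the values of the input and block variables. The machine gets stuck on tainted addresses, tainted branch conditions, data not matching its taint annotation, and returns to an address other than the one after the call; jumps set $\sigma_b:=(\sigma_f\cup\sigma_b)\circ\sigma$, calls push a frame with $\sigma_f:=(\sigma_f\cup\sigma_b)\circ\sigma_{call}$, returns extend the caller's $\sigma_b$ by $\sigma_b\circ\sigma_{ret}^{-1}$. pushsecq and popsecq are pushq and popq with the memory access moved by $\delta$. A state whose next instruction is halt is a termination state. $S$ is *well-formed*, $P,\mathcal P\vdash S$, if $\vdash P:\mathcal P$; the values and taints of registers and valid regions match the state type at the pc; constraints hold; each slot lies in $s_{stackPub}$, $s_{otherPub}$ or $s_{otherSec}$, spill slots in $s_{stackPub}$, and nonempty slots in $s_{otherPub}$ are untainted; the bottom frame is in main; and each other frame is in the function called by the frame below, has $\sigma_f$ equal to the caller's valuation composed with $\sigma_{call}$, has the untainted return address at $[\sigma_f(sp),\sigma_f(sp)+8)$,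 and differs in memory only there and in its slots from a memory at the call in which the rest of the stack is well-formed. *Transformation.* For a memory type, the strategy $\omega(s)$ is TransPtr if $\mathrm{getPtr}(s)\ne sp$ and all slots with that base have equal taint; otherwise TransOp, and then $s$ must be local or have taint $0$ or $1$. $\mathcal C$ maps an operand with slot $s$ and taint $\tau$ to the one with displacement and slot shifted by $\delta$ if $\omega(s)=$ TransOp and $\tau\ne0$ ($\mathcal C_{op}$, applied in movq, addq, cmpq); pushq, popq to pushsecq, popsecq; a call to instructions addq $\delta,r$ followed by the call with $\sigma_{call}$ shifted by $\delta$ at the same pointers ($\mathcal C_{ptr}$), one for each base pointer of a callee slot $s_c$ with $\omega_c(s_c)=$ TransPtr, $\sigma_{call}(\tau_c)\neq0$, contained in a caller slot $s_p$ with $\omega_p(s_p)=$ TransOp; other instructions are unchanged. $\mathcal C$ asserts at calls: each $s_c$ has such an $s_p$; if $s_p$ is a spill slot, $s_c$ is uninitialized; $\omega_c(s_c)=$ TransOp implies $\omega_p(s_p)=$ TransOp; a shifted pointer is not marked as unchanged and is held, untainted, by a unique register, which is not callee-saved; the other register types and all memory types of the callee's entry type are not affected by the shift; and the entry type does not contain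 the zero flag if there is a shift. $\mathcal C(P)$ is the result of transforming each block instruction by instruction. *Simulation relation.* $P,\mathcal P\vdash S'\prec S$ means: $S$ is well-formed; the pcs are in the same function and the instruction sequence at $pc'$ in $\mathcal C(P)$ is the transformation of the one at $pc$; with $\sigma=\sigma_f\cup\sigma_b$, $\sigma'$ likewise, $\sigma'=\sigma$ on marked and on taint variables; taints in typed registers are equal, and values equal if the type is $\top$, and otherwise they are $\sigma'(e)$ and $\sigma(e)$; for each slot $s$ with base $x$ and taint $\tau$: if $\omega(s)=$ TransOp then $\sigma(s)\subseteq s_{stackPub}$, and $s$ is local or $\tau\in\{0,1\}$; $\sigma'(x)-\sigma(x)$ is $0$ if $\omega(s)=$ TransOp or $\sigma(s)\not\subseteq s_{stackPub}\cup s_{stackSec}$, and otherwise $\delta$ if $\sigma(\tau)=1$ and $\sigma(s)\neq\emptyset$, and $0$ or $\delta$ in the remaining cases; and the valid region of $s$ in $M$ and that region moved by $\sigma'(x)-\sigma(x)+\mathrm{getOpShift}(s)$ in $M'$ hold data related in the same way as for registers, where $\mathrm{getOpShift}(s)$ is $0$ if $\omega(s)=$ TransPtr or $\tau=0$, and $\delta$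 otherwise. For call stacks with more than one frame, moreover: the calling frames and memories at the call are so related, the pc of the transformed caller being taken at the first instruction of the transformed call; $\sigma_f'$ is the composite of the transformed caller's valuation with $\sigma_{call}'$; both memories hold the untainted return addresses at $[\sigma_f(sp),\sigma_f(sp)+8)$; and outside this range and the slots (for $M'$: outside this range and the sets $\sigma(s)\cup(\sigma(s)+\delta)$ for TransOp slots, $\sigma(s)+\sigma'(x)-\sigma(x)$ for TransPtr slots) they agree with the memories at the call. **Theorem (Functional Correctness).** Let $P$ be a program with program type $\mathcal P$ on which all assertions of the transformation hold, and let $S$, $S'$ be states of $P$ and $\mathcal C(P)$ with $P,\mathcal P\vdash S$ and $P,\mathcal P\vdash S'\prec S$. Then either $S$ and $S'$ are both termination states, or there are states $S_1$, $S_1'$ such that, with $\mathit{inst}$ the next instruction of $S$, $$S\xrightarrow{\mathit{inst}}S_1,\qquad S'\xrightarrow{\mathcal C(\mathit{inst})}{}^{*}\,S_1',\qquad P,\mathcal P\vdash S_1'\prec S_1 .$$ -/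

import Mathlib

namespace Octal

/-! ## Words, registers, names -/

abbrev Word := BitVec 64
abbrev Byte := BitVec 8

/-- The sixteen general-purpose registers of x86-64. -/
inductive GPR
  | rax | rbx | rcx | rdx | rsi | rdi | rbp | rsp
  | r8 | r9 | r10 | r11 | r12 | r13 | r14 | r15
deriving DecidableEq

def GPR.all : List GPR :=
  [.rax, .rbx, .rcx, .rdx, .rsi, .rdi, .rbp, .rsp,
   .r8, .r9, .r10, .r11, .r12, .r13, .r14, .r15]

/-- Registers, including the zero flag. -/
inductive Reg
  | gp (r : GPR)
  | zf
deriving DecidableEq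

abbrev Reg.rsp : Reg := .gp .rsp

/-- Callee-saved registers of the System V ABI (including `rsp`). -/
def Reg.calleeSaved : Reg → Bool
  | .gp .rbx | .gp .rbp | .gp .rsp | .gp .r12 | .gp .r13 | .gp .r14 | .gp .r15 => true
  | _ => false

/-- Function names; `main` is the top-level function. -/
inductive FName
  | main
  | fn (n : ℕ)
deriving DecidableEq

/-- Block labels of a function: its first block, its unique exit block, other blocks. -/
inductive Label
  | entry
  | ret
  | blk (n : ℕ)
deriving DecidableEq

/-- A program counter: function, block and position in the block. -/
structure PC where
  fn : FName
  lbl : Label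
  idx : ℕ

def PC.next (pc : PC) : PC := { pc with idx := pc.idx + 1 }

/-! ## Type variables, dependent types, taint types -/

/-- A type variable. `input` separates input variables (shared by all blocks of a function)
from block variables, `ptr` marks variables that stand for pointers, and `nonChange` marks
variables whose value the transformation must leave unchanged. -/
structure Var where
  id : ℕ
  input : Bool
  ptr : Bool
  nonChange : Bool
deriving DecidableEq

/-- The variable `sp`: the value of `rsp` at function entry. -/
def Var.sp : Var := ⟨0, true, true, true⟩

/-- Taint variables; all of them are input variables. -/
abbrev TVar := ℕ

inductive UnOp
  | neg | not

inductive BinOp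
  | add | sub | mul | and | or | xor | shl | shr | eq | ult | slt

def UnOp.eval : UnOp → Word → Word
  | .neg, v => -v
  | .not, v => ~~~v

def boolWord (b : Bool) : Word := if b then 1 else 0

def BinOp.eval : BinOp → Word → Word → Word
  | .add, a, b => a + b
  | .sub, a, b => a - b
  | .mul, a, b => a * b
  | .and, a, b => a &&& b
  | .or, a, b => a ||| b
  | .xor, a, b => a ^^^ b
  | .shl, a, b => a <<< b
  | .shr, a, b => a >>> b
  | .eq, a, b => boolWord (a == b)
  | .ult, a, b => boolWord (a.ult b)
  | .slt, a, b => boolWord (a.slt b)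

/-- Dependent types; `top` is the unknown value. -/
inductive Exp
  | var (x : Var)
  | const (v : Word)
  | top
  | un (o : UnOp) (e : Exp)
  | bin (o : BinOp) (e₁ e₂ : Exp)

/-- Concrete values of the type variables. -/
abbrev Valuation := Var → Word

/-- Substitutions of type variables; the identity outside the intended domain. -/
abbrev Subst := Var → Exp

/-- Taint types: `zero` is untainted, `one` is tainted. -/
inductive Taint
  | var (x : TVar)
  | zero
  | one
  | join (t₁ t₂ : Taint)

/-- Substitutions of taint variables. -/
abbrev TSubst := TVar → Taint

namespace Exp

abbrev add (a b : Exp) : Exp := .bin .add a b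
abbrev sub (a b : Exp) : Exp := .bin .sub a b

/-- The value of a dependent type; `none` for an expression that contains `top`. -/
def eval (ρ : Valuation) : Exp → Option Word
  | var x => some (ρ x)
  | const v => some v
  | top => none
  | un o e => (e.eval ρ).map o.eval
  | bin o a b => (a.eval ρ).bind fun u => (b.eval ρ).map fun v => o.eval u v

/-- An expression in which `top` occurs; it is identified with `top`. -/
def HasTop : Exp → Prop
  | var _ => False
  | const _ => False
  | top => True
  | un _ e => e.HasTop
  | bin _ a b => a.HasTop ∨ b.HasTop

def vars : Exp → Set Var
  | var x => {x}
  | const _ => ∅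
  | top => ∅
  | un _ e => e.vars
  | bin _ a b => a.vars ∪ b.vars

def subst (σ : Subst) : Exp → Exp
  | var x => σ x
  | const v => const v
  | top => top
  | un o e => un o (e.subst σ)
  | bin o a b => bin o (a.subst σ) (b.subst σ)

/-- The pointer variable that a pointer expression refers to (the leftmost one). -/
def getPtr : Exp → Option Var
  | var x => if x.ptr then some x else none
  | const _ => none
  | top => none
  | un _ e => e.getPtr
  | bin _ a b => a.getPtr <|> b.getPtr

end Exp

namespace Taint

def eval (θ : TVar → Bool) : Taint → Bool
  | var x => θ x
  | zero => false
  | one => true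
  | join a b => a.eval θ || b.eval θ

def subst (σ : TSubst) : Taint → Taint
  | var x => σ x
  | zero => zero
  | one => one
  | join a b => join (a.subst σ) (b.subst σ)

/-- Equality of taint types. -/
def Equiv (a b : Taint) : Prop := ∀ θ, a.eval θ = b.eval θ

/-- Entailment `a ⇒ b`. -/
def Le (a b : Taint) : Prop := ∀ θ, a.eval θ = true → b.eval θ = true

abbrev IsZero (a : Taint) : Prop := a.Equiv zero
abbrev IsOne (a : Taint) : Prop := a.Equiv one

end Taint

/-! ## Regions and memory slots -/

/-- The addresses `[u, v)`, read modulo `2 ^ 64`. -/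
def interval (u v : Word) : Set Word := {x | x - u < v - u}

/-- Address regions given by dependent types. -/
inductive Region
  | empty
  | range (a b : Exp)
  | union (X Y : Region)
  | diff (X Y : Region)

namespace Region

def denote (ρ : Valuation) : Region → Set Word
  | empty => ∅
  | range a b =>
    match a.eval ρ, b.eval ρ with
    | some u, some v => interval u v
    | _, _ => ∅
  | union X Y => X.denote ρ ∪ Y.denote ρ
  | diff X Y => X.denote ρ \ Y.denote ρ

def subst (σ : Subst) : Region → Region
  | empty => empty
  | range a b => range (a.subst σ) (b.subst σ)
  | union X Y => union (X.subst σ) (Y.subst σ)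
  | diff X Y => diff (X.subst σ) (Y.subst σ)

def vars : Region → Set Var
  | empty => ∅
  | range a b => a.vars ∪ b.vars
  | union X Y => X.vars ∪ Y.vars
  | diff X Y => X.vars ∪ Y.vars

/-- The eight bytes at address `e`. -/
abbrev eight (e : Exp) : Region := range e (e.add (.const 8))

end Region

/-- What a slot holds: register spills and the area reserved for callees (`spill`), a data
object on the local stack of the function (`localObj`), or an object that the function
receives from its caller (`external`). -/
inductive SlotKind
  | spill | localObj | external
deriving DecidableEq

/-- The memory slot `[base + lo, base + hi)`; `base` is the pointer that refers to it. -/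
structure Slot where
  base : Var
  lo : Exp
  hi : Exp
  kind : SlotKind

namespace Slot

def region (s : Slot) : Region := .range ((Exp.var s.base).add s.lo) ((Exp.var s.base).add s.hi)

def IsSpill (s : Slot) : Prop := s.kind = .spill

def IsLocalStack (s : Slot) : Prop := s.kind = .spill ∨ s.kind = .localObj

def vars (s : Slot) : Set Var := {s.base} ∪ s.lo.vars ∪ s.hi.vars

def shift (s : Slot) (d : Word) : Slot :=
  { s with lo := s.lo.add (.const d), hi := s.hi.add (.const d) }

end Slot

/-! ## State types -/

/-- A type context: a set of constraints, each asserting that an expression is nonzero. -/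
abbrev Ctx := Set Exp

/-- A basic type: dependent type and taint type. -/
structure Basic where
  e : Exp
  t : Taint

/-- The type of a slot: initialized region and type of the data in it. -/
structure Cell where
  valid : Region
  val : Basic

abbrev RegType := Reg → Option Basic
abbrev MemType := Slot → Option Cell

structure StateType where
  ctx : Ctx
  regs : RegType
  mem : MemType

def Basic.subst (σ : Subst) (στ : TSubst) (b : Basic) : Basic := ⟨b.e.subst σ, b.t.subst στ⟩

def Ctx.subst (σ : Subst) (Δ : Ctx) : Ctx := Exp.subst σ '' Δ

/-- `ρ` satisfies the context; an unknown constraint says nothing. -/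
def Sat (ρ : Valuation) (Δ : Ctx) : Prop := ∀ c ∈ Δ, ∀ v, c.eval ρ = some v → v ≠ 0

/-- The valuations differ at most on variables that the transformation may change. -/
def AgreeNC (ρ ρ' : Valuation) : Prop := ∀ x : Var, x.nonChange = true → ρ' x = ρ x

/-- Under `Δ`, the value of `e` does not depend on variables that the transformation may
change. -/
def NonChange (Δ : Ctx) (e : Exp) : Prop :=
  ∀ ρ ρ', Sat ρ Δ → AgreeNC ρ ρ' → e.eval ρ' = e.eval ρ

/-- `Δ ⊢ a = b`, as an equation that is stable under changing the pointer variables that the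
transformation may relocate (the constraints of `Δ` are only known before relocation). -/
def EqStable (Δ : Ctx) (a b : Exp) : Prop :=
  ∀ ρ ρ', Sat ρ Δ → AgreeNC ρ ρ' → a.eval ρ' = b.eval ρ'

def Ctx.Sub (Δ : Ctx) (X Y : Region) : Prop := ∀ ρ, Sat ρ Δ → X.denote ρ ⊆ Y.denote ρ

def Ctx.Same (Δ : Ctx) (X Y : Region) : Prop := ∀ ρ, Sat ρ Δ → X.denote ρ = Y.denote ρ

def Ctx.IsEmpty (Δ : Ctx) (X : Region) : Prop := ∀ ρ, Sat ρ Δ → X.denote ρ = ∅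

def Ctx.Disj (Δ : Ctx) (X Y : Region) : Prop :=
  ∀ ρ, Sat ρ Δ → X.denote ρ ∩ Y.denote ρ = ∅

/-! ## Syntax of programs -/

/-- The memory operand `disp(base, idx, scale)` with its annotation. -/
structure MemOp where
  base : GPR
  idx : GPR
  scale : Word
  disp : Word
  slot : Slot
  taint : Taint

inductive Operand
  | reg (r : GPR)
  | imm (v : Word)
  | mem (m : MemOp)

/-- Instructions, in the order source, destination. -/
inductive Inst
  | movq (src dst : Operand)
  | addq (src dst : Operand)
  | cmpq (src dst : Operand)
  | leaq (m : MemOp) (r : GPR)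
  | pushq (r : GPR) (s : Slot) (τ : Taint)
  | popq (r : GPR) (s : Slot) (τ : Taint)
  | pushsecq (r : GPR) (s : Slot) (τ : Taint)
  | popsecq (r : GPR) (s : Slot) (τ : Taint)
  | jne (ℓ : Label) (σ : Subst)
  | jmp (ℓ : Label) (σ : Subst)
  | callq (f : FName) (σcall : Subst) (τcall : TSubst) (σret : Var → Option Var)
  | retq
  | halt

abbrev Program := FName → Label → Option (List Inst)
abbrev ProgType := FName → Label → Option StateType

def seqAt (P : Program) (pc : PC) : Option (List Inst) :=
  (P pc.fn pc.lbl).map fun I => I.drop pc.idx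

def getInst (P : Program) (pc : PC) : Option Inst := (P pc.fn pc.lbl).bind fun I => I[pc.idx]?

/-! ## Typing of operands -/

def addrType (R : RegType) (m : MemOp) : Option Basic :=
  (R (.gp m.base)).bind fun b => (R (.gp m.idx)).map fun i =>
    ⟨(b.e.add (.bin .mul i.e (.const m.scale))).add (.const m.disp), b.t.join i.t⟩

/-- The address is untainted, known, and at an offset from the base pointer of the slot that
the transformation does not change. -/
def AccessOK (Δ : Ctx) (a : Basic) (s : Slot) : Prop :=
  a.t.IsZero ∧ ¬ a.e.HasTop ∧ NonChange Δ (a.e.sub (.var s.base))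

open Classical in
noncomputable def loadType (Δ : Ctx) (M : MemType) (a : Basic) (s : Slot) (τ : Taint) :
    Option Basic :=
  (M s).bind fun c =>
    let e' := if Δ.Same (.eight a.e) c.valid then c.val.e else Exp.top
    if AccessOK Δ a s ∧ Δ.Sub (.eight a.e) c.valid ∧ c.val.t.Equiv τ ∧
        (e'.HasTop → NonChange Δ c.val.e)
    then some ⟨e', τ⟩ else none

open Classical in
noncomputable def storeType (Δ : Ctx) (M : MemType) (a : Basic) (s : Slot) (τ : Taint)
    (v : Basic) : Option Cell :=
  (M s).bind fun c =>
    if AccessOK Δ a s ∧ Δ.Sub (.eight a.e) s.region ∧ v.t.Le τ then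
      if s.IsSpill then some ⟨.eight a.e, ⟨v.e, τ⟩⟩
      else
        let e' := if Δ.Sub c.valid (.eight a.e) then v.e else Exp.top
        if c.val.t.Equiv τ ∧ (e'.HasTop → NonChange Δ c.val.e ∧ NonChange Δ v.e)
        then some ⟨.union (.eight a.e) c.valid, ⟨e', τ⟩⟩ else none
    else none

open Classical in
noncomputable def MemType.set (M : MemType) (s : Slot) (c : Cell) : MemType :=
  Function.update M s (some c)

def RegType.set (R : RegType) (r : Reg) (b : Basic) : RegType := Function.update R r (some b)

noncomputable def readType (S : StateType) : Operand → Option Basic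
  | .reg r => S.regs (.gp r)
  | .imm v => some ⟨.const v, .zero⟩
  | .mem m => (addrType S.regs m).bind fun a => loadType S.ctx S.mem a m.slot m.taint

noncomputable def writeType (S : StateType) (b : Basic) : Operand → Option StateType
  | .reg r => some { S with regs := S.regs.set (.gp r) b }
  | .imm _ => none
  | .mem m => (addrType S.regs m).bind fun a =>
      (storeType S.ctx S.mem a m.slot m.taint b).map fun c =>
        { S with mem := S.mem.set m.slot c }

/-- If a computed result is unknown, its operands do not depend on relocated pointers. -/
def TopOK (Δ : Ctx) (e e₁ e₂ : Exp) : Prop := e.HasTop → NonChange Δ e₁ ∧ NonChange Δ e₂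

/-! ## Subtyping -/

def BasicSub (Δ : Ctx) (b₁ b₂ : Basic) : Prop :=
  (EqStable Δ b₁.e b₂.e ∨ NonChange Δ b₁.e ∧ b₂.e.HasTop) ∧ b₁.t.Le b₂.t

/-- The instance of `s₂` under `σ` lies in `s₁` and refers to the same pointer. -/
def Covers (Δ : Ctx) (σ : Subst) (s₂ s₁ : Slot) : Prop :=
  Δ.Sub (s₂.region.subst σ) s₁.region ∧ (σ s₂.base).getPtr = some s₁.base

/-- Subtyping of slots; the second slot type is already instantiated. -/
def CellSub (Δ : Ctx) (s₁ : Slot) (c₁ : Cell) (s₂ : Slot) (c₂ : Cell) : Prop :=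
  (s₂.IsSpill → s₁.IsSpill) ∧ Δ.Sub c₂.valid c₁.valid ∧
  (EqStable Δ c₁.val.e c₂.val.e ∧ (c₂.val.e.HasTop ∨ Δ.Same c₁.valid c₂.valid) ∨
    NonChange Δ c₁.val.e ∧ c₂.val.e.HasTop ∨ Δ.IsEmpty c₂.valid) ∧
  (c₁.val.t.Equiv c₂.val.t ∨ s₁.IsSpill ∧ Δ.IsEmpty c₂.valid)

def Cell.subst (σ : Subst) (στ : TSubst) (c : Cell) : Cell :=
  ⟨c.valid.subst σ, c.val.subst σ στ⟩

/-- `A ⊑ σ(B)`. -/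
structure StateSub (A : StateType) (σ : Subst) (στ : TSubst) (B : StateType) : Prop where
  ctx : ∀ ρ, Sat ρ A.ctx → Sat ρ (B.ctx.subst σ)
  nonChange : ∀ x : Var, x.nonChange = true → NonChange A.ctx (σ x)
  regs : ∀ r b₂, B.regs r = some b₂ →
    ∃ b₁, A.regs r = some b₁ ∧ BasicSub A.ctx b₁ (b₂.subst σ στ)
  mem : ∀ s₂ c₂, B.mem s₂ = some c₂ →
    ∃ s₁ c₁, A.mem s₁ = some c₁ ∧ Covers A.ctx σ s₂ s₁ ∧
      CellSub A.ctx s₁ c₁ s₂ (c₂.subst σ στ)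

/-- A jump to block `ℓ` of the same function under the annotation `σ`, which instantiates
block variables only. -/
def JumpOK (𝒯 : ProgType) (f : FName) (S : StateType) (ℓ : Label) (σ : Subst) : Prop :=
  ∃ T, 𝒯 f ℓ = some T ∧ (∀ x : Var, x.input = true → σ x = .var x) ∧ (∀ x, ¬ (σ x).HasTop) ∧
    (∀ s, (T.mem s).isSome ↔ (S.mem s).isSome) ∧ StateSub S σ .var T

/-! ## Function calls -/

open Classical in
/-- The caller's slot that contains the callee's slot `s`. -/
noncomputable def findSlot (Δ : Ctx) (M : MemType) (σ : Subst) (s : Slot) : Option Slot :=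
  if h : ∃ p, (M p).isSome ∧ Covers Δ σ s p then some (Classical.choose h) else none

/-- `σcall ∪ σret`. -/
def retSubst (σcall : Subst) (σret : Var → Option Var) : Subst := fun x =>
  if x.input then σcall x else ((σret x).map Exp.var).getD (.var x)

/-- The slot `p` of the caller is updated by the slot `s` of the callee. -/
def Updates (Δ : Ctx) (M : MemType) (σcall : Subst) (M₁ : MemType) (p s : Slot) : Prop :=
  (M₁ s).isSome ∧ findSlot Δ M σcall s = some p

/-- `(valid₀ ∖ s₁) ∪ valid₁`. -/
def updValid (c₀ : Cell) (s₁ : Region) (c₁ : Cell) : Region :=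
  .union (.diff c₀.valid s₁) c₁.valid

/-- The assertions of `updateMem`; `Δ₂` is the context after the call. -/
structure UpdateOK (Δ Δ₂ : Ctx) (M : MemType) (σcall σ : Subst) (στ : TSubst) (M₁ : MemType) :
    Prop where
  found : ∀ s, (M₁ s).isSome → ∃ p, findSlot Δ M σcall s = some p
  spill : ∀ p c₀ s c₁, M p = some c₀ → Updates Δ M σcall M₁ p s → M₁ s = some c₁ →
    p.IsSpill → Δ₂.IsEmpty c₀.valid ∧ Δ₂.IsEmpty (c₁.valid.subst σ)
  unique : ∀ p s s', ¬ p.IsSpill → Updates Δ M σcall M₁ p s → Updates Δ M σcall M₁ p s' → s = s'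
  nonSpill : ∀ p c₀ s c₁, M p = some c₀ → Updates Δ M σcall M₁ p s → M₁ s = some c₁ →
    ¬ p.IsSpill → ¬ s.IsSpill ∧ c₀.val.t.Equiv (c₁.val.t.subst στ) ∧
      (¬ Δ₂.Same (updValid c₀ (s.region.subst σ) (c₁.subst σ στ)) (c₁.valid.subst σ) →
        NonChange Δ₂ c₀.val.e ∧ NonChange Δ₂ (c₁.val.e.subst σ))

open Classical in
/-- The memory type of the caller after the call. -/
noncomputable def updateMem (Δ Δ₂ : Ctx) (M : MemType) (σcall σ : Subst) (στ : TSubst)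
    (M₁ : MemType) : MemType := fun p =>
  (M p).map fun c₀ =>
    if h : ¬ p.IsSpill ∧ ∃ s, Updates Δ M σcall M₁ p s then
      match M₁ (Classical.choose h.2) with
      | none => c₀
      | some c₁ =>
        let c := c₁.subst σ στ
        let v := updValid c₀ ((Classical.choose h.2).region.subst σ) c
        if Δ₂.Same v c.valid then ⟨v, ⟨c.val.e, c₀.val.t⟩⟩ else ⟨v, ⟨.top, c₀.val.t⟩⟩
    else c₀

/-- Type variables that occur in a state type (in slots as well). -/
def StateType.vars (S : StateType) : Set Var :=
  {x | (∃ c ∈ S.ctx, x ∈ c.vars) ∨ (∃ r b, S.regs r = some b ∧ x ∈ b.e.vars) ∨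
    ∃ s c, S.mem s = some c ∧ (x ∈ s.vars ∨ x ∈ c.valid.vars ∨ x ∈ c.val.e.vars)}

/-- The state type after the return address has been pushed. -/
def pushedType (S : StateType) (b : Basic) : StateType :=
  { S with regs := S.regs.set .rsp ⟨b.e.sub (.const 8), b.t⟩ }

/-- The context after a call. -/
def callCtx (S X : StateType) (σ : Subst) : Ctx := S.ctx ∪ X.ctx.subst σ

/-- Premises for a call at state type `S`, with type `b` of `rsp`, to a function with
entry type `E` and exit type `X`. -/
structure CallOK (S : StateType) (b : Basic) (E X : StateType) (σcall : Subst) (τcall : TSubst)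
    (σret : Var → Option Var) : Prop where
  rspTaint : b.t.IsZero
  rsp : ∃ c, EqStable S.ctx b.e ((Exp.var .sp).add (.const c))
  retSlot : ∃ s c, S.mem s = some c ∧ s.base = .sp ∧
    S.ctx.Same s.region (.range (b.e.sub (.const 8)) b.e) ∧
    S.ctx.IsEmpty c.valid ∧ c.val.t.IsZero
  ptr : ∀ x : Var, x.input = true → x.ptr = true → ∃ y, (σcall x).getPtr = some y ∧
    NonChange S.ctx ((σcall x).sub (.var y))
  noTop : ∀ x, ¬ (σcall x).HasTop
  sub : StateSub (pushedType S b) σcall τcall E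
  retBlock : ∀ x₁ x₂, σret x₁ = some x₂ → x₁.input = false ∧ x₂.input = false ∧
    (x₂.nonChange = true → x₁.nonChange = true)
  retInj : ∀ x₁ x₁' x₂, σret x₁ = some x₂ → σret x₁' = some x₂ → x₁ = x₁'
  retFresh : ∀ x₁ x₂, σret x₁ = some x₂ → x₂ ∉ S.vars ∧
    ∀ x : Var, x.input = true → x₂ ∉ (σcall x).vars
  retDom : ∀ x ∈ X.vars, x.input = false → (σret x).isSome
  update : UpdateOK S.ctx (callCtx S X (retSubst σcall σret)) S.mem σcall
    (retSubst σcall σret) τcall X.mem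

/-- The state type after a call. -/
noncomputable def callType (S : StateType) (b : Basic) (X : StateType) (σcall : Subst)
    (τcall : TSubst) (σret : Var → Option Var) : StateType where
  ctx := callCtx S X (retSubst σcall σret)
  regs := RegType.set (fun r => (X.regs r).map (Basic.subst (retSubst σcall σret) τcall)) .rsp b
  mem := updateMem S.ctx (callCtx S X (retSubst σcall σret)) S.mem σcall
    (retSubst σcall σret) τcall X.mem

/-! ## Typing of instructions, blocks, functions and programs -/

open Classical in
/-- The state type after an instruction that is typed and may fall through; `none` if the
instruction is not typed at `S`, or never falls through. -/
noncomputable def stepType (𝒯 : ProgType) (f : FName) (S : StateType) : Inst → Option StateType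
  | .movq src dst => (readType S src).bind fun b => writeType S b dst
  | .addq src dst =>
    (readType S src).bind fun b₁ => (readType S dst).bind fun b₀ =>
      let e := b₀.e.add b₁.e
      let t := b₀.t.join b₁.t
      if TopOK S.ctx e b₀.e b₁.e then
        (writeType S ⟨e, t⟩ dst).map fun S' =>
          { S' with regs := S'.regs.set .zf ⟨.bin .eq e (.const 0), t⟩ }
      else none
  | .cmpq src dst =>
    (readType S src).bind fun b₁ => (readType S dst).bind fun b₀ =>
      let e := b₀.e.sub b₁.e
      if TopOK S.ctx e b₀.e b₁.e then
        some { S with regs := S.regs.set .zf ⟨.bin .eq e (.const 0), b₀.t.join b₁.t⟩ }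
      else none
  | .leaq m r =>
    (S.regs (.gp m.base)).bind fun b => (S.regs (.gp m.idx)).bind fun i =>
      (addrType S.regs m).bind fun a =>
        if TopOK S.ctx a.e b.e i.e then some { S with regs := S.regs.set (.gp r) a } else none
  | .pushq r s τ =>
    (S.regs (.gp r)).bind fun v => (S.regs .rsp).bind fun b =>
      let a : Basic := ⟨b.e.sub (.const 8), b.t⟩
      if s.IsSpill ∧ ¬ τ.IsZero then
        (storeType S.ctx S.mem a s τ v).map fun c =>
          { S with regs := S.regs.set .rsp a, mem := S.mem.set s c }
      else none
  | .popq r s τ =>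
    (S.regs .rsp).bind fun b =>
      if r ≠ .rsp ∧ s.IsSpill ∧ ¬ τ.IsZero then
        (loadType S.ctx S.mem b s τ).map fun v =>
          { S with regs := (S.regs.set (.gp r) v).set .rsp ⟨b.e.add (.const 8), b.t⟩ }
      else none
  | .jne ℓ σ =>
    (S.regs .zf).bind fun z =>
      if z.t.IsZero ∧ (∃ e, z.e = .bin .eq e (.const 0) ∧ NonChange S.ctx e) ∧
          JumpOK 𝒯 f { S with ctx := insert (.bin .eq z.e (.const 0)) S.ctx } ℓ σ
      then some { S with ctx := insert z.e S.ctx } else none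
  | .callq g σcall τcall σret =>
    (S.regs .rsp).bind fun b => (𝒯 g .entry).bind fun E => (𝒯 g .ret).bind fun X =>
      if g ≠ .main ∧ CallOK S b E X σcall τcall σret then
        some (callType S b X σcall τcall σret)
      else none
  | .pushsecq _ _ _ => none
  | .popsecq _ _ _ => none
  | .jmp _ _ => none
  | .retq => none
  | .halt => none

/-- Typing of instruction sequences, which end with `jmp`, `retq` or `halt`. -/
def SeqTyped (𝒯 : ProgType) (f : FName) : StateType → List Inst → Prop
  | _, [] => False
  | S, [i] =>
    match i with
    | .jmp ℓ σ => JumpOK 𝒯 f S ℓ σ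
    | .retq => True
    | .halt => True
    | _ => False
  | S, i :: j :: I => ∃ S', stepType 𝒯 f S i = some S' ∧ SeqTyped 𝒯 f S' (j :: I)

/-- The state type at a program counter. -/
noncomputable def stateTypeAt (P : Program) (𝒯 : ProgType) (pc : PC) : Option StateType :=
  (P pc.fn pc.lbl).bind fun I => (𝒯 pc.fn pc.lbl).bind fun T =>
    (I.take pc.idx).foldlM (stepType 𝒯 pc.fn) T

/-- A slot is described by input variables, its base is a pointer, and slots on the local
stack have base `sp`. -/
structure SlotOK (s : Slot) : Prop where
  ptr : s.base.ptr = true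
  input : ∀ x ∈ s.vars, x.input = true
  localBase : s.IsLocalStack → s.base = .sp

/-- A well-typed function with entry type `E` and exit type `X`. -/
structure FuncTyped (P : Program) (𝒯 : ProgType) (f : FName) (E X : StateType) : Prop where
  entry : 𝒯 f .entry = some E
  exit : 𝒯 f .ret = some X
  dom : ∀ ℓ, (P f ℓ).isSome ↔ (𝒯 f ℓ).isSome
  blocks : ∀ ℓ I T, P f ℓ = some I → 𝒯 f ℓ = some T → SeqTyped 𝒯 f T I
  noExit : ∀ ℓ I, P f ℓ = some I → ℓ ≠ .ret → Inst.retq ∉ I ∧ Inst.halt ∉ I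
  retBlock : P f .ret = some [if f = .main then .halt else .retq]
  rsp : ∃ t₀ t₁, E.regs .rsp = some ⟨.var .sp, t₀⟩ ∧ X.regs .rsp = some ⟨.var .sp, t₁⟩ ∧
    t₀.IsZero ∧ t₁.IsZero
  retAddr : ∀ T, T = E ∨ T = X → ∀ s, (T.mem s).isSome →
    T.ctx.Disj s.region (.eight (.var .sp))
  localInvalid : ∀ T, T = E ∨ T = X → ∀ s c, T.mem s = some c → s.IsLocalStack →
    T.ctx.IsEmpty c.valid
  calleeSaved : ∀ r : Reg, r.calleeSaved = true →
    ∃ x t, E.regs r = some ⟨.var x, t⟩ ∧ X.regs r = some ⟨.var x, t⟩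
  exitMem : ∀ s c, X.mem s = some c → X.ctx.IsEmpty c.valid ∨ NonChange X.ctx c.val.e
  exitRegs : ∀ r b, X.regs r = some b → r.calleeSaved = false → NonChange X.ctx b.e
  ctx : ∀ ℓ T, 𝒯 f ℓ = some T → E.ctx ⊆ T.ctx
  entryInput : ∀ x ∈ E.vars, x.input = true
  slots : ∀ s, (E.mem s).isSome → SlotOK s
  slotsDisjoint : ∀ s s', (E.mem s).isSome → (E.mem s').isSome → s ≠ s' →
    E.ctx.Disj s.region s'.region
  memDom : ∀ ℓ T, 𝒯 f ℓ = some T → ∀ s, (T.mem s).isSome ↔ (E.mem s).isSome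
  uniformTaint : ∀ ℓ T, 𝒯 f ℓ = some T → ∀ s c c₀, T.mem s = some c → E.mem s = some c₀ →
    ¬ s.IsSpill → c.val.t.Equiv c₀.val.t
  validSub : ∀ ℓ T, 𝒯 f ℓ = some T → ∀ s c, T.mem s = some c → T.ctx.Sub c.valid s.region

/-- A well-typed program. -/
structure ProgTyped (P : Program) (𝒯 : ProgType) : Prop where
  dom : ∀ f, (∃ ℓ, (P f ℓ).isSome) ↔ ∃ ℓ, (𝒯 f ℓ).isSome
  funcs : ∀ f, (∃ ℓ, (P f ℓ).isSome) → ∃ E X, FuncTyped P 𝒯 f E X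

/-! ## The abstract machine -/

abbrev RegFile := Reg → Word × Bool
abbrev Memory := Word → Byte × Bool

/-- A frame: program counter and values of the input variables, taint variables and block
variables. -/
structure Frame where
  pc : PC
  σf : Valuation
  θ : TVar → Bool
  σb : Valuation

/-- The values of all type variables, `σf ∪ σb`. -/
def Frame.val (fr : Frame) : Valuation := fun x => if x.input then fr.σf x else fr.σb x

/-- A machine state; the current frame comes first. -/
structure State where
  R : RegFile
  M : Memory
  Φ : List Frame

/-- Read eight bytes (little-endian); the taint is the join of the taints of the bytes. -/
def Memory.read (M : Memory) (a : Word) : Word × Bool :=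
  (BitVec.ofNat 64 (((List.range 8).map fun i =>
      (M (a + BitVec.ofNat 64 i)).1.toNat * 256 ^ i).sum),
   (List.range 8).any fun i => (M (a + BitVec.ofNat 64 i)).2)

/-- Write eight bytes (little-endian). -/
def Memory.write (M : Memory) (a : Word) (v : Word × Bool) : Memory := fun x =>
  if x - a < 8 then (v.1.extractLsb' (8 * (x - a).toNat) 8, v.2) else M x

def RegFile.set (R : RegFile) (r : Reg) (v : Word × Bool) : RegFile := Function.update R r v

/-- Effective address; the machine gets stuck if it is tainted. -/
def effAddr (R : RegFile) (m : MemOp) : Option Word :=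
  if (R (.gp m.base)).2 = false ∧ (R (.gp m.idx)).2 = false then
    some ((R (.gp m.base)).1 + (R (.gp m.idx)).1 * m.scale + m.disp)
  else none

/-- Load at `a`, checked against the taint annotation. -/
def loadVal (M : Memory) (θ : TVar → Bool) (a : Word) (τ : Taint) : Option (Word × Bool) :=
  if (M.read a).2 = true → τ.eval θ = true then some (M.read a) else none

/-- Store at `a`, checked against the taint annotation. -/
def storeVal (M : Memory) (θ : TVar → Bool) (a : Word) (τ : Taint) (v : Word × Bool) :
    Option Memory :=
  if v.2 = true → τ.eval θ = true then some (M.write a v) else none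

def readVal (R : RegFile) (M : Memory) (θ : TVar → Bool) : Operand → Option (Word × Bool)
  | .reg r => some (R (.gp r))
  | .imm v => some (v, false)
  | .mem m => (effAddr R m).bind fun a => loadVal M θ a m.taint

def writeVal (R : RegFile) (M : Memory) (θ : TVar → Bool) (v : Word × Bool) :
    Operand → Option (RegFile × Memory)
  | .reg r => some (R.set (.gp r) v, M)
  | .imm _ => none
  | .mem m => (effAddr R m).bind fun a => (storeVal M θ a m.taint v).map fun M' => (R, M')

/-- Instantiate a substitution with the values of a frame. -/
def Frame.inst (fr : Frame) (σ : Subst) : Valuation := fun x => ((σ x).eval fr.val).getD 0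

/-- The zero flag for a result. -/
def flagVal (v : Word × Bool) : Word × Bool := (boolWord (v.1 == 0), v.2)

open Classical in
/-- The block variables of the caller after a return: `(σb ∘ σret⁻¹) ∪ σbₚ`. -/
noncomputable def retVals (σb σbp : Valuation) (σret : Var → Option Var) : Valuation := fun y =>
  if h : ∃ x, σret x = some y then σb (Classical.choose h) else σbp y

/-- Memory layout: initial stack pointer, the shift `δ`, and the regions outside the stack. -/
structure MemConfig where
  spInit : Word
  δ : Word
  otherPub : Set Word
  otherSec : Set Word
  stack_disj : Disjoint (interval (spInit + δ) spInit) (interval (spInit + 2 * δ) (spInit + δ))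
  other_disj : Disjoint otherPub otherSec
  pub_disj : Disjoint otherPub
    (interval (spInit + δ) spInit ∪ interval (spInit + 2 * δ) (spInit + δ))
  sec_disj : Disjoint otherSec
    (interval (spInit + δ) spInit ∪ interval (spInit + 2 * δ) (spInit + δ))

def MemConfig.stackPub (cfg : MemConfig) : Set Word :=
  interval (cfg.spInit + cfg.δ) cfg.spInit

def MemConfig.stackSec (cfg : MemConfig) : Set Word :=
  interval (cfg.spInit + 2 * cfg.δ) (cfg.spInit + cfg.δ)

/-- Execute one instruction of `P`. `addr` gives the code addresses used as return addresses.
`pushsecq` and `popsecq` access the secret stack at distance `δ`. -/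
noncomputable def exec (cfg : MemConfig) (addr : PC → Word) (P : Program) (R : RegFile)
    (M : Memory) (fr : Frame) (Φ : List Frame) : Inst → Option State
  | .movq src dst =>
    (readVal R M fr.θ src).bind fun v => (writeVal R M fr.θ v dst).map fun RM =>
      ⟨RM.1, RM.2, { fr with pc := fr.pc.next } :: Φ⟩
  | .addq src dst =>
    (readVal R M fr.θ src).bind fun v₁ => (readVal R M fr.θ dst).bind fun v₀ =>
      let v := (v₀.1 + v₁.1, v₀.2 || v₁.2)
      (writeVal R M fr.θ v dst).map fun RM =>
        ⟨RM.1.set .zf (flagVal v), RM.2, { fr with pc := fr.pc.next } :: Φ⟩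
  | .cmpq src dst =>
    (readVal R M fr.θ src).bind fun v₁ => (readVal R M fr.θ dst).map fun v₀ =>
      ⟨R.set .zf (flagVal (v₀.1 - v₁.1, v₀.2 || v₁.2)), M, { fr with pc := fr.pc.next } :: Φ⟩
  | .leaq m r =>
    some ⟨R.set (.gp r) ((R (.gp m.base)).1 + (R (.gp m.idx)).1 * m.scale + m.disp,
        (R (.gp m.base)).2 || (R (.gp m.idx)).2), M, { fr with pc := fr.pc.next } :: Φ⟩
  | .pushq r _ τ =>
    if (R .rsp).2 = false then
      (storeVal M fr.θ ((R .rsp).1 - 8) τ (R (.gp r))).map fun M' =>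
        ⟨R.set .rsp ((R .rsp).1 - 8, false), M', { fr with pc := fr.pc.next } :: Φ⟩
    else none
  | .popq r _ τ =>
    if (R .rsp).2 = false then
      (loadVal M fr.θ (R .rsp).1 τ).map fun v =>
        ⟨(R.set (.gp r) v).set .rsp ((R .rsp).1 + 8, false), M,
          { fr with pc := fr.pc.next } :: Φ⟩
    else none
  | .pushsecq r _ τ =>
    if (R .rsp).2 = false then
      (storeVal M fr.θ ((R .rsp).1 - 8 + cfg.δ) τ (R (.gp r))).map fun M' =>
        ⟨R.set .rsp ((R .rsp).1 - 8, false), M', { fr with pc := fr.pc.next } :: Φ⟩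
    else none
  | .popsecq r _ τ =>
    if (R .rsp).2 = false then
      (loadVal M fr.θ ((R .rsp).1 + cfg.δ) τ).map fun v =>
        ⟨(R.set (.gp r) v).set .rsp ((R .rsp).1 + 8, false), M,
          { fr with pc := fr.pc.next } :: Φ⟩
    else none
  | .jne ℓ σ =>
    if (R .zf).2 = false then
      if (R .zf).1 ≠ 0 then some ⟨R, M, { fr with pc := fr.pc.next } :: Φ⟩
      else if (P fr.pc.fn ℓ).isSome then
        some ⟨R, M, { fr with pc := ⟨fr.pc.fn, ℓ, 0⟩, σb := fr.inst σ } :: Φ⟩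
      else none
    else none
  | .jmp ℓ σ =>
    if (P fr.pc.fn ℓ).isSome then
      some ⟨R, M, { fr with pc := ⟨fr.pc.fn, ℓ, 0⟩, σb := fr.inst σ } :: Φ⟩
    else none
  | .callq f σcall τcall _ =>
    if (R .rsp).2 = false ∧ (P f .entry).isSome then
      some ⟨R.set .rsp ((R .rsp).1 - 8, false),
        M.write ((R .rsp).1 - 8) (addr fr.pc.next, false),
        ⟨⟨f, .entry, 0⟩, fr.inst σcall, fun x => (τcall x).eval fr.θ, fun _ => 0⟩ :: fr :: Φ⟩
    else none
  | .retq =>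
    match Φ with
    | [] => none
    | p :: Φ₀ =>
      match getInst P p.pc with
      | some (.callq _ _ _ σret) =>
        if (R .rsp).2 = false ∧ M.read (R .rsp).1 = (addr p.pc.next, false) then
          some ⟨R.set .rsp ((R .rsp).1 + 8, false), M,
            { p with pc := p.pc.next, σb := retVals fr.σb p.σb σret } :: Φ₀⟩
        else none
      | _ => none
  | .halt => none

/-- `S` steps to `S₁` by executing `i`. -/
def Step (cfg : MemConfig) (addr : PC → Word) (P : Program) (S : State) (i : Inst)
    (S₁ : State) : Prop :=
  ∃ fr Φ, S.Φ = fr :: Φ ∧ getInst P fr.pc = some i ∧ exec cfg addr P S.R S.M fr Φ i = some S₁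

/-- `S` steps to `S₁` by executing exactly the listed instructions, in this order. -/
inductive Steps (cfg : MemConfig) (addr : PC → Word) (P : Program) :
    State → List Inst → State → Prop
  | nil (S) : Steps cfg addr P S [] S
  | cons {S S₁ S₂ : State} {i : Inst} {is : List Inst} :
      Step cfg addr P S i S₁ → Steps cfg addr P S₁ is S₂ → Steps cfg addr P S (i :: is) S₂

/-- A termination state: the next instruction is `halt`. -/
def Terminal (P : Program) (S : State) : Prop :=
  ∃ fr Φ, S.Φ = fr :: Φ ∧ getInst P fr.pc = some .halt

/-! ## Well-formed states -/

/-- The initialized region `X` of a slot holds data of value type `e` and taint `t`. -/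
def MemSlotTyped (M : Memory) (X : Set Word) (e : Option Word) (t : Bool) : Prop :=
  (∀ x ∈ X, (M x).2 = true → t = true) ∧
  (e = none ∨ X = ∅ ∨ ∃ a, X = interval a (a + 8) ∧ some (M.read a).1 = e)

def RegsTyped (R : RegFile) (ρ : Valuation) (θ : TVar → Bool) (ℛ : RegType) : Prop :=
  ∀ r b, ℛ r = some b →
    (b.e.eval ρ = none ∨ b.e.eval ρ = some (R r).1) ∧ ((R r).2 = true → b.t.eval θ = true)

def MemTyped (cfg : MemConfig) (M : Memory) (ρ : Valuation) (θ : TVar → Bool)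
    (ℳ : MemType) : Prop :=
  ∀ s c, ℳ s = some c →
    (s.region.denote ρ ⊆ cfg.stackPub ∨ s.region.denote ρ ⊆ cfg.otherPub ∨
      s.region.denote ρ ⊆ cfg.otherSec) ∧
    (s.IsSpill → s.region.denote ρ ⊆ cfg.stackPub) ∧
    ((s.region.denote ρ).Nonempty → s.region.denote ρ ⊆ cfg.otherPub → c.val.t.eval θ = false) ∧
    c.valid.denote ρ ⊆ s.region.denote ρ ∧
    MemSlotTyped M (c.valid.denote ρ) (c.val.e.eval ρ) (c.val.t.eval θ)

structure StateTyped (cfg : MemConfig) (R : RegFile) (M : Memory) (fr : Frame)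
    (T : StateType) : Prop where
  ctx : Sat fr.val T.ctx
  regs : RegsTyped R fr.val fr.θ T.regs
  mem : MemTyped cfg M fr.val fr.θ T.mem
  slotVars : ∀ s, (T.mem s).isSome → ∀ x ∈ s.vars, x.input = true

/-- The addresses of all slots. -/
def getDom (ℳ : MemType) (σ : Valuation) : Set Word :=
  {x | ∃ s, (ℳ s).isSome ∧ x ∈ s.region.denote σ}

/-- The eight bytes that hold the return address of a frame. -/
def Frame.retRegion (fr : Frame) : Set Word := interval (fr.σf .sp) (fr.σf .sp + 8)

/-- Well-formed machine states. -/
inductive WellFormedAt (cfg : MemConfig) (addr : PC → Word) (P : Program) (𝒯 : ProgType) :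
    RegFile → Memory → List Frame → Prop
  | base {R : RegFile} {M : Memory} {fr : Frame} {T : StateType} :
      ProgTyped P 𝒯 → fr.pc.fn = .main → stateTypeAt P 𝒯 fr.pc = some T →
      StateTyped cfg R M fr T → WellFormedAt cfg addr P 𝒯 R M [fr]
  | call {R : RegFile} {M : Memory} {fr : Frame} {T : StateType} {Rp : RegFile} {Mp : Memory}
      {p : Frame} {Φ : List Frame} {σcall : Subst} {τcall : TSubst} {σret : Var → Option Var} :
      ProgTyped P 𝒯 → fr.pc.fn ≠ .main → stateTypeAt P 𝒯 fr.pc = some T →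
      StateTyped cfg R M fr T →
      M.read (fr.σf .sp) = (addr p.pc.next, false) →
      (∀ x, x ∉ getDom T.mem fr.val ∪ fr.retRegion → M x = Mp x) →
      getInst P p.pc = some (.callq fr.pc.fn σcall τcall σret) →
      (∀ x : Var, x.input = true → fr.σf x = p.inst σcall x) →
      (∀ x, fr.θ x = (τcall x).eval p.θ) →
      WellFormedAt cfg addr P 𝒯 Rp Mp (p :: Φ) →
      WellFormedAt cfg addr P 𝒯 R M (fr :: p :: Φ)

def WellFormed (cfg : MemConfig) (addr : PC → Word) (P : Program) (𝒯 : ProgType)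
    (S : State) : Prop :=
  WellFormedAt cfg addr P 𝒯 S.R S.M S.Φ

/-! ## The transformation -/

/-- The strategy for slot `s` is to shift its pointer (`TransPtr`); otherwise it is to shift
the operands that access it (`TransOp`). -/
def TransPtr (ℳ : MemType) (s : Slot) : Prop :=
  s.base ≠ .sp ∧ ∀ s₁ c₁ s₂ c₂, ℳ s₁ = some c₁ → ℳ s₂ = some c₂ →
    s₁.base = s.base → s₂.base = s.base → c₁.val.t.Equiv c₂.val.t

/-- The assertion made when strategies are chosen. -/
def StrategyOK (ℳ : MemType) : Prop :=
  ∀ s c, ℳ s = some c → ¬ TransPtr ℳ s → s.IsLocalStack ∨ c.val.t.IsZero ∨ c.val.t.IsOne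

open Classical in
noncomputable def transMemOp (δ : Word) (ℳ : MemType) (m : MemOp) : MemOp :=
  if ¬ TransPtr ℳ m.slot ∧ ¬ m.taint.IsZero then
    { m with disp := δ + m.disp, slot := m.slot.shift δ }
  else m

/-- Operand shifting. -/
noncomputable def transOp (δ : Word) (ℳ : MemType) : Operand → Operand
  | .mem m => .mem (transMemOp δ ℳ m)
  | o => o

/-- The pointers that have to be shifted at a call from state type `S` to entry type `E`. -/
def shiftedPtrs (S E : StateType) (σcall : Subst) (τcall : TSubst) : Set Var :=
  {x | ∃ s c p, E.mem s = some c ∧ s.base = x ∧ TransPtr E.mem s ∧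
    findSlot S.ctx S.mem σcall s = some p ∧ ¬ TransPtr S.mem p ∧ ¬ (c.val.t.subst τcall).IsZero}

open Classical in
/-- The annotation of the transformed call. -/
noncomputable def shiftSubst (δ : Word) (X : Set Var) (σ : Subst) : Subst := fun x =>
  if x ∈ X then (σ x).add (.const δ) else σ x

/-- Register `r` holds one of the pointers `X`. -/
def HoldsPtr (E : StateType) (X : Set Var) (r : Reg) : Prop :=
  ∃ x ∈ X, ∃ t, E.regs r = some ⟨.var x, t⟩

open Classical in
/-- The instructions that shift pointer arguments before a call. -/
noncomputable def shiftInsts (δ : Word) (E : StateType) (X : Set Var) : List Inst :=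
  (GPR.all.filter fun r => decide (HoldsPtr E X (.gp r))).map fun r => .addq (.imm δ) (.reg r)

/-- The assertions of pointer-argument shifting. -/
structure CallTransOK (δ : Word) (S E : StateType) (σcall : Subst) (τcall : TSubst) : Prop where
  strategy : StrategyOK E.mem
  slots : ∀ s c, E.mem s = some c → ∃ p, findSlot S.ctx S.mem σcall s = some p ∧
    (p.IsSpill → S.ctx.IsEmpty (c.valid.subst σcall)) ∧
    (¬ TransPtr E.mem s → ¬ TransPtr S.mem p)
  nonChange : ∀ x ∈ shiftedPtrs S E σcall τcall, x.nonChange = false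
  reg : ∀ x ∈ shiftedPtrs S E σcall τcall, ∃ r t, E.regs (.gp r) = some ⟨.var x, t⟩ ∧
    t.IsZero ∧ Reg.calleeSaved (.gp r) = false ∧
    ∀ r' t', E.regs r' = some ⟨.var x, t'⟩ → r' = .gp r
  otherRegs : ∀ r b, E.regs r = some b → ¬ HoldsPtr E (shiftedPtrs S E σcall τcall) r →
    ∀ ρ, (b.e.subst (shiftSubst δ (shiftedPtrs S E σcall τcall) σcall)).eval ρ =
      (b.e.subst σcall).eval ρ
  mem : ∀ s c, E.mem s = some c →
    ∀ ρ, (c.val.e.subst (shiftSubst δ (shiftedPtrs S E σcall τcall) σcall)).eval ρ =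
      (c.val.e.subst σcall).eval ρ
  flag : (shiftedPtrs S E σcall τcall).Nonempty → E.regs .zf = none

open Classical in
/-- The transformation of one instruction at state type `S`; `none` if an assertion fails. -/
noncomputable def transInst (δ : Word) (𝒯 : ProgType) (S : StateType) :
    Inst → Option (List Inst)
  | .movq a b => some [.movq (transOp δ S.mem a) (transOp δ S.mem b)]
  | .addq a b => some [.addq (transOp δ S.mem a) (transOp δ S.mem b)]
  | .cmpq a b => some [.cmpq (transOp δ S.mem a) (transOp δ S.mem b)]
  | .pushq r s τ => some [.pushsecq r (s.shift δ) τ]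
  | .popq r s τ => some [.popsecq r (s.shift δ) τ]
  | .callq f σcall τcall σret =>
    (𝒯 f .entry).bind fun E =>
      if CallTransOK δ S E σcall τcall then
        some (shiftInsts δ E (shiftedPtrs S E σcall τcall) ++
          [.callq f (shiftSubst δ (shiftedPtrs S E σcall τcall) σcall) τcall σret])
      else none
  | i => some [i]

open Classical in
/-- The transformation of an instruction sequence. -/
noncomputable def transSeq (δ : Word) (𝒯 : ProgType) (f : FName) :
    StateType → List Inst → Option (List Inst)
  | _, [] => some []
  | S, i :: I =>
    if StrategyOK S.mem then
      (transInst δ 𝒯 S i).bind fun is =>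
        if I = [] then some is
        else (stepType 𝒯 f S i).bind fun S' => (transSeq δ 𝒯 f S' I).map fun J => is ++ J
    else none

/-- `P'` is the transformation of `P`, on which no assertion fails. -/
def Transforms (cfg : MemConfig) (𝒯 : ProgType) (P P' : Program) : Prop :=
  ∀ f ℓ, (P f ℓ = none → P' f ℓ = none) ∧
    ∀ I, P f ℓ = some I → ∃ T I', 𝒯 f ℓ = some T ∧ transSeq cfg.δ 𝒯 f T I = some I' ∧
      P' f ℓ = some I'

/-- The transformation of the instruction at `pc`. -/
noncomputable def transInstAt (cfg : MemConfig) (P : Program) (𝒯 : ProgType) (pc : PC) :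
    Option (List Inst) :=
  (getInst P pc).bind fun i => (stateTypeAt P 𝒯 pc).bind fun T => transInst cfg.δ 𝒯 T i

/-- The transformation of the instruction sequence that starts at `pc`. -/
noncomputable def transSeqAt (cfg : MemConfig) (P : Program) (𝒯 : ProgType) (pc : PC) :
    Option (List Inst) :=
  (seqAt P pc).bind fun I => (stateTypeAt P 𝒯 pc).bind fun T => transSeq cfg.δ 𝒯 pc.fn T I

/-! ## The simulation relation -/

/-- Both program counters are in the same function, and the instructions from `pc'` on are the
transformation of those from `pc` on. -/
def SimPC (cfg : MemConfig) (P P' : Program) (𝒯 : ProgType) (pc' pc : PC) : Prop :=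
  pc'.fn = pc.fn ∧ ∃ J, transSeqAt cfg P 𝒯 pc = some J ∧ seqAt P' pc' = some J

/-- Related values: equal if the type is unknown, otherwise both given by the type. -/
def SimVal (e : Exp) (ρ' ρ : Valuation) (v' v : Word × Bool) : Prop :=
  v'.2 = v.2 ∧ (e.HasTop ∧ v'.1 = v.1 ∨
    ¬ e.HasTop ∧ e.eval ρ' = some v'.1 ∧ e.eval ρ = some v.1)

def SimRegs (ℛ : RegType) (ρ' ρ : Valuation) (R' R : RegFile) : Prop :=
  ∀ r b, ℛ r = some b → SimVal b.e ρ' ρ (R' r) (R r)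

/-- Related contents of the region `X` in `M` and of `X` moved by `d` in `M'`. -/
def SimData (e : Exp) (ρ' ρ : Valuation) (M' M : Memory) (X : Set Word) (d : Word) : Prop :=
  X = ∅ ∨ ((∀ x ∈ X, (M' (x + d)).2 = (M x).2) ∧
    (e.HasTop ∧ (∀ x ∈ X, (M' (x + d)).1 = (M x).1) ∨
      ¬ e.HasTop ∧ ∃ a, X = interval a (a + 8) ∧ e.eval ρ' = some (M'.read (a + d)).1 ∧
        e.eval ρ = some (M.read a).1))

open Classical in
/-- How far the operands that access a slot are shifted. -/
noncomputable def getOpShift (δ : Word) (ℳ : MemType) (s : Slot) (c : Cell) : Word :=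
  if TransPtr ℳ s ∨ c.val.t.IsZero then 0 else δ

open Classical in
/-- The possible shifts of the pointer to a slot. -/
noncomputable def getPtrShift (cfg : MemConfig) (ℳ : MemType) (ρ : Valuation) (θ : TVar → Bool)
    (s : Slot) (c : Cell) : Set Word :=
  if ¬ TransPtr ℳ s ∨ ¬ s.region.denote ρ ⊆ cfg.stackPub ∪ cfg.stackSec then {0}
  else if c.val.t.eval θ = true ∧ (s.region.denote ρ).Nonempty then {cfg.δ}
  else {0, cfg.δ}

/-- `σ'(x) - σ(x)` for the base pointer `x` of the slot. -/
def ptrDiff (ρ' ρ : Valuation) (s : Slot) : Word := ρ' s.base - ρ s.base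

def SimMem (cfg : MemConfig) (ℳ : MemType) (θ : TVar → Bool) (ρ' ρ : Valuation)
    (M' M : Memory) : Prop :=
  ∀ s c, ℳ s = some c →
    (¬ TransPtr ℳ s → s.region.denote ρ ⊆ cfg.stackPub ∧
      (s.IsLocalStack ∨ c.val.t.IsZero ∨ c.val.t.IsOne)) ∧
    ptrDiff ρ' ρ s ∈ getPtrShift cfg ℳ ρ θ s c ∧
    SimData c.val.e ρ' ρ M' M (c.valid.denote ρ) (ptrDiff ρ' ρ s + getOpShift cfg.δ ℳ s c)

/-- The part of the simulation relation that concerns the current frames. -/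
structure SimHelper (cfg : MemConfig) (P P' : Program) (𝒯 : ProgType) (T : StateType)
    (R' : RegFile) (M' : Memory) (fr' : Frame) (R : RegFile) (M : Memory) (fr : Frame) :
    Prop where
  pc : SimPC cfg P P' 𝒯 fr'.pc fr.pc
  type : stateTypeAt P 𝒯 fr.pc = some T
  typed : StateTyped cfg R M fr T
  vars : AgreeNC fr.val fr'.val
  taints : fr'.θ = fr.θ
  regs : SimRegs T.regs fr'.val fr.val R' R
  mem : SimMem cfg T.mem fr.θ fr'.val fr.val M' M

/-- The region `X` moved by `d`. -/
def moved (X : Set Word) (d : Word) : Set Word := {x | x - d ∈ X}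

open Classical in
/-- The addresses at which the data of a slot may be stored after relocation. -/
noncomputable def getPossibleSlot (δ : Word) (ℳ : MemType) (ρ' ρ : Valuation) (s : Slot) :
    Set Word :=
  if TransPtr ℳ s then moved (s.region.denote ρ) (ptrDiff ρ' ρ s)
  else s.region.denote ρ ∪ moved (s.region.denote ρ) δ

noncomputable def getShiftedDom (δ : Word) (ℳ : MemType) (ρ' ρ : Valuation) : Set Word :=
  {x | ∃ s, (ℳ s).isSome ∧ x ∈ getPossibleSlot δ ℳ ρ' ρ s}

/-- The simulation relation. The memories `Mp`, `Mp'` are those at the call; `pc₀` is the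
program counter of the first instruction of the transformed call. -/
inductive SimAt (cfg : MemConfig) (addr addr' : PC → Word) (P P' : Program) (𝒯 : ProgType) :
    RegFile → Memory → List Frame → RegFile → Memory → List Frame → Prop
  | base {R' R : RegFile} {M' M : Memory} {fr' fr : Frame} {T : StateType} :
      SimHelper cfg P P' 𝒯 T R' M' fr' R M fr →
      WellFormedAt cfg addr P 𝒯 R M [fr] →
      SimAt cfg addr addr' P P' 𝒯 R' M' [fr'] R M [fr]
  | call {R' R Rp' Rp : RegFile} {M' M Mp' Mp : Memory} {fr' fr p' p : Frame}
      {Φ' Φ : List Frame} {T : StateType} {σcall : Subst} {τcall : TSubst}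
      {σret : Var → Option Var} {pc₀ : PC} {is : List Inst} :
      SimHelper cfg P P' 𝒯 T R' M' fr' R M fr →
      WellFormedAt cfg addr P 𝒯 R M (fr :: p :: Φ) →
      getInst P' p'.pc = some (.callq fr'.pc.fn σcall τcall σret) →
      (∀ x : Var, x.input = true → fr'.σf x = p'.inst σcall x) →
      (∀ x, fr'.θ x = (τcall x).eval p'.θ) →
      transInstAt cfg P 𝒯 p.pc = some is →
      p'.pc = { pc₀ with idx := pc₀.idx + (is.length - 1) } →
      SimAt cfg addr addr' P P' 𝒯 Rp' Mp' ({ p' with pc := pc₀ } :: Φ') Rp Mp (p :: Φ) →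
      M.read (fr.σf .sp) = (addr p.pc.next, false) →
      M'.read (fr.σf .sp) = (addr' p'.pc.next, false) →
      (∀ x, x ∉ getDom T.mem fr.val ∪ fr.retRegion → M x = Mp x) →
      (∀ x, x ∉ getShiftedDom cfg.δ T.mem fr'.val fr.val ∪ fr.retRegion → M' x = Mp' x) →
      SimAt cfg addr addr' P P' 𝒯 R' M' (fr' :: p' :: Φ') R M (fr :: p :: Φ)

/-- `S' ≺ S`. -/
def Sim (cfg : MemConfig) (addr addr' : PC → Word) (P P' : Program) (𝒯 : ProgType)
    (S' S : State) : Prop :=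
  SimAt cfg addr addr' P P' 𝒯 S'.R S'.M S'.Φ S.R S.M S.Φ

end Octal

namespace Octal

/-! ## Expressions, substitutions, taints -/

/-! The secret stack is the public stack translated by δ, and no slot ever occupies it. In the
transformed run the data of a slot lies at a fixed distance from its original place: the
displacement of the base pointer (`ptrDiff`) plus that of the operands (`getOpShift`). A TransPtr
slot has no operand shift and a TransOp slot has no pointer shift, so the distance is 0 or δ, and it
can be δ only for a region in the public stack (`SlotRel.shiftOK`). Consequently disjoint regions
stay disjoint under all admissible distances (`MemConfig.ShiftOK.ne`). This geometric fact is what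
protects other slots, return addresses and the memory of callers from the stores of the transformed
program.

Values are compared through their types. A known type gives the value in both runs, under two
valuations that agree on marked variables; an unknown type demands equal values. Wherever typing
forgets a value it requires `NonChange`, and for such a type related values are already equal
(`SimVal.eq_of_nonChange`). An address at a `NonChange` offset from the base pointer moves exactly
with that pointer, so after the operand shift it meets the related data (`Rel.load`, `Rel.store`).
All this takes place in `Rel`, which collects the typing and simulation conditions on the current
frame slot by slot.

Within a function every state type has the same slots, with the same taints outside spill slots
(`MemLike`). Strategies and distances therefore persist, and a jump only reinterprets the data under
new block variables (`Rel.jump`). Branch conditions are `NonChange`, so both runs take the same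
branch.

At a call, initialized data has the same distance in the callee's slot as in the caller's slot that
contains it: if the callee uses TransPtr where the caller uses TransOp, the shift of the pointer
argument replaces the shift of the operands (`CallRel.slotShift_eq`). Nothing has to be copied, and
`Rel.enter` follows. At a return the exit types are `NonChange`, except for callee-saved registers,
whose types are variables that are never shifted. Hence the shifted arguments leave no trace in the
caller, while data outside the callee's slots is intact by the frame conditions (`Rel.leave`).
Finally, `SimAt.relocate` carries the rest of the call stack along, because a step changes memory
only inside the slots of the current function. -/

theorem Exp.eval_eq_none {ρ : Valuation} {e : Exp} : e.eval ρ = none ↔ e.HasTop := by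
  induction e with
  | var x => simp [Exp.eval, Exp.HasTop]
  | const v => simp [Exp.eval, Exp.HasTop]
  | top => simp [Exp.eval, Exp.HasTop]
  | un o e ih => simp [Exp.eval, Exp.HasTop, ih]
  | bin o a b iha ihb =>
    simp only [Exp.eval, Exp.HasTop, ← iha, ← ihb]
    cases a.eval ρ <;> cases b.eval ρ <;> simp

theorem Exp.exists_eval {e : Exp} (h : ¬ e.HasTop) (ρ : Valuation) : ∃ v, e.eval ρ = some v := by
  rw [← Exp.eval_eq_none (ρ := ρ)] at h
  exact Option.ne_none_iff_exists'.1 h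

theorem Exp.not_hasTop_of_eval {e : Exp} {ρ : Valuation} {v : Word} (h : e.eval ρ = some v) :
    ¬ e.HasTop := by
  rw [← Exp.eval_eq_none (ρ := ρ), h]; simp

theorem Exp.eval_congr {ρ ρ' : Valuation} {e : Exp} (h : ∀ x ∈ e.vars, ρ x = ρ' x) :
    e.eval ρ = e.eval ρ' := by
  induction e with
  | var x => simp [Exp.eval, h x (by simp [Exp.vars])]
  | const v => rfl
  | top => rfl
  | un o e ih => simp [Exp.eval, ih h]
  | bin o a b iha ihb =>
    simp [Exp.eval, iha fun x hx => h x (Or.inl hx), ihb fun x hx => h x (Or.inr hx)]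

/-- The hypothesis concerns only variables that occur in `e`, because at a call the annotation is
controlled on input variables alone. -/
theorem Exp.eval_subst {ρ ρ₁ : Valuation} {σ : Subst} {e : Exp}
    (h : ∀ x ∈ e.vars, (σ x).eval ρ = some (ρ₁ x)) : (e.subst σ).eval ρ = e.eval ρ₁ := by
  induction e with
  | var x => simp [Exp.eval, Exp.subst, h x (by simp [Exp.vars])]
  | const v => rfl
  | top => rfl
  | un o e ih => simp [Exp.eval, Exp.subst, ih h]
  | bin o a b iha ihb =>
    simp [Exp.eval, Exp.subst, iha fun x hx => h x (Or.inl hx), ihb fun x hx => h x (Or.inr hx)]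

theorem Exp.hasTop_subst {σ : Subst} (h : ∀ x, ¬ (σ x).HasTop) {e : Exp} :
    (e.subst σ).HasTop ↔ e.HasTop := by
  induction e with
  | var x => simp [Exp.subst, Exp.HasTop, h x]
  | const v => rfl
  | top => rfl
  | un o e ih => simpa [Exp.HasTop, Exp.subst] using ih
  | bin o a b iha ihb => simp [Exp.HasTop, Exp.subst, iha, ihb]

theorem Region.denote_congr {ρ ρ' : Valuation} {X : Region} (h : ∀ x ∈ X.vars, ρ x = ρ' x) :
    X.denote ρ = X.denote ρ' := by
  induction X with
  | empty => rfl
  | range a b =>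
    simp [Region.denote, Exp.eval_congr (e := a) fun x hx => h x (Or.inl hx),
      Exp.eval_congr (e := b) fun x hx => h x (Or.inr hx)]
  | union X Y ihX ihY =>
    simp [Region.denote, ihX fun x hx => h x (Or.inl hx), ihY fun x hx => h x (Or.inr hx)]
  | diff X Y ihX ihY =>
    simp [Region.denote, ihX fun x hx => h x (Or.inl hx), ihY fun x hx => h x (Or.inr hx)]

theorem Region.denote_subst {ρ ρ₁ : Valuation} {σ : Subst} {X : Region}
    (h : ∀ x ∈ X.vars, (σ x).eval ρ = some (ρ₁ x)) : (X.subst σ).denote ρ = X.denote ρ₁ := by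
  induction X with
  | empty => rfl
  | range a b =>
    simp [Region.denote, Region.subst, Exp.eval_subst (e := a) fun x hx => h x (Or.inl hx),
      Exp.eval_subst (e := b) fun x hx => h x (Or.inr hx)]
  | union X Y ihX ihY =>
    simp [Region.denote, Region.subst, ihX fun x hx => h x (Or.inl hx),
      ihY fun x hx => h x (Or.inr hx)]
  | diff X Y ihX ihY =>
    simp [Region.denote, Region.subst, ihX fun x hx => h x (Or.inl hx),
      ihY fun x hx => h x (Or.inr hx)]

theorem Slot.region_vars (s : Slot) : s.region.vars ⊆ s.vars := by
  intro x hx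
  simpa [Slot.region, Region.vars, Exp.vars, Slot.vars, or_assoc, or_left_comm] using hx

theorem Slot.base_mem_vars (s : Slot) : s.base ∈ s.vars := by simp [Slot.vars]

theorem Region.denote_eight {ρ : Valuation} {e : Exp} {a : Word} (h : e.eval ρ = some a) :
    (Region.eight e).denote ρ = interval a (a + 8) := by
  simp [Region.denote, Exp.eval, h, BinOp.eval]

theorem Taint.eval_subst (θ : TVar → Bool) (τ : TSubst) (t : Taint) :
    (t.subst τ).eval θ = t.eval fun x => (τ x).eval θ := by
  induction t with
  | var x => rfl
  | zero => rfl
  | one => rfl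
  | join a b iha ihb => simp [Taint.subst, Taint.eval, iha, ihb]

theorem Taint.Equiv.symm {a b : Taint} (h : a.Equiv b) : b.Equiv a := fun θ => (h θ).symm

theorem Taint.Equiv.trans {a b c : Taint} (h : a.Equiv b) (h' : b.Equiv c) : a.Equiv c :=
  fun θ => (h θ).trans (h' θ)

theorem Taint.Equiv.refl (a : Taint) : a.Equiv a := fun _ => rfl

theorem Taint.Equiv.isZero_iff {a b : Taint} (h : a.Equiv b) : a.IsZero ↔ b.IsZero :=
  ⟨fun h' => h.symm.trans h', fun h' => h.trans h'⟩

theorem Taint.Equiv.isOne_iff {a b : Taint} (h : a.Equiv b) : a.IsOne ↔ b.IsOne :=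
  ⟨fun h' => h.symm.trans h', fun h' => h.trans h'⟩

theorem Taint.Equiv.subst {a b : Taint} (h : a.Equiv b) (τ : TSubst) :
    (a.subst τ).Equiv (b.subst τ) := fun θ => by simp [Taint.eval_subst, h _]

theorem Taint.subst_var (t : Taint) : t.subst .var = t := by
  induction t with
  | var x => rfl
  | zero => rfl
  | one => rfl
  | join a b iha ihb => simp [Taint.subst, iha, ihb]

theorem AgreeNC.refl (ρ : Valuation) : AgreeNC ρ ρ := fun _ _ => rfl

theorem Sat.mono {ρ : Valuation} {Δ Δ' : Ctx} (h : Sat ρ Δ') (hs : Δ ⊆ Δ') : Sat ρ Δ :=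
  fun c hc => h c (hs hc)

theorem Sat.subst_iff {ρ ρ₁ : Valuation} {σ : Subst} {Δ : Ctx}
    (h : ∀ c ∈ Δ, ∀ x ∈ c.vars, (σ x).eval ρ = some (ρ₁ x)) :
    Sat ρ (Δ.subst σ) ↔ Sat ρ₁ Δ := by
  constructor
  · intro hs c hc v hv
    exact hs _ ⟨c, hc, rfl⟩ v ((Exp.eval_subst (h c hc)).trans hv)
  · rintro hs _ ⟨c, hc, rfl⟩ v hv
    exact hs c hc v ((Exp.eval_subst (h c hc)).symm.trans hv)

/-! ## Intervals and memory accesses -/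

theorem mem_interval_eight {x a : Word} : x ∈ interval a (a + 8) ↔ x - a < 8 := by
  have : a + 8 - a = (8 : Word) := by simp
  rw [interval, Set.mem_ofPred_eq, this]

theorem self_mem_interval_eight (a : Word) : a ∈ interval a (a + 8) := by
  rw [mem_interval_eight]; simp

theorem mem_interval_eight_add {x a d : Word} :
    x + d ∈ interval (a + d) (a + d + 8) ↔ x ∈ interval a (a + 8) := by
  rw [mem_interval_eight, mem_interval_eight]
  have : x + d - (a + d) = x - a := by abel
  rw [this]

theorem mem_interval_eight_iff_exists {x a : Word} :
    x ∈ interval a (a + 8) ↔ ∃ i < 8, x = a + BitVec.ofNat 64 i := by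
  rw [mem_interval_eight]
  constructor
  · intro h
    refine ⟨(x - a).toNat, by simpa [BitVec.lt_def] using h, ?_⟩
    rw [BitVec.ofNat_toNat, BitVec.setWidth_eq]
    abel
  · rintro ⟨i, hi, rfl⟩
    have : a + BitVec.ofNat 64 i - a = BitVec.ofNat 64 i := by abel
    rw [this, BitVec.lt_def]
    simp; omega

/-- The offset `c = a - b` satisfies `c < 8` by the first byte and `c + 7 < 8` by the last one. As
`c + 7` cannot wrap around, `c = 0`. -/
theorem interval_eight_subset {a b : Word} (h : interval a (a + 8) ⊆ interval b (b + 8)) :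
    a = b := by
  have h0 := h (self_mem_interval_eight a)
  have h7 := h (mem_interval_eight_iff_exists.2 ⟨7, by norm_num, rfl⟩)
  rw [mem_interval_eight] at h0 h7
  have h7' : a - b + 7 < (8 : Word) := by
    have e : a + BitVec.ofNat 64 7 - b = a - b + 7 := by
      change a + 7 - b = a - b + 7
      abel
    rwa [e] at h7
  have : a - b = 0 := by
    generalize a - b = c at *
    rw [BitVec.lt_def] at h0 h7'
    apply BitVec.eq_of_toNat_eq
    simp [BitVec.toNat_add] at *
    omega
  exact sub_eq_zero.1 this

theorem sum_digits_lt {f : ℕ → ℕ} (hf : ∀ i, f i < 256) (n : ℕ) :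
    ((List.range n).map fun i => f i * 256 ^ i).sum < 256 ^ n := by
  induction n with
  | zero => simp
  | succ n ih =>
    rw [List.sum_range_succ]
    have h1 : f n * 256 ^ n ≤ 255 * 256 ^ n := Nat.mul_le_mul_right _ (by have := hf n; omega)
    rw [pow_succ]
    omega

/-- Uniqueness of base-256 digits: the terms above position `i` are multiples of `256 ^ (i + 1)`,
and those below sum to less than `256 ^ i`. -/
theorem digit_sum_digits {f : ℕ → ℕ} (hf : ∀ i, f i < 256) {n i : ℕ} (hi : i < n) :
    ((List.range n).map fun i => f i * 256 ^ i).sum / 256 ^ i % 256 = f i := by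
  induction n with
  | zero => omega
  | succ n ih =>
    rw [List.sum_range_succ]
    rcases Nat.lt_succ_iff_lt_or_eq.1 hi with h | rfl
    · obtain ⟨k, rfl⟩ : ∃ k, n = i + (k + 1) := ⟨n - i - 1, by omega⟩
      have e : f (i + (k + 1)) * 256 ^ (i + (k + 1)) =
          256 ^ i * (256 * (f (i + (k + 1)) * 256 ^ k)) := by ring
      rw [e, Nat.add_mul_div_left _ _ (by positivity), Nat.add_mul_mod_self_left, ih h]
    · rw [Nat.add_mul_div_right _ _ (by positivity), Nat.div_eq_of_lt (sum_digits_lt hf i),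
        Nat.zero_add, Nat.mod_eq_of_lt (hf i)]

theorem sum_digits (v n : ℕ) :
    ((List.range n).map fun i => v / 256 ^ i % 256 * 256 ^ i).sum = v % 256 ^ n := by
  induction n with
  | zero => simp [Nat.mod_one]
  | succ n ih => rw [List.sum_range_succ, ih, pow_succ, Nat.mod_mul, Nat.mul_comm (v / _ % _)]

theorem two_pow_eight_mul (i : ℕ) : 2 ^ (8 * i) = 256 ^ i := by
  rw [pow_mul]; norm_num

theorem Memory.extract_read (M : Memory) (a : Word) {i : ℕ} (hi : i < 8) :
    (M.read a).1.extractLsb' (8 * i) 8 = (M (a + BitVec.ofNat 64 i)).1 := by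
  apply BitVec.eq_of_toNat_eq
  have hb : ∀ j : ℕ, (M (a + BitVec.ofNat 64 j)).1.toNat < 256 := fun j =>
    (M (a + BitVec.ofNat 64 j)).1.isLt
  rw [BitVec.extractLsb'_toNat, Nat.shiftRight_eq_div_pow, two_pow_eight_mul, Memory.read,
    BitVec.toNat_ofNat, Nat.mod_eq_of_lt (lt_of_lt_of_eq (sum_digits_lt hb 8) (by norm_num))]
  exact digit_sum_digits hb hi

theorem Memory.read_congr {M M' : Memory} {a b : Word}
    (h : ∀ i < 8, M' (b + BitVec.ofNat 64 i) = M (a + BitVec.ofNat 64 i)) :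
    M'.read b = M.read a := by
  have h1 : (List.range 8).map (fun i => (M' (b + BitVec.ofNat 64 i)).1.toNat * 256 ^ i) =
      (List.range 8).map fun i => (M (a + BitVec.ofNat 64 i)).1.toNat * 256 ^ i := by
    apply List.map_congr_left
    intro i hi
    rw [h i (List.mem_range.1 hi)]
  have h2 : (List.range 8).any (fun i => (M' (b + BitVec.ofNat 64 i)).2) =
      (List.range 8).any fun i => (M (a + BitVec.ofNat 64 i)).2 := by
    rw [Bool.eq_iff_iff, List.any_eq_true, List.any_eq_true]
    constructor <;> rintro ⟨i, hi, hh⟩ <;> refine ⟨i, hi, ?_⟩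
    · rwa [← h i (List.mem_range.1 hi)]
    · rwa [h i (List.mem_range.1 hi)]
  simp only [Memory.read, h1, h2]

theorem Memory.read_congr_of_interval {M M' : Memory} {a : Word}
    (h : ∀ x ∈ interval a (a + 8), M' x = M x) : M'.read a = M.read a :=
  Memory.read_congr fun i hi => h _ (mem_interval_eight_iff_exists.2 ⟨i, hi, rfl⟩)

/-- Each byte can be extracted from the little-endian word. This turns equality of typed values into
equality of memory contents, as required once a type is weakened to `top`. -/
theorem Memory.bytes_eq_of_read_eq {M M' : Memory} {a d : Word}
    (h : (M'.read (a + d)).1 = (M.read a).1) :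
    ∀ x ∈ interval a (a + 8), (M' (x + d)).1 = (M x).1 := by
  intro x hx
  obtain ⟨i, hi, rfl⟩ := mem_interval_eight_iff_exists.1 hx
  rw [← Memory.extract_read M a hi, ← h, Memory.extract_read M' (a + d) hi]
  congr 2
  abel

theorem Memory.read_fst_congr {M M' : Memory} {a b : Word}
    (h : ∀ i < 8, (M' (b + BitVec.ofNat 64 i)).1 = (M (a + BitVec.ofNat 64 i)).1) :
    (M'.read b).1 = (M.read a).1 := by
  have h1 : (List.range 8).map (fun i => (M' (b + BitVec.ofNat 64 i)).1.toNat * 256 ^ i) =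
      (List.range 8).map fun i => (M (a + BitVec.ofNat 64 i)).1.toNat * 256 ^ i := by
    apply List.map_congr_left
    intro i hi
    rw [h i (List.mem_range.1 hi)]
  simp only [Memory.read, h1]

theorem Memory.read_snd (M : Memory) (a : Word) :
    (M.read a).2 = true ↔ ∃ x ∈ interval a (a + 8), (M x).2 = true := by
  simp only [Memory.read, List.any_eq_true, List.mem_range]
  constructor
  · rintro ⟨i, hi, h⟩
    exact ⟨_, mem_interval_eight_iff_exists.2 ⟨i, hi, rfl⟩, h⟩
  · rintro ⟨x, hx, h⟩
    obtain ⟨i, hi, rfl⟩ := mem_interval_eight_iff_exists.1 hx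
    exact ⟨i, hi, h⟩

theorem Memory.read_snd_congr {M M' : Memory} {a d : Word}
    (h : ∀ x ∈ interval a (a + 8), (M' (x + d)).2 = (M x).2) :
    (M'.read (a + d)).2 = (M.read a).2 := by
  rw [Bool.eq_iff_iff, Memory.read_snd, Memory.read_snd]
  constructor
  · rintro ⟨x, hx, hh⟩
    have hx' : x - d ∈ interval a (a + 8) := by
      rw [← mem_interval_eight_add (d := d)]; simpa using hx
    refine ⟨x - d, hx', ?_⟩
    rw [← h _ hx']; simpa using hh
  · rintro ⟨x, hx, hh⟩
    exact ⟨x + d, mem_interval_eight_add.2 hx, by rw [h _ hx]; exact hh⟩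

theorem Memory.write_of_notMem {M : Memory} {a x : Word} {v : Word × Bool}
    (h : x ∉ interval a (a + 8)) : M.write a v x = M x := by
  rw [mem_interval_eight] at h
  exact if_neg h

theorem Memory.write_of_mem {M : Memory} {a x : Word} {v : Word × Bool}
    (h : x ∈ interval a (a + 8)) :
    M.write a v x = (v.1.extractLsb' (8 * (x - a).toNat) 8, v.2) := by
  rw [mem_interval_eight] at h
  exact if_pos h

theorem Memory.write_add {M M' : Memory} {a d x : Word} {v v' : Word × Bool} (hv : v'.1 = v.1)
    (h : x ∈ interval a (a + 8)) :
    (M'.write (a + d) v' (x + d)).1 = (M.write a v x).1 := by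
  rw [Memory.write_of_mem h, Memory.write_of_mem (mem_interval_eight_add.2 h), hv]
  have : x + d - (a + d) = x - a := by abel
  rw [this]

theorem Memory.read_write (M : Memory) (a : Word) (v : Word × Bool) : (M.write a v).read a = v := by
  have hm : ∀ i < 8, M.write a v (a + BitVec.ofNat 64 i) = (v.1.extractLsb' (8 * i) 8, v.2) := by
    intro i hi
    rw [Memory.write_of_mem (mem_interval_eight_iff_exists.2 ⟨i, hi, rfl⟩)]
    have : a + BitVec.ofNat 64 i - a = BitVec.ofNat 64 i := by abel
    rw [this, BitVec.toNat_ofNat, Nat.mod_eq_of_lt (by omega)]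
  apply Prod.ext
  · have h1 : (List.range 8).map (fun i =>
        (M.write a v (a + BitVec.ofNat 64 i)).1.toNat * 256 ^ i) =
        (List.range 8).map fun i => (v.1.extractLsb' (8 * i) 8).toNat * 256 ^ i := by
      apply List.map_congr_left
      intro i hi
      rw [hm i (List.mem_range.1 hi)]
    simp only [Memory.read, h1]
    apply BitVec.eq_of_toNat_eq
    -- The bytes are the base-256 digits of the word, so their sum is the word modulo `256 ^ 8 = 2 ^
    -- 64`, which is the word itself.
    have h2 := sum_digits v.1.toNat 8
    have hv : v.1.toNat < 256 ^ 8 := lt_of_lt_of_eq v.1.isLt (by norm_num)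
    rw [Nat.mod_eq_of_lt hv] at h2
    simp only [BitVec.extractLsb'_toNat, Nat.shiftRight_eq_div_pow, two_pow_eight_mul,
      BitVec.toNat_ofNat]
    change _ % 2 ^ 64 = _
    rw [← show (256 : ℕ) ^ 8 = 2 ^ 64 by norm_num]
    change ((List.range 8).map fun i => v.1.toNat / 256 ^ i % 256 * 256 ^ i).sum % 256 ^ 8 = _
    rw [h2, Nat.mod_eq_of_lt hv]
  · rw [Bool.eq_iff_iff, Memory.read_snd]
    constructor
    · rintro ⟨x, hx, h⟩
      rwa [Memory.write_of_mem hx] at h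
    · intro h
      refine ⟨a, self_mem_interval_eight a, ?_⟩
      rwa [Memory.write_of_mem (self_mem_interval_eight a)]

/-! ## Related values and data -/

/-- If the type is known, the two values are its values under `ρ'` and `ρ`, which `NonChange`
identifies. This is the reason for every `NonChange` premise in the typing rules. -/
theorem SimVal.eq_of_nonChange {Δ : Ctx} {e : Exp} {ρ' ρ : Valuation} {v' v : Word × Bool}
    (h : SimVal e ρ' ρ v' v) (hs : Sat ρ Δ) (ha : AgreeNC ρ ρ') (hn : NonChange Δ e) :
    v' = v := by
  refine Prod.ext ?_ h.1
  rcases h.2 with ⟨-, h⟩ | ⟨-, h', h⟩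
  · exact h
  · have := hn ρ ρ' hs ha
    rw [h', h] at this
    exact Option.some.inj this

theorem SimVal.of_top {e : Exp} {ρ' ρ : Valuation} {v' v : Word × Bool} (he : e.HasTop)
    (h : v' = v) : SimVal e ρ' ρ v' v := by
  subst h
  exact ⟨rfl, Or.inl ⟨he, rfl⟩⟩

theorem SimVal.of_eval {e : Exp} {ρ' ρ : Valuation} {v' v : Word × Bool} (ht : v'.2 = v.2)
    (h' : e.eval ρ' = some v'.1) (h : e.eval ρ = some v.1) : SimVal e ρ' ρ v' v :=
  ⟨ht, Or.inr ⟨Exp.not_hasTop_of_eval h, h', h⟩⟩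

theorem SimVal.eval {e : Exp} {ρ' ρ : Valuation} {v' v : Word × Bool} (h : SimVal e ρ' ρ v' v)
    (he : ¬ e.HasTop) : e.eval ρ' = some v'.1 ∧ e.eval ρ = some v.1 := by
  rcases h.2 with ⟨h, -⟩ | ⟨-, h⟩
  · exact absurd h he
  · exact h

/-- Transfer along a change of type and valuations that is exact, or forgets the value. -/
theorem SimVal.transfer {e e₂ : Exp} {ρ' ρ ρ₂' ρ₂ : Valuation} {v' v : Word × Bool}
    (h : SimVal e ρ' ρ v' v)
    (H : (e₂.eval ρ₂' = e.eval ρ' ∧ e₂.eval ρ₂ = e.eval ρ) ∨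
      (e₂.HasTop ∧ (e.eval ρ' = e.eval ρ))) : SimVal e₂ ρ₂' ρ₂ v' v := by
  refine ⟨h.1, ?_⟩
  rcases H with ⟨h1, h2⟩ | ⟨h1, h2⟩
  · have : e₂.HasTop ↔ e.HasTop := by
      rw [← Exp.eval_eq_none (ρ := ρ₂), h2, Exp.eval_eq_none]
    rw [this, h1, h2]
    exact h.2
  · refine Or.inl ⟨h1, ?_⟩
    rcases h.2 with ⟨-, h⟩ | ⟨-, h', h⟩
    · exact h
    · rw [h', h] at h2
      exact Option.some.inj h2

/-- An unknown result must be equal in both runs even if one operand had a known type that was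
relocated; `TopOK` excludes this by making both operands equal. -/
theorem SimVal.bin {Δ : Ctx} {o : BinOp} {e₁ e₂ : Exp} {ρ' ρ : Valuation}
    {v₁' v₁ v₂' v₂ : Word × Bool} (h₁ : SimVal e₁ ρ' ρ v₁' v₁) (h₂ : SimVal e₂ ρ' ρ v₂' v₂)
    (hs : Sat ρ Δ) (ha : AgreeNC ρ ρ') (ht : TopOK Δ (.bin o e₁ e₂) e₁ e₂) :
    SimVal (.bin o e₁ e₂) ρ' ρ (o.eval v₁'.1 v₂'.1, v₁'.2 || v₂'.2)
      (o.eval v₁.1 v₂.1, v₁.2 || v₂.2) := by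
  by_cases he : (Exp.bin o e₁ e₂).HasTop
  · obtain ⟨n₁, n₂⟩ := ht he
    rw [h₁.eq_of_nonChange hs ha n₁, h₂.eq_of_nonChange hs ha n₂]
    exact SimVal.of_top he rfl
  · have h1 : ¬ e₁.HasTop := fun h => he (Or.inl h)
    have h2 : ¬ e₂.HasTop := fun h => he (Or.inr h)
    obtain ⟨a', a⟩ := h₁.eval h1
    obtain ⟨b', b⟩ := h₂.eval h2
    exact SimVal.of_eval (by simp [h₁.1, h₂.1]) (by simp [Exp.eval, a', b'])
      (by simp [Exp.eval, a, b])

theorem SimVal.flag {e : Exp} {ρ' ρ : Valuation} {v' v : Word × Bool} (h : SimVal e ρ' ρ v' v) :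
    SimVal (.bin .eq e (.const 0)) ρ' ρ (flagVal v') (flagVal v) := by
  refine ⟨h.1, ?_⟩
  rcases h.2 with ⟨h1, h2⟩ | ⟨h1, h2, h3⟩
  · exact Or.inl ⟨Or.inl h1, by simp [flagVal, h2]⟩
  · exact Or.inr ⟨by simp [Exp.HasTop, h1], by simp [Exp.eval, h2, BinOp.eval, flagVal],
      by simp [Exp.eval, h3, BinOp.eval, flagVal]⟩

theorem SimData.taint {e : Exp} {ρ' ρ : Valuation} {M' M : Memory} {X : Set Word} {d : Word}
    (h : SimData e ρ' ρ M' M X d) : ∀ x ∈ X, (M' (x + d)).2 = (M x).2 := by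
  rcases h with rfl | h
  · simp
  · exact h.1

/-- The hypothesis covers two situations at once: a `NonChange` type, and an unknown type, for which
both sides are `none`. -/
theorem SimData.bytes_eq {e : Exp} {ρ' ρ : Valuation} {M' M : Memory}
    {X : Set Word} {d : Word} (h : SimData e ρ' ρ M' M X d) (hn : e.eval ρ' = e.eval ρ) :
    ∀ x ∈ X, M' (x + d) = M x := by
  intro x hx
  refine Prod.ext ?_ (h.taint x hx)
  rcases h with rfl | ⟨-, ⟨-, h⟩ | ⟨-, a, rfl, h', h⟩⟩
  · exact absurd hx (by simp)
  · exact h x hx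
  · rw [h', h] at hn
    exact Memory.bytes_eq_of_read_eq (Option.some.inj hn) x hx

theorem SimData.of_bytes_eq {e : Exp} {ρ' ρ : Valuation} {M' M : Memory} {X : Set Word}
    {d : Word} (he : e.HasTop) (h : ∀ x ∈ X, M' (x + d) = M x) : SimData e ρ' ρ M' M X d :=
  Or.inr ⟨fun x hx => by rw [h x hx], Or.inl ⟨he, fun x hx => by rw [h x hx]⟩⟩

/-- The alternatives mirror those of `CellSub`. A known type describes one whole word and so
survives only on the same region; a subregion is allowed when the new type is unknown, since then
the bytes agree one by one. -/
theorem SimData.transfer {e e₂ : Exp} {ρ' ρ ρ₂' ρ₂ : Valuation} {M' M : Memory} {X X₂ : Set Word}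
    {d : Word} (h : SimData e ρ' ρ M' M X d) (hX : X₂ ⊆ X)
    (H : (e₂.eval ρ₂' = e.eval ρ' ∧ e₂.eval ρ₂ = e.eval ρ ∧ (e₂.HasTop ∨ X₂ = X)) ∨
      (e₂.HasTop ∧ (e.eval ρ' = e.eval ρ)) ∨ X₂ = ∅) : SimData e₂ ρ₂' ρ₂ M' M X₂ d := by
  rcases H with ⟨h1, h2, h3⟩ | ⟨h1, h2⟩ | h1
  · have ht : e₂.HasTop ↔ e.HasTop := by
      rw [← Exp.eval_eq_none (ρ := ρ₂), h2, Exp.eval_eq_none]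
    rcases h3 with h3 | rfl
    · refine SimData.of_bytes_eq h3 fun x hx => h.bytes_eq ?_ x (hX hx)
      rw [Exp.eval_eq_none.2 (ht.1 h3), Exp.eval_eq_none.2 (ht.1 h3)]
    · unfold SimData at *
      rwa [ht, h1, h2]
  · exact SimData.of_bytes_eq h1 fun x hx => h.bytes_eq h2 x (hX hx)
  · exact Or.inl h1

theorem SimData.congr {e : Exp} {ρ' ρ : Valuation} {M' M M₁' M₁ : Memory}
    {X : Set Word} {d : Word} (h : SimData e ρ' ρ M' M X d) (hM : ∀ x ∈ X, M₁ x = M x)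
    (hM' : ∀ x ∈ X, M₁' (x + d) = M' (x + d)) : SimData e ρ' ρ M₁' M₁ X d := by
  rcases h with h | ⟨ht, h⟩
  · exact Or.inl h
  · refine Or.inr ⟨fun x hx => by rw [hM x hx, hM' x hx, ht x hx], ?_⟩
    rcases h with ⟨h1, h2⟩ | ⟨h1, a, rfl, h2, h3⟩
    · exact Or.inl ⟨h1, fun x hx => by rw [hM x hx, hM' x hx, h2 x hx]⟩
    · refine Or.inr ⟨h1, a, rfl, ?_, ?_⟩
      · rw [h2]
        congr 2
        refine (Memory.read_congr_of_interval fun x hx => ?_).symm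
        have := hM' (x - d) (by rw [← mem_interval_eight_add (d := d)]; simpa using hx)
        simpa using this
      · rw [h3, Memory.read_congr_of_interval hM]

/-- A read that lies in related data. -/
theorem SimData.read {e : Exp} {ρ' ρ : Valuation} {M' M : Memory} {X : Set Word} {d a : Word}
    (h : SimData e ρ' ρ M' M X d) (hX : interval a (a + 8) ⊆ X) :
    SimVal e ρ' ρ (M'.read (a + d)) (M.read a) := by
  have ht := h.taint
  refine ⟨Memory.read_snd_congr fun x hx => ht x (hX hx), ?_⟩
  rcases h with rfl | ⟨-, ⟨h1, h2⟩ | ⟨h1, b, rfl, h2, h3⟩⟩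
  · exact absurd (hX (self_mem_interval_eight a)) (by simp)
  · refine Or.inl ⟨h1, Memory.read_fst_congr fun i hi => ?_⟩
    rw [← h2 _ (hX (mem_interval_eight_iff_exists.2 ⟨i, hi, rfl⟩))]
    congr 2
    abel
  · obtain rfl := interval_eight_subset hX
    exact Or.inr ⟨h1, h2, h3⟩

/-- Writing related values makes the written range related. -/
theorem SimData.write {e : Exp} {ρ' ρ : Valuation} {M' M : Memory} {d a : Word}
    {v' v : Word × Bool} (h : SimVal e ρ' ρ v' v) :
    SimData e ρ' ρ (M'.write (a + d) v') (M.write a v) (interval a (a + 8)) d := by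
  refine Or.inr ⟨fun x hx => ?_, ?_⟩
  · rw [Memory.write_of_mem hx, Memory.write_of_mem (mem_interval_eight_add.2 hx)]
    exact h.1
  · rcases h.2 with ⟨h1, h2⟩ | ⟨h1, h2, h3⟩
    · exact Or.inl ⟨h1, fun x hx => Memory.write_add h2 hx⟩
    · exact Or.inr ⟨h1, a, rfl, by rw [Memory.read_write, h2], by rw [Memory.read_write, h3]⟩

/-! ## Placement and relocation of regions -/

/-- The region lies in one of the regions that slots may occupy. -/
def MemConfig.Placed (cfg : MemConfig) (A : Set Word) : Prop :=
  A ⊆ cfg.stackPub ∨ A ⊆ cfg.otherPub ∨ A ⊆ cfg.otherSec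

/-- The region may be moved by `d`. -/
def MemConfig.ShiftOK (cfg : MemConfig) (A : Set Word) (d : Word) : Prop :=
  d = 0 ∨ d = cfg.δ ∧ A ⊆ cfg.stackPub

/-- Both ends of the secret stack are those of the public stack moved by δ, and membership in an
interval depends only on differences, so wrap-around is harmless. -/
theorem MemConfig.add_mem_stackSec {cfg : MemConfig} {x : Word} :
    x + cfg.δ ∈ cfg.stackSec ↔ x ∈ cfg.stackPub := by
  unfold MemConfig.stackPub MemConfig.stackSec interval
  rw [Set.mem_ofPred_eq, Set.mem_ofPred_eq]
  have h1 : x + cfg.δ - (cfg.spInit + 2 * cfg.δ) = x - (cfg.spInit + cfg.δ) := by ring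
  have h2 : cfg.spInit + cfg.δ - (cfg.spInit + 2 * cfg.δ) = cfg.spInit - (cfg.spInit + cfg.δ) := by
    ring
  rw [h1, h2]

theorem MemConfig.Placed.mono {cfg : MemConfig} {A B : Set Word} (h : cfg.Placed B)
    (hs : A ⊆ B) : cfg.Placed A := by
  rcases h with h | h | h
  · exact Or.inl (hs.trans h)
  · exact Or.inr (Or.inl (hs.trans h))
  · exact Or.inr (Or.inr (hs.trans h))

theorem MemConfig.ShiftOK.mono {cfg : MemConfig} {A B : Set Word} {d : Word}
    (h : cfg.ShiftOK B d) (hs : A ⊆ B) : cfg.ShiftOK A d :=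
  h.imp_right fun h => ⟨h.1, hs.trans h.2⟩

/-- The target of all shifts is free of slots. -/
theorem MemConfig.Placed.notMem_stackSec {cfg : MemConfig} {A : Set Word} (h : cfg.Placed A)
    {x : Word} (hx : x ∈ A) : x ∉ cfg.stackSec := by
  intro hs
  rcases h with h | h | h
  · exact Set.disjoint_left.1 cfg.stack_disj (h hx) hs
  · exact Set.disjoint_left.1 cfg.pub_disj (h hx) (Or.inr hs)
  · exact Set.disjoint_left.1 cfg.sec_disj (h hx) (Or.inr hs)

/-- Equal distances preserve distinctness. With different distances one of the points lands in the
secret stack while the other stays in a placed region, which avoids the secret stack. -/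
theorem MemConfig.ShiftOK.ne {cfg : MemConfig} {A B : Set Word} {d₁ d₂ : Word}
    (hA : cfg.Placed A) (hB : cfg.Placed B) (h₁ : cfg.ShiftOK A d₁) (h₂ : cfg.ShiftOK B d₂)
    (hd : A ∩ B = ∅) {x y : Word} (hx : x ∈ A) (hy : y ∈ B) : x + d₁ ≠ y + d₂ := by
  intro h
  have hne : x ≠ y := by
    rintro rfl
    exact (Set.eq_empty_iff_forall_notMem.1 hd x) ⟨hx, hy⟩
  rcases h₁ with rfl | ⟨rfl, h₁⟩ <;> rcases h₂ with rfl | ⟨rfl, h₂⟩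
  · exact hne (by simpa using h)
  · rw [add_zero] at h
    exact hA.notMem_stackSec hx (h ▸ MemConfig.add_mem_stackSec.2 (h₂ hy))
  · rw [add_zero] at h
    exact hB.notMem_stackSec hy (h ▸ MemConfig.add_mem_stackSec.2 (h₁ hx))
  · exact hne (add_right_cancel h)

theorem MemConfig.Placed.subset_stackPub {cfg : MemConfig} {A : Set Word} (h : cfg.Placed A)
    (hs : A ⊆ cfg.stackPub ∪ cfg.stackSec) : A ⊆ cfg.stackPub := by
  intro x hx
  rcases hs hx with h' | h'
  · exact h'
  · exact absurd h' (h.notMem_stackSec hx)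

theorem MemConfig.notMem_stack_of_otherPub {cfg : MemConfig} {x : Word} (h : x ∈ cfg.otherPub) :
    x ∉ cfg.stackPub ∪ cfg.stackSec := Set.disjoint_left.1 cfg.pub_disj h

theorem MemConfig.notMem_stack_of_otherSec {cfg : MemConfig} {x : Word} (h : x ∈ cfg.otherSec) :
    x ∉ cfg.stackPub ∪ cfg.stackSec := Set.disjoint_left.1 cfg.sec_disj h

/-! ## Memory types with the same slots and taints -/

/-- The memory types have the same slots, and the same taints in non-spill slots. -/
structure MemLike (ℳ ℳ₀ : MemType) : Prop where
  dom : ∀ s, (ℳ s).isSome ↔ (ℳ₀ s).isSome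
  taint : ∀ s c c₀, ℳ s = some c → ℳ₀ s = some c₀ → ¬ s.IsSpill → c.val.t.Equiv c₀.val.t

theorem MemLike.refl (ℳ : MemType) : MemLike ℳ ℳ :=
  ⟨fun _ => Iff.rfl, fun s c c₀ h h' _ => by
    rw [h] at h'; cases h'; exact Taint.Equiv.refl _⟩

theorem MemLike.symm {ℳ ℳ₀ : MemType} (h : MemLike ℳ ℳ₀) : MemLike ℳ₀ ℳ :=
  ⟨fun s => (h.dom s).symm, fun s c c₀ hc hc₀ hs => (h.taint s c₀ c hc₀ hc hs).symm⟩

theorem MemLike.exists {ℳ ℳ₀ : MemType} (h : MemLike ℳ ℳ₀) {s : Slot} {c : Cell}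
    (hc : ℳ s = some c) : ∃ c₀, ℳ₀ s = some c₀ :=
  Option.isSome_iff_exists.1 ((h.dom s).1 (by simp [hc]))

theorem MemLike.trans {ℳ ℳ₁ ℳ₂ : MemType} (h : MemLike ℳ ℳ₁) (h' : MemLike ℳ₁ ℳ₂) :
    MemLike ℳ ℳ₂ :=
  ⟨fun s => (h.dom s).trans (h'.dom s), fun s c c₂ hc hc₂ hs => by
    obtain ⟨c₁, hc₁⟩ := h.exists hc
    exact (h.taint s c c₁ hc hc₁ hs).trans (h'.taint s c₁ c₂ hc₁ hc₂ hs)⟩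

/-- Slots are well-formed. -/
def SlotsOK (ℳ : MemType) : Prop := ∀ s, (ℳ s).isSome → SlotOK s

/-- Distinct slots are disjoint. -/
def SlotsDisjoint (ℳ : MemType) (ρ : Valuation) : Prop :=
  ∀ s s', (ℳ s).isSome → (ℳ s').isSome → s ≠ s' →
    s.region.denote ρ ∩ s'.region.denote ρ = ∅

theorem MemLike.slotsOK {ℳ ℳ₀ : MemType} (h : MemLike ℳ ℳ₀) (h₀ : SlotsOK ℳ₀) : SlotsOK ℳ :=
  fun s hs => h₀ s ((h.dom s).1 hs)

theorem MemLike.slotsDisjoint {ℳ ℳ₀ : MemType} {ρ : Valuation} (h : MemLike ℳ ℳ₀)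
    (h₀ : SlotsDisjoint ℳ₀ ρ) : SlotsDisjoint ℳ ρ :=
  fun s s' hs hs' => h₀ s s' ((h.dom s).1 hs) ((h.dom s').1 hs')

theorem SlotsDisjoint.eq {ℳ : MemType} {ρ : Valuation} (h : SlotsDisjoint ℳ ρ) {s s' : Slot}
    (hs : (ℳ s).isSome) (hs' : (ℳ s').isSome) {x : Word} (hx : x ∈ s.region.denote ρ)
    (hx' : x ∈ s'.region.denote ρ) : s = s' := by
  by_contra hne
  exact Set.eq_empty_iff_forall_notMem.1 (h s s' hs hs' hne) x ⟨hx, hx'⟩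

theorem TransPtr.congr_base {ℳ : MemType} {s s' : Slot} (h : TransPtr ℳ s)
    (hb : s'.base = s.base) : TransPtr ℳ s' := by
  unfold TransPtr at *
  rwa [hb]

theorem not_transPtr_of_isLocalStack {ℳ : MemType} {s : Slot} (h : SlotOK s)
    (hs : s.IsLocalStack) : ¬ TransPtr ℳ s := fun ht => ht.1 (h.localBase hs)

/-- A strategy compares taints of slots with a common base, and `MemLike` says nothing about taints
of spill slots. But a TransPtr base differs from `sp`, the base of every spill slot, so no spill
slot enters the comparison. -/
theorem MemLike.transPtr {ℳ ℳ₀ : MemType} (h : MemLike ℳ ℳ₀) (h₀ : SlotsOK ℳ) {s : Slot}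
    (ht : TransPtr ℳ s) : TransPtr ℳ₀ s := by
  refine ⟨ht.1, fun s₁ c₁ s₂ c₂ h₁ h₂ b₁ b₂ => ?_⟩
  have hns : ∀ t c, ℳ t = some c → t.base = s.base → ¬ t.IsSpill := fun t c hc hb hsp =>
    ht.1 (hb ▸ (h₀ t (by simp [hc])).localBase (Or.inl hsp))
  obtain ⟨d₁, e₁⟩ := h.symm.exists h₁
  obtain ⟨d₂, e₂⟩ := h.symm.exists h₂
  exact (h.taint s₁ d₁ c₁ e₁ h₁ (hns _ _ e₁ b₁)).symm.trans
    ((ht.2 s₁ d₁ s₂ d₂ e₁ e₂ b₁ b₂).trans (h.taint s₂ d₂ c₂ e₂ h₂ (hns _ _ e₂ b₂)))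

theorem MemLike.transPtr_iff {ℳ ℳ₀ : MemType} (h : MemLike ℳ ℳ₀) (h₀ : SlotsOK ℳ) {s : Slot} :
    TransPtr ℳ s ↔ TransPtr ℳ₀ s :=
  ⟨h.transPtr h₀, h.symm.transPtr (h.symm.slotsOK h₀)⟩

/-! ## The relation between slots -/

/-- The distance by which the data in a slot is moved. -/
noncomputable def slotShift (cfg : MemConfig) (ℳ : MemType) (ρ' ρ : Valuation) (s : Slot)
    (c : Cell) : Word := ptrDiff ρ' ρ s + getOpShift cfg.δ ℳ s c

/-- Placement and relocation of a slot. -/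
structure SlotRel (cfg : MemConfig) (ℳ : MemType) (θ : TVar → Bool) (ρ' ρ : Valuation)
    (s : Slot) (c : Cell) : Prop where
  place : cfg.Placed (s.region.denote ρ)
  spill : s.IsSpill → s.region.denote ρ ⊆ cfg.stackPub
  pub : (s.region.denote ρ).Nonempty → s.region.denote ρ ⊆ cfg.otherPub → c.val.t.eval θ = false
  op : ¬ TransPtr ℳ s → s.region.denote ρ ⊆ cfg.stackPub ∧
    (s.IsLocalStack ∨ c.val.t.IsZero ∨ c.val.t.IsOne)
  ptr : ptrDiff ρ' ρ s ∈ getPtrShift cfg ℳ ρ θ s c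

/-- A slot together with its data. -/
structure CellRel (cfg : MemConfig) (ℳ : MemType) (θ : TVar → Bool) (ρ' ρ : Valuation)
    (M' M : Memory) (s : Slot) (c : Cell) : Prop extends SlotRel cfg ℳ θ ρ' ρ s c where
  validSub : c.valid.denote ρ ⊆ s.region.denote ρ
  taint : ∀ x ∈ c.valid.denote ρ, (M x).2 = true → c.val.t.eval θ = true
  data : SimData c.val.e ρ' ρ M' M (c.valid.denote ρ) (slotShift cfg ℳ ρ' ρ s c)

section SlotRel
variable {cfg : MemConfig} {ℳ : MemType} {θ : TVar → Bool} {ρ' ρ : Valuation} {s : Slot} {c : Cell}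

theorem SlotRel.ptrDiff_eq_zero (h : SlotRel cfg ℳ θ ρ' ρ s c) (ht : ¬ TransPtr ℳ s) :
    ptrDiff ρ' ρ s = 0 := by
  have := h.ptr
  unfold getPtrShift at this
  rw [if_pos (Or.inl ht)] at this
  simpa using this

/-- A pointer shift δ is only possible if the region lies in the two stacks together; being placed,
it then lies in the public one. -/
theorem SlotRel.ptrDiff_shiftOK (h : SlotRel cfg ℳ θ ρ' ρ s c) :
    cfg.ShiftOK (s.region.denote ρ) (ptrDiff ρ' ρ s) := by
  have hp := h.ptr
  unfold getPtrShift at hp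
  split_ifs at hp with h1 h2
  · exact Or.inl (by simpa using hp)
  all_goals
    have hs : s.region.denote ρ ⊆ cfg.stackPub :=
      h.place.subset_stackPub (by by_contra hh; exact h1 (Or.inr hh))
  · exact Or.inr ⟨by simpa using hp, hs⟩
  · rcases hp with hp | hp
    · exact Or.inl hp
    · exact Or.inr ⟨by simpa using hp, hs⟩

/-- Pointer shift and operand shift never add up: TransPtr excludes the latter, TransOp the former.
-/
theorem SlotRel.shiftOK (h : SlotRel cfg ℳ θ ρ' ρ s c) :
    cfg.ShiftOK (s.region.denote ρ) (slotShift cfg ℳ ρ' ρ s c) := by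
  unfold slotShift getOpShift
  by_cases ht : TransPtr ℳ s
  · simpa [ht] using h.ptrDiff_shiftOK
  · rw [h.ptrDiff_eq_zero ht, zero_add]
    split_ifs
    · exact Or.inl rfl
    · exact Or.inr ⟨rfl, (h.op ht).1⟩

/-- Every address a relocated slot may use is an admissible translate of an original address; in
this form `MemConfig.ShiftOK.ne` applies to it. -/
theorem SlotRel.exists_of_mem_possibleSlot (h : SlotRel cfg ℳ θ ρ' ρ s c) {x : Word}
    (hx : x ∈ getPossibleSlot cfg.δ ℳ ρ' ρ s) :
    ∃ d y, cfg.ShiftOK (s.region.denote ρ) d ∧ y ∈ s.region.denote ρ ∧ x = y + d := by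
  unfold getPossibleSlot at hx
  split_ifs at hx with ht
  · exact ⟨_, x - ptrDiff ρ' ρ s, h.ptrDiff_shiftOK, hx, by abel⟩
  · rcases hx with hx | hx
    · exact ⟨0, x, Or.inl rfl, hx, by abel⟩
    · exact ⟨cfg.δ, x - cfg.δ, Or.inr ⟨rfl, (h.op ht).1⟩, hx, by abel⟩

theorem SlotRel.mem_possibleSlot (h : SlotRel cfg ℳ θ ρ' ρ s c) {x : Word}
    (hx : x ∈ s.region.denote ρ) :
    x + slotShift cfg ℳ ρ' ρ s c ∈ getPossibleSlot cfg.δ ℳ ρ' ρ s := by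
  unfold slotShift getOpShift getPossibleSlot
  by_cases ht : TransPtr ℳ s
  · simpa [ht, moved] using hx
  · rw [h.ptrDiff_eq_zero ht, zero_add, if_neg ht]
    split_ifs
    · exact Or.inl (by simpa using hx)
    · exact Or.inr (by simpa [moved] using hx)

theorem ptrDiff_congr {ρ₁' ρ₁ : Valuation} (hρ : ∀ x ∈ s.vars, ρ₁ x = ρ x)
    (hρ' : ∀ x ∈ s.vars, ρ₁' x = ρ' x) : ptrDiff ρ₁' ρ₁ s = ptrDiff ρ' ρ s := by
  simp [ptrDiff, hρ _ s.base_mem_vars, hρ' _ s.base_mem_vars]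

theorem Slot.denote_congr {ρ₁ : Valuation} (hρ : ∀ x ∈ s.vars, ρ₁ x = ρ x) :
    s.region.denote ρ₁ = s.region.denote ρ :=
  Region.denote_congr fun x hx => hρ x (s.region_vars hx)

theorem getPtrShift_congr {ρ₁ : Valuation} {θ₁ : TVar → Bool} {ℳ₁ : MemType} {c₁ : Cell}
    (ht : TransPtr ℳ₁ s ↔ TransPtr ℳ s) (hρ : s.region.denote ρ₁ = s.region.denote ρ)
    (hc : TransPtr ℳ s → c₁.val.t.eval θ₁ = c.val.t.eval θ) :
    getPtrShift cfg ℳ₁ ρ₁ θ₁ s c₁ = getPtrShift cfg ℳ ρ θ s c := by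
  unfold getPtrShift
  rw [ht, hρ]
  by_cases h : TransPtr ℳ s
  · rw [hc h]
  · simp [h]

theorem getOpShift_congr {ℳ₁ : MemType} {c₁ : Cell} {δ : Word}
    (ht : TransPtr ℳ₁ s ↔ TransPtr ℳ s) (hc : c₁.val.t.Equiv c.val.t) :
    getOpShift δ ℳ₁ s c₁ = getOpShift δ ℳ s c := by
  unfold getOpShift
  rw [ht, hc.isZero_iff]

/-- The taint of a spill slot is allowed to change. Such a slot lies in the public stack, so the
condition on public data outside it is void, and it is TransOp, so its pointer shift does not depend
on the taint. -/
theorem SlotRel.congr {ℳ₁ : MemType} {ρ₁' ρ₁ : Valuation} {c₁ : Cell}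
    (h : SlotRel cfg ℳ θ ρ' ρ s c) (hok : SlotOK s) (ht : TransPtr ℳ₁ s ↔ TransPtr ℳ s)
    (hc : ¬ s.IsSpill → c₁.val.t.Equiv c.val.t) (hρ : ∀ x ∈ s.vars, ρ₁ x = ρ x)
    (hρ' : ∀ x ∈ s.vars, ρ₁' x = ρ' x) : SlotRel cfg ℳ₁ θ ρ₁' ρ₁ s c₁ := by
  have hr := Slot.denote_congr hρ
  by_cases hs : s.IsSpill
  · have hnt : ¬ TransPtr ℳ s := not_transPtr_of_isLocalStack hok (Or.inl hs)
    refine ⟨hr ▸ h.place, fun hs => hr ▸ h.spill hs, ?_, fun _ => ⟨hr ▸ h.spill hs,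
      Or.inl (Or.inl hs)⟩, ?_⟩
    · rw [hr]
      rintro ⟨x, hx⟩ hp
      exact absurd (Or.inl (h.spill hs hx)) (MemConfig.notMem_stack_of_otherPub (hp hx))
    · rw [ptrDiff_congr hρ hρ', getPtrShift_congr (c := c) (θ := θ) ht hr fun h => absurd h hnt]
      exact h.ptr
  · have hc := hc hs
    refine ⟨hr ▸ h.place, fun hs => hr ▸ h.spill hs, ?_, ?_, ?_⟩
    · rw [hr, hc θ]; exact h.pub
    · rw [hr, ht, hc.isZero_iff, hc.isOne_iff]; exact h.op
    · rw [ptrDiff_congr hρ hρ', getPtrShift_congr (c := c) (θ := θ) ht hr fun _ => hc θ]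
      exact h.ptr

end SlotRel

/-! ## The relation between the data of two states -/

/-- Registers and memories are typed by `T` and related. -/
structure Rel (cfg : MemConfig) (T : StateType) (θ : TVar → Bool) (ρ' ρ : Valuation)
    (R' : RegFile) (M' : Memory) (R : RegFile) (M : Memory) : Prop where
  ctx : Sat ρ T.ctx
  vars : AgreeNC ρ ρ'
  regs : SimRegs T.regs ρ' ρ R' R
  regTaint : ∀ r b, T.regs r = some b → (R r).2 = true → b.t.eval θ = true
  mem : ∀ s c, T.mem s = some c → CellRel cfg T.mem θ ρ' ρ M' M s c

/-- Together with the converse `Rel.simHelper`, this reduces each instruction to a statement about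
`Rel`, leaving only program counters to be treated separately. -/
theorem SimHelper.rel {cfg : MemConfig} {P P' : Program} {𝒯 : ProgType} {T : StateType}
    {R' R : RegFile} {M' M : Memory} {fr' fr : Frame}
    (h : SimHelper cfg P P' 𝒯 T R' M' fr' R M fr) :
    Rel cfg T fr.θ fr'.val fr.val R' M' R M where
  ctx := h.typed.ctx
  vars := h.vars
  regs := h.regs
  regTaint r b hb := (h.typed.regs r b hb).2
  mem s c hc := by
    obtain ⟨h1, h2, h3, h4, h5, -⟩ := h.typed.mem s c hc
    obtain ⟨k1, k2, k3⟩ := h.mem s c hc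
    exact ⟨⟨h1, h2, h3, k1, k2⟩, h4, h5, k3⟩

theorem Rel.simHelper {cfg : MemConfig} {P P' : Program} {𝒯 : ProgType} {T : StateType}
    {R' R : RegFile} {M' M : Memory} {fr' fr : Frame}
    (h : Rel cfg T fr.θ fr'.val fr.val R' M' R M) (hpc : SimPC cfg P P' 𝒯 fr'.pc fr.pc)
    (hT : stateTypeAt P 𝒯 fr.pc = some T) (hθ : fr'.θ = fr.θ) (hs : SlotsOK T.mem) :
    SimHelper cfg P P' 𝒯 T R' M' fr' R M fr where
  pc := hpc
  type := hT
  typed :=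
    { ctx := h.ctx
      regs := fun r b hb => by
        refine ⟨?_, h.regTaint r b hb⟩
        rcases (h.regs r b hb).2 with ⟨h, -⟩ | ⟨-, -, h⟩
        · exact Or.inl (Exp.eval_eq_none.2 h)
        · exact Or.inr h
      mem := fun s c hc => by
        have hm := h.mem s c hc
        refine ⟨hm.place, hm.spill, hm.pub, hm.validSub, hm.taint, ?_⟩
        rcases hm.data with h | ⟨-, ⟨h, -⟩ | ⟨-, a, h1, -, h2⟩⟩
        · exact Or.inr (Or.inl h)
        · exact Or.inl (Exp.eval_eq_none.2 h)
        · exact Or.inr (Or.inr ⟨a, h1, h2.symm⟩)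
      slotVars := fun s h => (hs s h).input }
  vars := h.vars
  taints := hθ
  regs := h.regs
  mem s c hc := ⟨(h.mem s c hc).op, (h.mem s c hc).ptr, (h.mem s c hc).data⟩

theorem CellRel.congr_memory {cfg : MemConfig} {ℳ : MemType} {θ : TVar → Bool} {ρ' ρ : Valuation}
    {M' M M₁' M₁ : Memory} {s : Slot} {c : Cell} (h : CellRel cfg ℳ θ ρ' ρ M' M s c)
    (hM : ∀ x ∈ c.valid.denote ρ, M₁ x = M x)
    (hM' : ∀ x ∈ c.valid.denote ρ, M₁' (x + slotShift cfg ℳ ρ' ρ s c) =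
      M' (x + slotShift cfg ℳ ρ' ρ s c)) :
    CellRel cfg ℳ θ ρ' ρ M₁' M₁ s c :=
  ⟨h.toSlotRel, h.validSub, fun x hx => by rw [hM x hx]; exact h.taint x hx,
    h.data.congr hM hM'⟩

/-! ### Typed memory accesses in both runs -/

section access
variable {cfg : MemConfig} {T : StateType} {θ : TVar → Bool} {ρ' ρ : Valuation} {R' R : RegFile}
  {M' M : Memory}

/-- The address of an access, moved with the base pointer of the slot. -/
theorem AccessOK.eval {Δ : Ctx} {a : Basic} {s : Slot} (h : AccessOK Δ a s) (hs : Sat ρ Δ)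
    (ha : AgreeNC ρ ρ') : ∃ A, a.e.eval ρ = some A ∧ a.e.eval ρ' = some (A + ptrDiff ρ' ρ s) := by
  obtain ⟨-, h1, h2⟩ := h
  obtain ⟨A, hA⟩ := Exp.exists_eval h1 ρ
  obtain ⟨A', hA'⟩ := Exp.exists_eval h1 ρ'
  refine ⟨A, hA, ?_⟩
  have := h2 ρ ρ' hs ha
  simp only [Exp.eval, hA, hA', Option.bind_some, Option.map_some, BinOp.eval,
    Option.some.injEq] at this
  rw [hA', ptrDiff, ← sub_eq_iff_eq_add'.2 (sub_eq_iff_eq_add.1 this)]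
  congr 1
  abel

/-- The shift of an operand with slot `s` and taint `τ`. -/
noncomputable def opShift (δ : Word) (ℳ : MemType) (s : Slot) (τ : Taint) : Word :=
  getOpShift δ ℳ s ⟨.empty, ⟨.top, τ⟩⟩

theorem effAddr_transMemOp (δ : Word) (ℳ : MemType) (m : MemOp) :
    effAddr R (transMemOp δ ℳ m) = (effAddr R m).map (· + opShift δ ℳ m.slot m.taint) := by
  unfold transMemOp opShift getOpShift
  by_cases h : TransPtr ℳ m.slot <;> by_cases h' : m.taint.IsZero <;>
    simp only [h, h', not_true, not_false_iff, and_true, and_false, if_true, if_false, or_true,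
      or_false, effAddr] <;> split_ifs <;> simp
  ring

theorem transMemOp_taint (δ : Word) (ℳ : MemType) (m : MemOp) :
    (transMemOp δ ℳ m).taint = m.taint := by
  unfold transMemOp
  split_ifs <;> rfl

/-- A known address type makes the types of both address registers known, and its zero taint makes
both registers untainted. So neither machine gets stuck, and both addresses are read off from the
same expression. -/
theorem Rel.effAddr (h : Rel cfg T θ ρ' ρ R' M' R M) {m : MemOp} {a : Basic}
    (ht : addrType T.regs m = some a) (hok : AccessOK T.ctx a m.slot) :
    ∃ A, a.e.eval ρ = some A ∧ effAddr R m = some A ∧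
      effAddr R' m = some (A + ptrDiff ρ' ρ m.slot) := by
  obtain ⟨A, hA, hA'⟩ := hok.eval h.ctx h.vars
  refine ⟨A, hA, ?_⟩
  unfold addrType at ht
  obtain ⟨b, hb, ht⟩ := Option.bind_eq_some_iff.1 ht
  obtain ⟨i, hi, rfl⟩ := Option.map_eq_some_iff.1 ht
  obtain ⟨hz, hnt, -⟩ := hok
  have hnb : ¬ b.e.HasTop := fun h => hnt (Or.inl (Or.inl h))
  have hni : ¬ i.e.HasTop := fun h => hnt (Or.inl (Or.inr (Or.inl h)))
  obtain ⟨b', b0⟩ := (h.regs _ _ hb).eval hnb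
  obtain ⟨i', i0⟩ := (h.regs _ _ hi).eval hni
  have hz' := hz θ
  simp only [Taint.eval, Bool.or_eq_false_iff] at hz'
  have tb : (R (.gp m.base)).2 = false := by
    by_contra hh
    have := h.regTaint _ _ hb (by simpa using hh)
    simp [hz'.1] at this
  have ti : (R (.gp m.idx)).2 = false := by
    by_contra hh
    have := h.regTaint _ _ hi (by simpa using hh)
    simp [hz'.2] at this
  have tb' : (R' (.gp m.base)).2 = false := by rw [(h.regs _ _ hb).1, tb]
  have ti' : (R' (.gp m.idx)).2 = false := by rw [(h.regs _ _ hi).1, ti]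
  simp only [Exp.eval, b', b0, i', i0, Option.bind_some, Option.map_some, BinOp.eval,
    Option.some.injEq] at hA hA'
  unfold Octal.effAddr
  rw [if_pos ⟨tb, ti⟩, if_pos ⟨tb', ti'⟩, hA, hA']
  exact ⟨rfl, rfl⟩

theorem MemType.set_self (ℳ : MemType) (s : Slot) (c : Cell) : ℳ.set s c s = some c := by
  simp [MemType.set]

theorem MemType.set_of_ne {ℳ : MemType} {s t : Slot} {c : Cell} (h : t ≠ s) :
    ℳ.set s c t = ℳ t := by
  simp [MemType.set, h]

theorem exists_of_loadType {Δ : Ctx} {ℳ : MemType} {a : Basic} {s : Slot} {τ : Taint} {b : Basic}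
    (h : loadType Δ ℳ a s τ = some b) :
    ∃ c, ℳ s = some c ∧ AccessOK Δ a s ∧ Δ.Sub (.eight a.e) c.valid ∧ c.val.t.Equiv τ ∧ b.t = τ ∧
      (b.e = c.val.e ∨ b.e.HasTop ∧ NonChange Δ c.val.e) := by
  unfold loadType at h
  obtain ⟨c, hc, h⟩ := Option.bind_eq_some_iff.1 h
  refine ⟨c, hc, ?_⟩
  by_cases h1 : Δ.Same (.eight a.e) c.valid
  · simp only [h1, if_true] at h
    obtain ⟨⟨h2, h3, h4, -⟩, h⟩ := Option.ite_none_right_eq_some.1 h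
    cases h
    exact ⟨h2, h3, h4, rfl, Or.inl rfl⟩
  · simp only [h1, if_false] at h
    obtain ⟨⟨h2, h3, h4, h5⟩, h⟩ := Option.ite_none_right_eq_some.1 h
    cases h
    exact ⟨h2, h3, h4, rfl, Or.inr ⟨trivial, h5 (by rw [if_neg h1]; trivial)⟩⟩

theorem exists_of_storeType {Δ : Ctx} {ℳ : MemType} {a : Basic} {s : Slot} {τ : Taint} {v : Basic}
    {c : Cell} (h : storeType Δ ℳ a s τ v = some c) :
    ∃ c₀, ℳ s = some c₀ ∧ AccessOK Δ a s ∧ Δ.Sub (.eight a.e) s.region ∧ v.t.Le τ ∧ c.val.t = τ ∧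
      (s.IsSpill ∧ c.valid = .eight a.e ∧ c.val.e = v.e ∨
        ¬ s.IsSpill ∧ c₀.val.t.Equiv τ ∧ c.valid = .union (.eight a.e) c₀.valid ∧
        (Δ.Sub c₀.valid (.eight a.e) ∧ c.val.e = v.e ∨
          c.val.e.HasTop ∧ NonChange Δ c₀.val.e ∧ NonChange Δ v.e)) := by
  unfold storeType at h
  obtain ⟨c₀, hc₀, h⟩ := Option.bind_eq_some_iff.1 h
  obtain ⟨⟨h1, h2, h3⟩, h⟩ := Option.ite_none_right_eq_some.1 h
  refine ⟨c₀, hc₀, h1, h2, h3, ?_⟩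
  by_cases hs : s.IsSpill
  · rw [if_pos hs] at h
    cases h
    exact ⟨rfl, Or.inl ⟨hs, rfl, rfl⟩⟩
  · rw [if_neg hs] at h
    by_cases h4 : Δ.Sub c₀.valid (.eight a.e)
    · simp only [h4, if_true] at h
      obtain ⟨⟨h5, -⟩, h⟩ := Option.ite_none_right_eq_some.1 h
      cases h
      exact ⟨rfl, Or.inr ⟨hs, h5, rfl, Or.inl ⟨h4, rfl⟩⟩⟩
    · simp only [h4, if_false] at h
      obtain ⟨⟨h5, h6⟩, h⟩ := Option.ite_none_right_eq_some.1 h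
      cases h
      exact ⟨rfl, Or.inr ⟨hs, h5, rfl, Or.inr ⟨trivial, h6 (by rw [if_neg h4]; trivial)⟩⟩⟩

theorem storeType_memLike {Δ : Ctx} {ℳ : MemType} {a : Basic} {s : Slot} {τ : Taint} {v : Basic}
    {c : Cell} (h : storeType Δ ℳ a s τ v = some c) : MemLike (ℳ.set s c) ℳ := by
  obtain ⟨c₀, hc₀, -, -, -, hτ, h⟩ := exists_of_storeType h
  refine ⟨fun t => ?_, fun t d d₀ hd hd₀ hns => ?_⟩
  · by_cases ht : t = s
    · subst ht; simp [MemType.set_self, hc₀]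
    · simp [MemType.set_of_ne ht]
  · by_cases ht : t = s
    · subst ht
      rw [MemType.set_self] at hd
      rw [hc₀] at hd₀
      cases hd
      cases hd₀
      rcases h with ⟨h, -⟩ | ⟨-, h, -⟩
      · exact absurd h hns
      · exact hτ ▸ h.symm
    · rw [MemType.set_of_ne ht, hd₀] at hd
      cases hd
      exact Taint.Equiv.refl _

/-- A typed load. -/
theorem Rel.load (h : Rel cfg T θ ρ' ρ R' M' R M) {a : Basic} {s : Slot} {τ : Taint} {b : Basic}
    (hl : loadType T.ctx T.mem a s τ = some b) :
    ∃ A, a.e.eval ρ = some A ∧ AccessOK T.ctx a s ∧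
      ∃ v' v, loadVal M θ A τ = some v ∧
        loadVal M' θ (A + ptrDiff ρ' ρ s + opShift cfg.δ T.mem s τ) τ = some v' ∧
        SimVal b.e ρ' ρ v' v ∧ (v.2 = true → b.t.eval θ = true) := by
  obtain ⟨c, hc, hok, hsub, hτ, hbt, hbe⟩ := exists_of_loadType hl
  obtain ⟨A, hA, hA'⟩ := hok.eval h.ctx h.vars
  have hm := h.mem s c hc
  have hsub := hsub ρ h.ctx
  rw [Region.denote_eight hA] at hsub
  -- The operand is shifted according to its annotation, the data according to the taint of the
  -- cell; typing makes the two taints equivalent.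
  have hsh : A + ptrDiff ρ' ρ s + opShift cfg.δ T.mem s τ =
      A + slotShift cfg T.mem ρ' ρ s c := by
    unfold slotShift opShift
    rw [add_assoc, getOpShift_congr (c := c) Iff.rfl hτ.symm]
  have hsv := hm.data.read hsub
  have htt : (M.read A).2 = true → τ.eval θ = true := by
    intro ht
    obtain ⟨x, hx, ht⟩ := (Memory.read_snd _ _).1 ht
    rw [← hτ θ]
    exact hm.taint x (hsub hx) ht
  refine ⟨A, hA, hok, M'.read (A + slotShift cfg T.mem ρ' ρ s c), M.read A, ?_, ?_, ?_, hbt ▸ htt⟩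
  · unfold loadVal
    rw [if_pos htt]
  · unfold loadVal
    rw [hsh, if_pos (by rwa [hsv.1])]
  · rcases hbe with hbe | ⟨hbe, hnc⟩
    · rw [hbe]; exact hsv
    · exact SimVal.of_top hbe (hsv.eq_of_nonChange h.ctx h.vars hnc)

/-- A typed store. -/
theorem Rel.store (h : Rel cfg T θ ρ' ρ R' M' R M) (hok : SlotsOK T.mem)
    (hdisj : SlotsDisjoint T.mem ρ) {a : Basic} {s : Slot} {τ : Taint} {b : Basic} {c : Cell}
    (hst : storeType T.ctx T.mem a s τ b = some c) {v' v : Word × Bool}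
    (hv : SimVal b.e ρ' ρ v' v) (hvt : v.2 = true → b.t.eval θ = true) :
    ∃ A, a.e.eval ρ = some A ∧ AccessOK T.ctx a s ∧
      ∃ M₁' M₁, storeVal M θ A τ v = some M₁ ∧
        storeVal M' θ (A + ptrDiff ρ' ρ s + opShift cfg.δ T.mem s τ) τ v' = some M₁' ∧
        (∀ t d, T.mem.set s c t = some d → CellRel cfg (T.mem.set s c) θ ρ' ρ M₁' M₁ t d) ∧
        (∀ x, x ∉ getDom T.mem ρ → M₁ x = M x) ∧
        (∀ x, x ∉ getShiftedDom cfg.δ T.mem ρ' ρ → M₁' x = M' x) := by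
  have hlike := storeType_memLike hst
  have hTP : ∀ t, TransPtr (T.mem.set s c) t ↔ TransPtr T.mem t := fun t =>
    hlike.transPtr_iff (hlike.slotsOK hok)
  obtain ⟨c₀, hc₀, hacc, hsub, hle, hτ, hst⟩ := exists_of_storeType hst
  obtain ⟨A, hA, -⟩ := hacc.eval h.ctx h.vars
  have hsub := hsub ρ h.ctx
  rw [Region.denote_eight hA] at hsub
  have hvτ : v.2 = true → τ.eval θ = true := fun hh => hle θ (hvt hh)
  have hm := h.mem s c₀ hc₀
  set D := ptrDiff ρ' ρ s + opShift cfg.δ T.mem s τ with hD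
  have hct : ¬ s.IsSpill → c.val.t.Equiv c₀.val.t :=
    hlike.taint s c c₀ (MemType.set_self _ _ _) hc₀
  have hrel : SlotRel cfg (T.mem.set s c) θ ρ' ρ s c :=
    hm.toSlotRel.congr (hok s (by simp [hc₀])) (hTP s) hct (fun _ _ => rfl) fun _ _ => rfl
  -- The new cell carries the annotation `τ`, so its data distance is the displacement of the
  -- accessed address.
  have hDs : slotShift cfg (T.mem.set s c) ρ' ρ s c = D := by
    rw [hD, slotShift, opShift,
      getOpShift_congr (c := ⟨.empty, ⟨.top, τ⟩⟩) (hTP s) (hτ ▸ Taint.Equiv.refl _)]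
  have hAD : A + ptrDiff ρ' ρ s + opShift cfg.δ T.mem s τ = A + D := by rw [hD]; abel
  have hposs : ∀ y ∈ s.region.denote ρ, y + D ∈ getPossibleSlot cfg.δ T.mem ρ' ρ s := by
    intro y hy
    have := hrel.mem_possibleSlot hy
    rw [hDs] at this
    unfold getPossibleSlot at *
    rwa [hTP s] at this
  refine ⟨A, hA, hacc, M'.write (A + D) v', M.write A v, ?_, ?_, ?_, ?_, ?_⟩
  · simp only [storeVal]; rw [if_pos hvτ]
  · simp only [storeVal]; rw [hAD, if_pos (by rwa [hv.1])]
  · intro t d hd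
    by_cases hts : t = s
    · subst hts
      rw [MemType.set_self] at hd
      cases hd
      suffices H : c.valid.denote ρ ⊆ t.region.denote ρ ∧
          (∀ x ∈ c.valid.denote ρ, (M.write A v x).2 = true → c.val.t.eval θ = true) ∧
          SimData c.val.e ρ' ρ (M'.write (A + D) v') (M.write A v) (c.valid.denote ρ) D from
        ⟨hrel, H.1, H.2.1, by rw [hDs]; exact H.2.2⟩
      rcases hst with ⟨hsp, hvalid, he⟩ | ⟨hsp, hcτ, hvalid, he⟩
      -- A spill slot may change its taint, hence its distance; its old contents are dropped, so
      -- nothing but the written word has to be related.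
      · rw [hvalid, he, hτ, Region.denote_eight hA]
        exact ⟨hsub, fun x hx => by rw [Memory.write_of_mem hx]; exact hvτ, SimData.write hv⟩
      -- Outside spill slots the taint is kept, so the surviving old bytes and the new word have the
      -- same distance.
      · have hD₀ : slotShift cfg T.mem ρ' ρ t c₀ = D := by
          rw [hD, slotShift, opShift, 
            getOpShift_congr (c₁ := c₀) (c := ⟨.empty, ⟨.top, τ⟩⟩) Iff.rfl hcτ]
        have hX : c.valid.denote ρ = interval A (A + 8) ∪ c₀.valid.denote ρ := by
          rw [hvalid, ← Region.denote_eight hA]; rfl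
        rw [hX, hτ]
        refine ⟨Set.union_subset hsub hm.validSub, ?_, ?_⟩
        · intro x hx
          by_cases hxA : x ∈ interval A (A + 8)
          · rw [Memory.write_of_mem hxA]; exact hvτ
          · rw [Memory.write_of_notMem hxA, ← hcτ θ]
            exact hm.taint x (hx.resolve_left hxA)
        · rcases he with ⟨h2, he⟩ | ⟨he, n1, n2⟩
          · have h2 := h2 ρ h.ctx
            rw [Region.denote_eight hA] at h2
            rw [Set.union_eq_left.2 h2, he]
            exact SimData.write hv
          -- Old and new data are merged under an unknown type, and both were `NonChange`, so all
          -- bytes agree in the two memories.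
          · refine SimData.of_bytes_eq he fun x hx => ?_
            by_cases hxA : x ∈ interval A (A + 8)
            · have := hv.eq_of_nonChange h.ctx h.vars n2
              subst this
              refine Prod.ext (Memory.write_add rfl hxA) ?_
              rw [Memory.write_of_mem hxA, Memory.write_of_mem (mem_interval_eight_add.2 hxA)]
            · rw [Memory.write_of_notMem hxA,
                Memory.write_of_notMem (by rwa [mem_interval_eight_add]), ← hD₀]
              exact hm.data.bytes_eq (n1 ρ ρ' h.ctx h.vars) x (hx.resolve_left hxA)
    · have hd' : T.mem t = some d := by rwa [MemType.set_of_ne hts] at hd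
      have ht := h.mem t d hd'
      have hts' : SlotRel cfg (T.mem.set s c) θ ρ' ρ t d :=
        ht.toSlotRel.congr (hok t (by simp [hd'])) (hTP t) (fun _ => Taint.Equiv.refl _)
          (fun _ _ => rfl) fun _ _ => rfl
      have hsheq : slotShift cfg (T.mem.set s c) ρ' ρ t d = slotShift cfg T.mem ρ' ρ t d := by
        rw [slotShift, slotShift, getOpShift_congr (hTP t) (Taint.Equiv.refl _)]
      have hdis := hdisj t s (by simp [hd']) (by simp [hc₀]) hts
      have hcell : CellRel cfg (T.mem.set s c) θ ρ' ρ M' M t d :=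
        ⟨hts', ht.validSub, ht.taint, by rw [hsheq]; exact ht.data⟩
      refine hcell.congr_memory (fun x hx => ?_) fun x hx => ?_
      · refine Memory.write_of_notMem fun hxA => ?_
        exact Set.eq_empty_iff_forall_notMem.1 hdis x ⟨ht.validSub hx, hsub hxA⟩
      · refine Memory.write_of_notMem fun hxA => ?_
        -- If the shifted write hit the relocated data of another slot, admissible translates of two
        -- disjoint slots would meet.
        have hy : x + slotShift cfg (T.mem.set s c) ρ' ρ t d - D ∈ interval A (A + 8) := by
          rw [← mem_interval_eight_add (d := D)]; simpa using hxA
        refine MemConfig.ShiftOK.ne hts'.place hrel.place hts'.shiftOK hrel.shiftOK hdis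
          (ht.validSub hx) (hsub hy) ?_
        rw [hDs]; abel
  · intro x hx
    refine Memory.write_of_notMem fun hxA => hx ⟨s, by simp [hc₀], hsub hxA⟩
  · intro x hx
    refine Memory.write_of_notMem fun hxA => hx ⟨s, by simp [hc₀], ?_⟩
    have hy : x - D ∈ interval A (A + 8) := by
      rw [← mem_interval_eight_add (d := D)]; simpa using hxA
    simpa using hposs _ (hsub hy)

end access

/-! ## Instruction sequences -/

theorem getInst_of_seqAt {P : Program} {pc : PC} {i : Inst} {I : List Inst}
    (h : seqAt P pc = some (i :: I)) : getInst P pc = some i := by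
  unfold seqAt at h
  obtain ⟨J, hJ, h⟩ := Option.map_eq_some_iff.1 h
  unfold getInst
  rw [hJ, Option.bind_some]
  have := congrArg (fun L => L[0]?) h
  simpa using this

theorem seqAt_add {P : Program} {pc : PC} {L I : List Inst}
    (h : seqAt P pc = some (L ++ I)) :
    seqAt P { pc with idx := pc.idx + L.length } = some I := by
  unfold seqAt at *
  obtain ⟨J, hJ, h⟩ := Option.map_eq_some_iff.1 h
  simp only [hJ, Option.map_some, ← List.drop_drop, h]
  simp

theorem seqAt_next {P : Program} {pc : PC} {i : Inst} {I : List Inst}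
    (h : seqAt P pc = some (i :: I)) : seqAt P pc.next = some I := seqAt_add (L := [i]) h

theorem stateTypeAt_next {P : Program} {𝒯 : ProgType} {pc : PC} {T T₁ : StateType} {i : Inst}
    (hT : stateTypeAt P 𝒯 pc = some T) (hi : getInst P pc = some i)
    (hs : stepType 𝒯 pc.fn T i = some T₁) : stateTypeAt P 𝒯 pc.next = some T₁ := by
  unfold stateTypeAt at *
  unfold getInst at hi
  obtain ⟨I, hI, hi⟩ := Option.bind_eq_some_iff.1 hi
  rw [hI, Option.bind_some] at hT
  obtain ⟨T₀, hT₀, hT⟩ := Option.bind_eq_some_iff.1 hT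
  simp only [PC.next, hI, hT₀, Option.bind_some, List.take_add_one, hi, Option.toList_some,
    List.foldlM_append, hT, Option.bind_eq_bind]
  simpa using hs

theorem stateTypeAt_zero {P : Program} {𝒯 : ProgType} {f : FName} {ℓ : Label} {T : StateType}
    (hP : (P f ℓ).isSome) (hT : 𝒯 f ℓ = some T) : stateTypeAt P 𝒯 ⟨f, ℓ, 0⟩ = some T := by
  obtain ⟨I, hI⟩ := Option.isSome_iff_exists.1 hP
  simp [stateTypeAt, hI, hT]

theorem Transforms.isSome {cfg : MemConfig} {𝒯 : ProgType} {P P' : Program}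
    (h : Transforms cfg 𝒯 P P') {f : FName} {ℓ : Label} (hP : (P f ℓ).isSome) :
    (P' f ℓ).isSome := by
  obtain ⟨I, hI⟩ := Option.isSome_iff_exists.1 hP
  obtain ⟨T, I', -, -, h⟩ := (h f ℓ).2 I hI
  simp [h]

theorem Transforms.simPC_zero {cfg : MemConfig} {𝒯 : ProgType} {P P' : Program}
    (h : Transforms cfg 𝒯 P P') {f : FName} {ℓ : Label} (hP : (P f ℓ).isSome) :
    SimPC cfg P P' 𝒯 ⟨f, ℓ, 0⟩ ⟨f, ℓ, 0⟩ := by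
  obtain ⟨I, hI⟩ := Option.isSome_iff_exists.1 hP
  obtain ⟨T, I', hT, hI', h⟩ := (h f ℓ).2 I hI
  exact ⟨rfl, I', by simp [transSeqAt, seqAt, stateTypeAt, hI, hT, hI'], by simp [seqAt, h]⟩

/-! ## Invariants of typing -/

theorem updateMem_memLike (Δ Δ₂ : Ctx) (ℳ : MemType) (σcall σ : Subst) (στ : TSubst)
    (ℳ₁ : MemType) : MemLike (updateMem Δ Δ₂ ℳ σcall σ στ ℳ₁) ℳ := by
  refine ⟨fun s => by simp [updateMem], fun s c c₀ hc hc₀ _ => ?_⟩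
  simp only [updateMem, hc₀, Option.map_some, Option.some.injEq] at hc
  subst hc
  split_ifs
  · split
    · exact Taint.Equiv.refl _
    · split_ifs <;> exact Taint.Equiv.refl _
  · exact Taint.Equiv.refl _

theorem writeType_inv {S S₁ : StateType} {b : Basic} {o : Operand}
    (h : writeType S b o = some S₁) : S₁.ctx = S.ctx ∧ MemLike S₁.mem S.mem := by
  cases o with
  | reg r => cases h; exact ⟨rfl, MemLike.refl _⟩
  | imm v => cases h
  | mem m =>
    obtain ⟨a, -, h⟩ := Option.bind_eq_some_iff.1 h
    obtain ⟨c, hc, rfl⟩ := Option.map_eq_some_iff.1 h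
    exact ⟨rfl, storeType_memLike hc⟩

/-- By induction along a block, every program point inherits the constraints, the slots and the
relevant taints of the function entry. -/
theorem stepType_inv {𝒯 : ProgType} {f : FName} {S S₁ : StateType} {i : Inst}
    (h : stepType 𝒯 f S i = some S₁) : S.ctx ⊆ S₁.ctx ∧ MemLike S₁.mem S.mem := by
  cases i with
  | movq src dst =>
    obtain ⟨b, -, h⟩ := Option.bind_eq_some_iff.1 h
    obtain ⟨h1, h2⟩ := writeType_inv h
    exact ⟨h1.ge, h2⟩
  | addq src dst =>
    obtain ⟨b, -, h⟩ := Option.bind_eq_some_iff.1 h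
    obtain ⟨b', -, h⟩ := Option.bind_eq_some_iff.1 h
    obtain ⟨-, h⟩ := Option.ite_none_right_eq_some.1 h
    obtain ⟨S', hw, rfl⟩ := Option.map_eq_some_iff.1 h
    obtain ⟨h1, h2⟩ := writeType_inv hw
    exact ⟨h1.ge, h2⟩
  | cmpq src dst =>
    obtain ⟨b, -, h⟩ := Option.bind_eq_some_iff.1 h
    obtain ⟨b', -, h⟩ := Option.bind_eq_some_iff.1 h
    obtain ⟨-, h⟩ := Option.ite_none_right_eq_some.1 h
    cases h
    exact ⟨subset_rfl, MemLike.refl _⟩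
  | leaq m r =>
    obtain ⟨b, -, h⟩ := Option.bind_eq_some_iff.1 h
    obtain ⟨b', -, h⟩ := Option.bind_eq_some_iff.1 h
    obtain ⟨b'', -, h⟩ := Option.bind_eq_some_iff.1 h
    obtain ⟨-, h⟩ := Option.ite_none_right_eq_some.1 h
    cases h
    exact ⟨subset_rfl, MemLike.refl _⟩
  | pushq r s τ =>
    obtain ⟨b, -, h⟩ := Option.bind_eq_some_iff.1 h
    obtain ⟨b', -, h⟩ := Option.bind_eq_some_iff.1 h
    obtain ⟨-, h⟩ := Option.ite_none_right_eq_some.1 h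
    obtain ⟨c, hc, rfl⟩ := Option.map_eq_some_iff.1 h
    exact ⟨subset_rfl, storeType_memLike hc⟩
  | popq r s τ =>
    obtain ⟨b, -, h⟩ := Option.bind_eq_some_iff.1 h
    obtain ⟨-, h⟩ := Option.ite_none_right_eq_some.1 h
    obtain ⟨c, hc, rfl⟩ := Option.map_eq_some_iff.1 h
    exact ⟨subset_rfl, MemLike.refl _⟩
  | pushsecq r s τ => cases h
  | popsecq r s τ => cases h
  | jne ℓ σ =>
    obtain ⟨b, -, h⟩ := Option.bind_eq_some_iff.1 h
    obtain ⟨-, h⟩ := Option.ite_none_right_eq_some.1 h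
    cases h
    exact ⟨Set.subset_insert _ _, MemLike.refl _⟩
  | jmp ℓ σ => cases h
  | callq g σcall τcall σret =>
    obtain ⟨b, -, h⟩ := Option.bind_eq_some_iff.1 h
    obtain ⟨E, -, h⟩ := Option.bind_eq_some_iff.1 h
    obtain ⟨X, -, h⟩ := Option.bind_eq_some_iff.1 h
    obtain ⟨-, h⟩ := Option.ite_none_right_eq_some.1 h
    cases h
    exact ⟨Set.subset_union_left, updateMem_memLike _ _ _ _ _ _ _⟩
  | retq => cases h
  | halt => cases h

/-- Program point `pc` of a well-typed function has state type `T`, and the instructions from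
there on are `i :: I`. -/
structure TypedAt (P : Program) (𝒯 : ProgType) (pc : PC) (T E X : StateType) (i : Inst)
    (I : List Inst) : Prop where
  func : FuncTyped P 𝒯 pc.fn E X
  type : stateTypeAt P 𝒯 pc = some T
  seq : seqAt P pc = some (i :: I)
  typed : SeqTyped 𝒯 pc.fn T (i :: I)
  ctx : E.ctx ⊆ T.ctx
  mem : MemLike T.mem E.mem

theorem FuncTyped.memLike {P : Program} {𝒯 : ProgType} {f : FName} {E X : StateType}
    (h : FuncTyped P 𝒯 f E X) {ℓ : Label} {T : StateType} (hT : 𝒯 f ℓ = some T) :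
    MemLike T.mem E.mem := ⟨h.memDom ℓ T hT, h.uniformTaint ℓ T hT⟩

theorem foldlM_stepType_inv {𝒯 : ProgType} {f : FName} {T T₁ : StateType} {I J : List Inst}
    (hs : SeqTyped 𝒯 f T (J ++ I)) (h : J.foldlM (stepType 𝒯 f) T = some T₁) :
    I ≠ [] ∧ SeqTyped 𝒯 f T₁ I ∧ T.ctx ⊆ T₁.ctx ∧ MemLike T₁.mem T.mem := by
  induction J generalizing T with
  | nil =>
    cases h
    refine ⟨?_, hs, subset_rfl, MemLike.refl _⟩
    rintro rfl
    exact hs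
  | cons i J ih =>
    rw [List.foldlM_cons] at h
    obtain ⟨T₂, h₂, h⟩ := Option.bind_eq_some_iff.1 h
    obtain ⟨c2, m2⟩ := stepType_inv h₂
    have hs₂ : SeqTyped 𝒯 f T₂ (J ++ I) := by
      rw [List.cons_append] at hs
      cases hJ : J ++ I with
      | nil =>
        rw [hJ] at hs
        -- Only `jmp`, `retq` and `halt` may end a typed sequence, and `stepType` is `none` on them.
        cases i <;> first | exact hs.elim | cases h₂
      | cons j K =>
        rw [hJ] at hs
        obtain ⟨S', h1, h2⟩ := hs
        rw [h₂] at h1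
        cases h1
        exact h2
    obtain ⟨r1, r2, r3, r4⟩ := ih hs₂ h
    exact ⟨r1, r2, c2.trans r3, r4.trans m2⟩

/-- The state type at `pc` comes from running `stepType` over the instructions before it. Since a
typed block ends with an instruction that does not fall through, some instruction must remain. -/
theorem ProgTyped.exists_typedAt {P : Program} {𝒯 : ProgType} (h : ProgTyped P 𝒯) {pc : PC}
    {T : StateType} (hT : stateTypeAt P 𝒯 pc = some T) :
    ∃ E X i I, TypedAt P 𝒯 pc T E X i I := by
  have hT₀ := hT
  unfold stateTypeAt at hT
  obtain ⟨I, hI, hT⟩ := Option.bind_eq_some_iff.1 hT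
  obtain ⟨B, hB, hT⟩ := Option.bind_eq_some_iff.1 hT
  obtain ⟨E, X, hF⟩ := h.funcs pc.fn ⟨pc.lbl, by simp [hI]⟩
  have hs := hF.blocks _ _ _ hI hB
  rw [← List.take_append_drop pc.idx I] at hs
  obtain ⟨h1, h2, h3, h4⟩ := foldlM_stepType_inv hs hT
  obtain ⟨i, J, hJ⟩ := List.exists_cons_of_ne_nil h1
  exact ⟨E, X, i, J, hF, hT₀, by rw [seqAt, hI, Option.map_some, hJ], hJ ▸ h2,
    (hF.ctx _ _ hB).trans h3, h4.trans (hF.memLike hB)⟩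

theorem WellFormedAt.progTyped {cfg : MemConfig} {addr : PC → Word} {P : Program} {𝒯 : ProgType}
    {R : RegFile} {M : Memory} {Φ : List Frame} (h : WellFormedAt cfg addr P 𝒯 R M Φ) :
    ProgTyped P 𝒯 := by
  cases h <;> assumption

/-! ### Consequences of typing at a program point -/

section TypedAt
variable {cfg : MemConfig} {P P' : Program} {𝒯 : ProgType} {pc pc' : PC} {T E X : StateType}
  {i : Inst} {I : List Inst}

theorem TypedAt.getInst (h : TypedAt P 𝒯 pc T E X i I) : getInst P pc = some i :=
  getInst_of_seqAt h.seq

theorem TypedAt.slotsOK (h : TypedAt P 𝒯 pc T E X i I) : SlotsOK T.mem :=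
  h.mem.slotsOK h.func.slots

theorem TypedAt.slotsDisjoint (h : TypedAt P 𝒯 pc T E X i I) {ρ : Valuation}
    (hs : Sat ρ T.ctx) : SlotsDisjoint T.mem ρ :=
  h.mem.slotsDisjoint fun s s' h1 h2 hne =>
    h.func.slotsDisjoint s s' h1 h2 hne ρ (hs.mono h.ctx)

theorem TypedAt.retAddr (h : TypedAt P 𝒯 pc T E X i I) {ρ : Valuation}
    (hs : Sat ρ T.ctx) {s : Slot} (hm : (T.mem s).isSome) :
    s.region.denote ρ ∩ interval (ρ .sp) (ρ .sp + 8) = ∅ := by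
  have := h.func.retAddr E (Or.inl rfl) s ((h.mem.dom s).1 hm) ρ (hs.mono h.ctx)
  rwa [Region.denote_eight (a := ρ .sp) rfl] at this

theorem TypedAt.step (h : TypedAt P 𝒯 pc T E X i I)
    (hi : (∀ ℓ σ, i ≠ .jmp ℓ σ) ∧ i ≠ .retq ∧ i ≠ .halt) :
    I ≠ [] ∧ ∃ T₁, stepType 𝒯 pc.fn T i = some T₁ := by
  have hs := h.typed
  cases I with
  | nil =>
    obtain ⟨h1, h2, h3⟩ := hi
    cases i <;> simp_all [SeqTyped]
  | cons j J =>
    obtain ⟨T₁, h1, -⟩ := hs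
    exact ⟨by simp, T₁, h1⟩

theorem TypedAt.last (h : TypedAt P 𝒯 pc T E X i I) (hi : stepType 𝒯 pc.fn T i = none) :
    I = [] := by
  have hs := h.typed
  cases I with
  | nil => rfl
  | cons j J =>
    obtain ⟨T₁, h1, -⟩ := hs
    rw [hi] at h1
    cases h1

/-- The transformed program at related program counters. -/
theorem TypedAt.simPC (h : TypedAt P 𝒯 pc T E X i I) (hpc : SimPC cfg P P' 𝒯 pc' pc) :
    ∃ is I', StrategyOK T.mem ∧ transInst cfg.δ 𝒯 T i = some is ∧
      transInstAt cfg P 𝒯 pc = some is ∧ seqAt P' pc' = some (is ++ I') ∧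
      ∀ T₁, stepType 𝒯 pc.fn T i = some T₁ → I ≠ [] →
        stateTypeAt P 𝒯 pc.next = some T₁ ∧
        SimPC cfg P P' 𝒯 { pc' with idx := pc'.idx + is.length } pc.next := by
  obtain ⟨hfn, J, hJ, hseq⟩ := hpc
  unfold transSeqAt at hJ
  rw [h.seq, h.type, Option.bind_some, Option.bind_some, transSeq] at hJ
  obtain ⟨hst, hJ⟩ := Option.ite_none_right_eq_some.1 hJ
  obtain ⟨is, his, hJ⟩ := Option.bind_eq_some_iff.1 hJ
  have hat : transInstAt cfg P 𝒯 pc = some is := by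
    simp [transInstAt, h.getInst, h.type, his]
  by_cases hI : I = []
  · rw [if_pos hI] at hJ
    cases hJ
    exact ⟨_, [], hst, his, hat, by simpa using hseq, fun _ _ hne => absurd hI hne⟩
  · rw [if_neg hI] at hJ
    obtain ⟨T₁, hT₁, hJ⟩ := Option.bind_eq_some_iff.1 hJ
    obtain ⟨I', hI', rfl⟩ := Option.map_eq_some_iff.1 hJ
    refine ⟨is, I', hst, his, hat, hseq, fun T₂ hT₂ _ => ?_⟩
    rw [hT₁] at hT₂
    cases hT₂
    have hn := stateTypeAt_next h.type h.getInst hT₁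
    refine ⟨hn, hfn, I', ?_, seqAt_add hseq⟩
    rw [transSeqAt, seqAt_next h.seq, hn]
    exact hI'

end TypedAt

/-! ## Frames and calls -/

theorem Frame.val_of_input (fr : Frame) {x : Var} (h : x.input = true) : fr.val x = fr.σf x := by
  simp [Frame.val, h]

theorem Frame.inst_eq {fr : Frame} {σ : Subst} {x : Var} {v : Word}
    (h : (σ x).eval fr.val = some v) : fr.inst σ x = v := by
  simp [Frame.inst, h]

theorem Frame.eval_inst {fr : Frame} {σ : Subst} {x : Var} (h : ¬ (σ x).HasTop) :
    (σ x).eval fr.val = some (fr.inst σ x) := by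
  obtain ⟨v, hv⟩ := Exp.exists_eval h fr.val
  rw [hv, Frame.inst_eq hv]

theorem ProgTyped.funcTyped {P : Program} {𝒯 : ProgType} (h : ProgTyped P 𝒯) {g : FName}
    {E X : StateType} (hE : 𝒯 g .entry = some E) (hX : 𝒯 g .ret = some X) :
    FuncTyped P 𝒯 g E X := by
  obtain ⟨E', X', hF⟩ := h.funcs g ((h.dom g).2 ⟨.entry, by simp [hE]⟩)
  obtain rfl : E' = E := Option.some.inj (hF.entry.symm.trans hE)
  obtain rfl : X' = X := Option.some.inj (hF.exit.symm.trans hX)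
  exact hF

theorem exists_callOK {𝒯 : ProgType} {f g : FName} {T T₁ : StateType} {σcall : Subst}
    {τcall : TSubst} {σret : Var → Option Var}
    (h : stepType 𝒯 f T (.callq g σcall τcall σret) = some T₁) :
    ∃ b E X, T.regs .rsp = some b ∧ 𝒯 g .entry = some E ∧ 𝒯 g .ret = some X ∧ g ≠ .main ∧
      CallOK T b E X σcall τcall σret ∧ T₁ = callType T b X σcall τcall σret := by
  obtain ⟨b, hb, h⟩ := Option.bind_eq_some_iff.1 h
  obtain ⟨E, hE, h⟩ := Option.bind_eq_some_iff.1 h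
  obtain ⟨X, hX, h⟩ := Option.bind_eq_some_iff.1 h
  obtain ⟨⟨h1, h2⟩, h⟩ := Option.ite_none_right_eq_some.1 h
  cases h
  exact ⟨b, E, X, hb, hE, hX, h1, h2, rfl⟩

section CallOK
variable {P : Program} {𝒯 : ProgType} {T E X : StateType} {b : Basic} {g : FName} {σcall : Subst}
  {τcall : TSubst} {σret : Var → Option Var} {ρ ρ' : Valuation}

/-- The type of `rsp` is stably `sp + c` and `sp` is marked, so the stack pointer at a call is the
same number in both runs. -/
theorem CallOK.eval_rsp (h : CallOK T b E X σcall τcall σret) (hs : Sat ρ T.ctx)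
    (ha : AgreeNC ρ ρ') : ∃ A, b.e.eval ρ = some A ∧ b.e.eval ρ' = some A := by
  obtain ⟨c, hc⟩ := h.rsp
  refine ⟨ρ .sp + c, hc ρ ρ hs (AgreeNC.refl ρ), (hc ρ ρ' hs ha).trans ?_⟩
  change some (ρ' .sp + c) = _
  rw [ha .sp rfl]

/-- The callee's entry type for `rsp` is the variable `sp`, so subtyping at the pushed state
identifies the annotation of `sp` with the decremented stack pointer. The alternative of forgetting
the value is excluded because annotations contain no `top`. -/
theorem CallOK.eval_sp (h : CallOK T b E X σcall τcall σret) (hF : FuncTyped P 𝒯 g E X)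
    (hs : Sat ρ T.ctx) (ha : AgreeNC ρ ρ') {A : Word} (hA : b.e.eval ρ' = some A) :
    (σcall .sp).eval ρ' = some (A - 8) := by
  obtain ⟨t₀, -, hE, -⟩ := hF.rsp
  obtain ⟨b₁, hb₁, ⟨hsub, -⟩⟩ := h.sub.regs _ _ hE
  simp only [pushedType, RegType.set, Function.update_self, Option.some.injEq] at hb₁
  subst hb₁
  rcases hsub with hsub | ⟨-, hsub⟩
  · refine (hsub ρ ρ' hs ha).symm.trans ?_
    simp [Exp.eval, hA, BinOp.eval]
  · exact absurd hsub (h.noTop _)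

theorem CallOK.eval_retSlot (h : CallOK T b E X σcall τcall σret) (hs : Sat ρ T.ctx)
    {A : Word} (hA : b.e.eval ρ = some A) :
    ∃ s c, T.mem s = some c ∧ s.base = .sp ∧
      s.region.denote ρ = interval (A - 8) (A - 8 + 8) ∧ c.valid.denote ρ = ∅ ∧
      c.val.t.IsZero := by
  obtain ⟨s, c, h1, h2, h3, h4, h5⟩ := h.retSlot
  refine ⟨s, c, h1, h2, ?_, h4 ρ hs, h5⟩
  rw [h3 ρ hs]
  simp [Region.denote, Exp.eval, hA, BinOp.eval]

end CallOK

/-- Slots mention input variables only, and these keep their values during the life of a frame. So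
the frame conditions refer to the same addresses after each step. -/
theorem getDom_congr {ℳ ℳ₁ : MemType} {ρ ρ₁ : Valuation} (h : MemLike ℳ₁ ℳ) (hok : SlotsOK ℳ)
    (hρ : ∀ x : Var, x.input = true → ρ₁ x = ρ x) : getDom ℳ₁ ρ₁ = getDom ℳ ρ := by
  ext x
  refine exists_congr fun s => ?_
  rw [h.dom s]
  refine and_congr_right fun hs => ?_
  rw [Slot.denote_congr fun x hx => hρ x ((hok s hs).input x hx)]

theorem getPossibleSlot_congr {ℳ ℳ₁ : MemType} {ρ ρ₁ ρ' ρ₁' : Valuation} {s : Slot} {δ : Word}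
    (h : TransPtr ℳ₁ s ↔ TransPtr ℳ s) (hρ : ∀ x ∈ s.vars, ρ₁ x = ρ x)
    (hρ' : ∀ x ∈ s.vars, ρ₁' x = ρ' x) :
    getPossibleSlot δ ℳ₁ ρ₁' ρ₁ s = getPossibleSlot δ ℳ ρ' ρ s := by
  unfold getPossibleSlot
  rw [h, Slot.denote_congr hρ, ptrDiff_congr hρ hρ']

theorem getShiftedDom_congr {ℳ ℳ₁ : MemType} {ρ ρ₁ ρ' ρ₁' : Valuation} {δ : Word}
    (h : MemLike ℳ₁ ℳ) (hok : SlotsOK ℳ) (hρ : ∀ x : Var, x.input = true → ρ₁ x = ρ x)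
    (hρ' : ∀ x : Var, x.input = true → ρ₁' x = ρ' x) :
    getShiftedDom δ ℳ₁ ρ₁' ρ₁ = getShiftedDom δ ℳ ρ' ρ := by
  ext x
  refine exists_congr fun s => ?_
  rw [h.dom s]
  refine and_congr_right fun hs => ?_
  rw [getPossibleSlot_congr (h.transPtr_iff (h.slotsOK hok))
    (fun x hx => hρ x ((hok s hs).input x hx)) fun x hx => hρ' x ((hok s hs).input x hx)]

/-! ## Changing the current frame -/

section Sim
variable {cfg : MemConfig} {addr addr' : PC → Word} {P P' : Program} {𝒯 : ProgType}

theorem SimAt.head {R' R : RegFile} {M' M : Memory} {fr' fr : Frame} {Φ' Φ : List Frame}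
    (h : SimAt cfg addr addr' P P' 𝒯 R' M' (fr' :: Φ') R M (fr :: Φ)) :
    WellFormedAt cfg addr P 𝒯 R M (fr :: Φ) ∧
      ∃ T, SimHelper cfg P P' 𝒯 T R' M' fr' R M fr := by
  cases h with
  | base h₁ h₂ => exact ⟨h₂, _, h₁⟩
  | call h₁ h₂ => exact ⟨h₂, _, h₁⟩

/-- The return address of a frame lies in a slot of the caller. -/
theorem SimHelper.exists_retSlot {R' R : RegFile} {M' M : Memory} {p' p fr : Frame} {T : StateType}
    (h : SimHelper cfg P P' 𝒯 T R' M' p' R M p) (hP : ProgTyped P 𝒯) {g : FName} {σcall : Subst}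
    {τcall : TSubst} {σret : Var → Option Var}
    (hi : getInst P p.pc = some (.callq g σcall τcall σret))
    (hsp : fr.σf .sp = p.inst σcall .sp) :
    ∃ s c, T.mem s = some c ∧ s.base = .sp ∧ s.region.denote p.val = fr.retRegion ∧
      c.valid.denote p.val = ∅ ∧ c.val.t.IsZero := by
  obtain ⟨E₀, X₀, i, I, ht⟩ := hP.exists_typedAt h.type
  obtain rfl : i = _ := Option.some.inj (ht.getInst.symm.trans hi)
  obtain ⟨-, T₁, hT₁⟩ := ht.step (by simp)
  obtain ⟨b, E, X, hb, hE, hX, hg, hok, -⟩ := exists_callOK hT₁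
  obtain ⟨A, hA, -⟩ := hok.eval_rsp h.rel.ctx h.rel.vars
  obtain ⟨s, c, h1, h2, h3, h4, h5⟩ := hok.eval_retSlot h.rel.ctx hA
  refine ⟨s, c, h1, h2, ?_, h4, h5⟩
  rw [h3, Frame.retRegion, hsp,
    Frame.inst_eq (hok.eval_sp (hP.funcTyped hE hX) h.rel.ctx (AgreeNC.refl _) hA)]

/-- Changing the current frame, and memory in the slots of the function only. -/
theorem SimAt.relocate {R' R R₁' R₁ : RegFile} {M' M M₁' M₁ : Memory} {fr' fr fr₁' fr₁ : Frame}
    {Φ' Φ : List Frame} {T T₁ : StateType}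
    (h : SimAt cfg addr addr' P P' 𝒯 R' M' (fr' :: Φ') R M (fr :: Φ))
    (hT : stateTypeAt P 𝒯 fr.pc = some T)
    (h₁ : SimHelper cfg P P' 𝒯 T₁ R₁' M₁' fr₁' R₁ M₁ fr₁)
    (hfn : fr₁.pc.fn = fr.pc.fn) (hσ : fr₁.σf = fr.σf) (hθ : fr₁.θ = fr.θ)
    (hσ' : fr₁'.σf = fr'.σf) (hlike : MemLike T₁.mem T.mem)
    (hM : ∀ x, x ∉ getDom T.mem fr.val → M₁ x = M x)
    (hM' : ∀ x, x ∉ getShiftedDom cfg.δ T.mem fr'.val fr.val → M₁' x = M' x) :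
    SimAt cfg addr addr' P P' 𝒯 R₁' M₁' (fr₁' :: Φ') R₁ M₁ (fr₁ :: Φ) := by
  cases h with
  | base hh hw =>
    refine SimAt.base h₁ ?_
    cases hw with
    | base a1 a2 a3 a4 => exact WellFormedAt.base a1 (hfn.trans a2) h₁.type h₁.typed
  | @call _ _ _ _ _ _ _ _ _ _ p' p Φ' Φ T₀ _ _ _ _ _ hh hw a1 a2 a3 a4 a5 a6 a7 a8 a9
      a10 =>
    obtain rfl : T₀ = T := Option.some.inj (hh.type.symm.trans hT)
    cases hw with
    | @call _ _ _ Tw _ _ _ _ σcall τcall σret b1 b2 b3 b4 b5 b6 b7 b8 b9 b10 =>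
      obtain rfl : T₀ = Tw := Option.some.inj (hT.symm.trans b3)
      obtain ⟨E, X, i, I, ht⟩ := b1.exists_typedAt hh.type
      have hok := ht.slotsOK
      -- The slots of a function avoid its return address; changes inside the slots cannot alter it.
      have hret : ∀ x ∈ fr.retRegion, x ∉ getDom T₀.mem fr.val := by
        rintro x hx ⟨s, hs, hxs⟩
        have := ht.retAddr hh.rel.ctx hs
        exact Set.eq_empty_iff_forall_notMem.1 this x ⟨hxs, hx⟩
      have hrr : fr₁.retRegion = fr.retRegion := by rw [Frame.retRegion, hσ, Frame.retRegion]
      obtain ⟨-, Tp, hp⟩ := a6.head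
      obtain ⟨sr, cr, c1, c2, c3, -, -⟩ := hp.exists_retSlot b1 b7 (b8 .sp rfl)
      -- The return address fills a slot of the caller with base `sp`, which is TransOp and hence in
      -- the public stack. It is never moved, so relocated slots of the callee cannot meet it
      -- either.
      have hpub : fr.retRegion ⊆ cfg.stackPub := by
        rw [← c3]
        exact ((hp.rel.mem sr cr c1).op fun ht => ht.1 c2).1
      have hret' : ∀ x ∈ fr.retRegion, x ∉ getShiftedDom cfg.δ T₀.mem fr'.val fr.val := by
        rintro x hx ⟨s, hs, hxs⟩
        obtain ⟨c, hc⟩ := Option.isSome_iff_exists.1 hs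
        have hr := hh.rel.mem s c hc
        obtain ⟨d, y, hd, hy, rfl⟩ := hr.exists_of_mem_possibleSlot hxs
        have := ht.retAddr hh.rel.ctx hs
        refine MemConfig.ShiftOK.ne hr.place (Or.inl hpub) hd (Or.inl rfl) this hy hx ?_
        rw [add_zero]
      have hdom : getDom T₁.mem fr₁.val = getDom T₀.mem fr.val :=
        getDom_congr hlike hok fun x hx => by simp [Frame.val, hx, hσ]
      have hsdom : getShiftedDom cfg.δ T₁.mem fr₁'.val fr₁.val =
          getShiftedDom cfg.δ T₀.mem fr'.val fr.val :=
        getShiftedDom_congr hlike hok (fun x hx => by simp [Frame.val, hx, hσ]) fun x hx => by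
          simp [Frame.val, hx, hσ']
      have hrd : M₁.read (fr.σf .sp) = M.read (fr.σf .sp) :=
        Memory.read_congr_of_interval fun x hx => hM x (hret x hx)
      have hrd' : M₁'.read (fr.σf .sp) = M'.read (fr.σf .sp) :=
        Memory.read_congr_of_interval fun x hx => hM' x (hret' x hx)
      have hfn' : fr₁'.pc.fn = fr'.pc.fn := by rw [h₁.pc.1, hfn, hh.pc.1]
      refine SimAt.call h₁ ?_ (hfn' ▸ a1) (hσ' ▸ a2) ?_ a4 a5 a6 ?_ ?_ ?_ ?_
      · refine WellFormedAt.call b1 (hfn ▸ b2) h₁.type h₁.typed ?_ ?_ (hfn ▸ b7) (hσ ▸ b8)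
          (hθ ▸ b9) b10
        · rw [hσ, hrd, b5]
        · rw [hdom, hrr]
          exact fun x hx => (hM x fun h => hx (Or.inl h)).trans (b6 x hx)
      · intro x
        rw [h₁.taints, hθ, ← hh.taints]
        exact a3 x
      · rw [hσ, hrd, a7]
      · rw [hσ, hrd', a8]
      · rw [hdom, hrr]
        exact fun x hx => (hM x fun h => hx (Or.inl h)).trans (a9 x hx)
      · rw [hsdom, hrr]
        exact fun x hx => (hM' x fun h => hx (Or.inl h)).trans (a10 x hx)

end Sim

/-! ## Instructions that fall through -/

section Rel
variable {cfg : MemConfig} {T : StateType} {θ : TVar → Bool} {ρ' ρ : Valuation} {R' R : RegFile}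
  {M' M : Memory}

theorem Rel.readVal (h : Rel cfg T θ ρ' ρ R' M' R M) {o : Operand} {b : Basic}
    (ho : readType T o = some b) :
    ∃ v' v, readVal R M θ o = some v ∧ readVal R' M' θ (transOp cfg.δ T.mem o) = some v' ∧
      SimVal b.e ρ' ρ v' v ∧ (v.2 = true → b.t.eval θ = true) := by
  cases o with
  | reg r => exact ⟨_, _, rfl, rfl, h.regs _ _ ho, h.regTaint _ _ ho⟩
  | imm v =>
    cases ho
    exact ⟨_, _, rfl, rfl, SimVal.of_eval rfl rfl rfl, fun h => h⟩
  | mem m =>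
    obtain ⟨a, ha, hl⟩ := Option.bind_eq_some_iff.1 ho
    obtain ⟨A, hA, hok, v', v, h1, h2, h3, h4⟩ := h.load hl
    obtain ⟨B, hB, hB1, hB2⟩ := h.effAddr ha hok
    obtain rfl : A = B := Option.some.inj (hA.symm.trans hB)
    refine ⟨v', v, ?_, ?_, h3, h4⟩
    · simp [Octal.readVal, hB1, h1]
    · simp [Octal.readVal, transOp, effAddr_transMemOp, transMemOp_taint, hB2, h2]

theorem Rel.setReg (h : Rel cfg T θ ρ' ρ R' M' R M) {r : Reg} {b : Basic} {v' v : Word × Bool}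
    (hv : SimVal b.e ρ' ρ v' v) (ht : v.2 = true → b.t.eval θ = true) :
    Rel cfg { T with regs := T.regs.set r b } θ ρ' ρ (R'.set r v') M' (R.set r v) M where
  ctx := h.ctx
  vars := h.vars
  regs q c hc := by
    by_cases hq : q = r
    · subst hq
      simp only [RegType.set, Function.update_self, Option.some.injEq] at hc
      subst hc
      simpa [RegFile.set] using hv
    · simp only [RegType.set, Function.update_of_ne hq] at hc
      simpa [RegFile.set, hq] using h.regs q c hc
  regTaint q c hc := by
    by_cases hq : q = r
    · subst hq
      simp only [RegType.set, Function.update_self, Option.some.injEq] at hc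
      subst hc
      simpa [RegFile.set] using ht
    · simp only [RegType.set, Function.update_of_ne hq] at hc
      simpa [RegFile.set, hq] using h.regTaint q c hc
  mem := h.mem

theorem Rel.setMem (h : Rel cfg T θ ρ' ρ R' M' R M) {ℳ : MemType} {M₁' M₁ : Memory}
    (hm : ∀ s c, ℳ s = some c → CellRel cfg ℳ θ ρ' ρ M₁' M₁ s c) :
    Rel cfg { T with mem := ℳ } θ ρ' ρ R' M₁' R M₁ :=
  ⟨h.ctx, h.vars, h.regs, h.regTaint, hm⟩

/-- Memory changes in the slots only. -/
def ChangesSlots (cfg : MemConfig) (ℳ : MemType) (ρ' ρ : Valuation) (M' M M₁' M₁ : Memory) :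
    Prop :=
  (∀ x, x ∉ getDom ℳ ρ → M₁ x = M x) ∧ ∀ x, x ∉ getShiftedDom cfg.δ ℳ ρ' ρ → M₁' x = M' x

theorem ChangesSlots.refl (cfg : MemConfig) (ℳ : MemType) (ρ' ρ : Valuation) (M' M : Memory) :
    ChangesSlots cfg ℳ ρ' ρ M' M M' M := ⟨fun _ _ => rfl, fun _ _ => rfl⟩

theorem Rel.writeVal (h : Rel cfg T θ ρ' ρ R' M' R M) (hok : SlotsOK T.mem)
    (hdisj : SlotsDisjoint T.mem ρ) {o : Operand} {b : Basic} {T₁ : StateType}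
    (ho : writeType T b o = some T₁) {v' v : Word × Bool} (hv : SimVal b.e ρ' ρ v' v)
    (ht : v.2 = true → b.t.eval θ = true) :
    ∃ R₁' M₁' R₁ M₁, writeVal R M θ v o = some (R₁, M₁) ∧
      writeVal R' M' θ v' (transOp cfg.δ T.mem o) = some (R₁', M₁') ∧
      Rel cfg T₁ θ ρ' ρ R₁' M₁' R₁ M₁ ∧ ChangesSlots cfg T.mem ρ' ρ M' M M₁' M₁ := by
  cases o with
  | reg r =>
    cases ho
    exact ⟨_, _, _, _, rfl, rfl, h.setReg hv ht, ChangesSlots.refl _ _ _ _ _ _⟩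
  | imm w => cases ho
  | mem m =>
    obtain ⟨a, ha, ho⟩ := Option.bind_eq_some_iff.1 ho
    obtain ⟨c, hc, rfl⟩ := Option.map_eq_some_iff.1 ho
    obtain ⟨A, hA, hacc, M₁', M₁, h1, h2, h3, h4, h5⟩ := h.store hok hdisj hc hv ht
    obtain ⟨B, hB, hB1, hB2⟩ := h.effAddr ha hacc
    obtain rfl : A = B := Option.some.inj (hA.symm.trans hB)
    refine ⟨R', M₁', R, M₁, ?_, ?_, h.setMem h3, h4, h5⟩
    · simp [Octal.writeVal, hB1, h1]
    · simp [Octal.writeVal, transOp, effAddr_transMemOp, transMemOp_taint, hB2, h2]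

end Rel

/-- The conclusion of the simulation theorem for one step. -/
def SimStep (cfg : MemConfig) (addr addr' : PC → Word) (P P' : Program) (𝒯 : ProgType)
    (S' S : State) : Prop :=
  ∃ (fr : Frame) (Φ : List Frame) (inst : Inst) (is : List Inst) (S₁ S₁' : State),
    S.Φ = fr :: Φ ∧ getInst P fr.pc = some inst ∧ transInstAt cfg P 𝒯 fr.pc = some is ∧
    Step cfg addr P S inst S₁ ∧ Steps cfg addr' P' S' is S₁' ∧
    Sim cfg addr addr' P P' 𝒯 S₁' S₁

/-- The effect on registers and memory of an instruction `i` that falls through, and of its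
transformation `i'`. -/
def FallsThrough (cfg : MemConfig) (addr addr' : PC → Word) (P P' : Program) (T T₁ : StateType)
    (R' : RegFile) (M' : Memory) (fr' : Frame) (Φ' : List Frame) (R : RegFile) (M : Memory)
    (fr : Frame) (Φ : List Frame) (i' i : Inst) : Prop :=
  ∃ R₁' M₁' R₁ M₁, exec cfg addr P R M fr Φ i = some ⟨R₁, M₁, { fr with pc := fr.pc.next } :: Φ⟩ ∧
    exec cfg addr' P' R' M' fr' Φ' i' = some ⟨R₁', M₁', { fr' with pc := fr'.pc.next } :: Φ'⟩ ∧
    Rel cfg T₁ fr.θ fr'.val fr.val R₁' M₁' R₁ M₁ ∧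
    ChangesSlots cfg T.mem fr'.val fr.val M' M M₁' M₁

section Sim
variable {cfg : MemConfig} {addr addr' : PC → Word} {P P' : Program} {𝒯 : ProgType}

theorem SimAt.progTyped {R' R : RegFile} {M' M : Memory} {fr' fr : Frame} {Φ' Φ : List Frame}
    (h : SimAt cfg addr addr' P P' 𝒯 R' M' (fr' :: Φ') R M (fr :: Φ)) : ProgTyped P 𝒯 :=
  h.head.1.progTyped

theorem SimAt.simStep_of_fallsThrough {R' R : RegFile} {M' M : Memory} {fr' fr : Frame}
    {Φ' Φ : List Frame} {T T₁ E X : StateType} {i i' : Inst} {I : List Inst}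
    (h : SimAt cfg addr addr' P P' 𝒯 R' M' (fr' :: Φ') R M (fr :: Φ))
    (hh : SimHelper cfg P P' 𝒯 T R' M' fr' R M fr) (ht : TypedAt P 𝒯 fr.pc T E X i I)
    (hI : I ≠ []) (hs : stepType 𝒯 fr.pc.fn T i = some T₁)
    (htr : transInst cfg.δ 𝒯 T i = some [i'])
    (hf : FallsThrough cfg addr addr' P P' T T₁ R' M' fr' Φ' R M fr Φ i' i) :
    SimStep cfg addr addr' P P' 𝒯 ⟨R', M', fr' :: Φ'⟩ ⟨R, M, fr :: Φ⟩ := by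
  obtain ⟨R₁', M₁', R₁, M₁, e, e', hrel, hM, hM'⟩ := hf
  obtain ⟨is, I', -, h2, h3, h4, h5⟩ := ht.simPC hh.pc
  obtain rfl : is = [i'] := Option.some.inj (h2.symm.trans htr)
  obtain ⟨hT₁, hpc⟩ := h5 T₁ hs hI
  refine ⟨fr, Φ, i, [i'], _, _, rfl, ht.getInst, h3, ⟨fr, Φ, rfl, ht.getInst, e⟩,
    Steps.cons ⟨fr', Φ', rfl, getInst_of_seqAt h4, e'⟩ (Steps.nil _), ?_⟩
  have hlike := (stepType_inv hs).2
  have hh₁ : SimHelper cfg P P' 𝒯 T₁ R₁' M₁' { fr' with pc := fr'.pc.next } R₁ M₁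
      { fr with pc := fr.pc.next } :=
    Rel.simHelper (fr := { fr with pc := fr.pc.next }) (fr' := { fr' with pc := fr'.pc.next })
      hrel hpc hT₁ hh.taints (hlike.slotsOK ht.slotsOK)
  exact h.relocate hh.type hh₁ rfl rfl rfl rfl hlike hM hM'

theorem Taint.IsZero.snd_eq_false {t : Taint} (h : t.IsZero) {θ : TVar → Bool} {b : Bool}
    (hb : b = true → t.eval θ = true) : b = false := by
  by_contra hh
  have := hb (by simpa using hh)
  rw [h θ] at this
  cases this

/-- Data instructions fall through. -/
theorem SimHelper.fallsThrough {R' R : RegFile} {M' M : Memory} {fr' fr : Frame}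
    (Φ' Φ : List Frame) {T T₁ E X : StateType} {i : Inst} {I : List Inst}
    (hh : SimHelper cfg P P' 𝒯 T R' M' fr' R M fr) (ht : TypedAt P 𝒯 fr.pc T E X i I)
    (hs : stepType 𝒯 fr.pc.fn T i = some T₁) (hjne : ∀ ℓ σ, i ≠ .jne ℓ σ)
    (hcall : ∀ g σcall τcall σret, i ≠ .callq g σcall τcall σret) :
    ∃ i', transInst cfg.δ 𝒯 T i = some [i'] ∧
      FallsThrough cfg addr addr' P P' T T₁ R' M' fr' Φ' R M fr Φ i' i := by
  have h := hh.rel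
  have hok := ht.slotsOK
  have hdisj := ht.slotsDisjoint h.ctx
  have hθ := hh.taints
  cases i with
  | movq src dst =>
    obtain ⟨b, hb, hs⟩ := Option.bind_eq_some_iff.1 hs
    obtain ⟨v', v, h1, h2, h3, h4⟩ := h.readVal hb
    obtain ⟨R₁', M₁', R₁, M₁, k1, k2, k3, k4⟩ := h.writeVal hok hdisj hs h3 h4
    exact ⟨_, rfl, R₁', M₁', R₁, M₁, by simp [exec, h1, k1], by simp [exec, hθ, h2, k2], k3, k4⟩
  | addq src dst =>
    obtain ⟨b₁, hb₁, hs⟩ := Option.bind_eq_some_iff.1 hs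
    obtain ⟨b₀, hb₀, hs⟩ := Option.bind_eq_some_iff.1 hs
    obtain ⟨htop, hs⟩ := Option.ite_none_right_eq_some.1 hs
    obtain ⟨T₂, hw, rfl⟩ := Option.map_eq_some_iff.1 hs
    obtain ⟨v', v, h1, h2, h3, h4⟩ := h.readVal hb₁
    obtain ⟨u', u, g1, g2, g3, g4⟩ := h.readVal hb₀
    have hsv := g3.bin h3 h.ctx h.vars htop
    have htt : (u.2 || v.2) = true → (b₀.t.join b₁.t).eval fr.θ = true := by
      rw [Bool.or_eq_true, Taint.eval, Bool.or_eq_true]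
      exact Or.imp g4 h4
    obtain ⟨R₁', M₁', R₁, M₁, k1, k2, k3, k4⟩ := h.writeVal hok hdisj hw hsv htt
    simp only [BinOp.eval] at k1 k2 hsv
    exact ⟨_, rfl, _, M₁', _, M₁, by simp [exec, h1, g1, k1], by simp [exec, hθ, h2, g2, k2],
      k3.setReg hsv.flag htt, k4⟩
  | cmpq src dst =>
    obtain ⟨b₁, hb₁, hs⟩ := Option.bind_eq_some_iff.1 hs
    obtain ⟨b₀, hb₀, hs⟩ := Option.bind_eq_some_iff.1 hs
    obtain ⟨htop, hs⟩ := Option.ite_none_right_eq_some.1 hs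
    cases hs
    obtain ⟨v', v, h1, h2, h3, h4⟩ := h.readVal hb₁
    obtain ⟨u', u, g1, g2, g3, g4⟩ := h.readVal hb₀
    have hsv := g3.bin h3 h.ctx h.vars htop
    have htt : (u.2 || v.2) = true → (b₀.t.join b₁.t).eval fr.θ = true := by
      rw [Bool.or_eq_true, Taint.eval, Bool.or_eq_true]
      exact Or.imp g4 h4
    simp only [BinOp.eval] at hsv
    exact ⟨_, rfl, _, M', _, M, by simp [exec, h1, g1], by simp [exec, hθ, h2, g2],
      h.setReg hsv.flag htt, ChangesSlots.refl _ _ _ _ _ _⟩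
  | leaq m r =>
    obtain ⟨b, hb, hs⟩ := Option.bind_eq_some_iff.1 hs
    obtain ⟨i, hi, hs⟩ := Option.bind_eq_some_iff.1 hs
    obtain ⟨a, ha, hs⟩ := Option.bind_eq_some_iff.1 hs
    obtain ⟨htop, hs⟩ := Option.ite_none_right_eq_some.1 hs
    cases hs
    simp only [addrType, hb, hi, Option.bind_some, Option.map_some, Option.some.injEq] at ha
    subst ha
    refine ⟨_, rfl, _, M', _, M, rfl, rfl, h.setReg ?_ ?_, ChangesSlots.refl _ _ _ _ _ _⟩
    · have hB := h.regs _ _ hb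
      have hI := h.regs _ _ hi
      by_cases he : ((b.e.add (.bin .mul i.e (.const m.scale))).add (.const m.disp)).HasTop
      · obtain ⟨n1, n2⟩ := htop he
        refine SimVal.of_top he ?_
        rw [hB.eq_of_nonChange h.ctx h.vars n1, hI.eq_of_nonChange h.ctx h.vars n2]
      · have hnb : ¬ b.e.HasTop := fun h => he (Or.inl (Or.inl h))
        have hni : ¬ i.e.HasTop := fun h => he (Or.inl (Or.inr (Or.inl h)))
        obtain ⟨p1, p2⟩ := hB.eval hnb
        obtain ⟨q1, q2⟩ := hI.eval hni
        exact SimVal.of_eval (by simp [hB.1, hI.1]) (by simp [Exp.eval, p1, q1, BinOp.eval])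
          (by simp [Exp.eval, p2, q2, BinOp.eval])
    · rw [Bool.or_eq_true, Taint.eval, Bool.or_eq_true]
      exact Or.imp (h.regTaint _ _ hb) (h.regTaint _ _ hi)
  | pushq r s τ =>
    obtain ⟨v, hv, hs⟩ := Option.bind_eq_some_iff.1 hs
    obtain ⟨b, hb, hs⟩ := Option.bind_eq_some_iff.1 hs
    obtain ⟨⟨hsp, hτ⟩, hs⟩ := Option.ite_none_right_eq_some.1 hs
    obtain ⟨c, hc, rfl⟩ := Option.map_eq_some_iff.1 hs
    obtain ⟨A, hA, hacc, M₁', M₁, h1, h2, h3, h4, h5⟩ :=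
      h.store hok hdisj hc (h.regs _ _ hv) (h.regTaint _ _ hv)
    obtain ⟨c₀, hc₀, -⟩ := exists_of_storeType hc
    have hnt : ¬ TransPtr T.mem s :=
      not_transPtr_of_isLocalStack (hok s (by simp [hc₀])) (Or.inl hsp)
    -- A spill slot has base `sp` and is TransOp, and the annotation of a push is not zero; the
    -- displacement is therefore exactly the one built into `pushsecq`.
    have hsh : opShift cfg.δ T.mem s τ = cfg.δ := by
      rw [opShift, getOpShift, if_neg]
      rintro (h | h)
      · exact hnt h
      · exact hτ h
    have hpd := (h.mem s c₀ hc₀).ptrDiff_eq_zero hnt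
    have hR := h.regs _ _ hb
    have hbt : b.t.IsZero := hacc.1
    have t0 : (R .rsp).2 = false := hbt.snd_eq_false (h.regTaint _ _ hb)
    have t0' : (R' .rsp).2 = false := hR.1.trans t0
    have hnb : ¬ b.e.HasTop := fun h => hacc.2.1 (Or.inl h)
    obtain ⟨p1, p2⟩ := hR.eval hnb
    obtain ⟨B, hB, hB'⟩ := hacc.eval h.ctx h.vars
    obtain rfl : A = B := Option.some.inj (hA.symm.trans hB)
    simp only [Exp.eval, p1, p2, Option.bind_some, Option.map_some, BinOp.eval,
      Option.some.injEq] at hA hB'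
    rw [hsh, ← hB'] at h2
    rw [← hA] at h1
    refine ⟨_, rfl, R'.set .rsp ((R' .rsp).1 - 8, false), M₁', R.set .rsp ((R .rsp).1 - 8, false),
      M₁, by rw [exec, if_pos t0, h1]; rfl, by rw [exec, if_pos t0', hθ, h2]; rfl,
      (h.setMem h3).setReg ?_ ?_, h4, h5⟩
    · exact SimVal.of_eval rfl (by simp [Exp.eval, p1, BinOp.eval])
        (by simp [Exp.eval, p2, BinOp.eval])
    · simp
  | popq r s τ =>
    obtain ⟨b, hb, hs⟩ := Option.bind_eq_some_iff.1 hs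
    obtain ⟨⟨hr, hsp, hτ⟩, hs⟩ := Option.ite_none_right_eq_some.1 hs
    obtain ⟨v, hl, rfl⟩ := Option.map_eq_some_iff.1 hs
    obtain ⟨A, hA, hacc, v', v₀, h1, h2, h3, h4⟩ := h.load hl
    obtain ⟨c₀, hc₀, -⟩ := exists_of_loadType hl
    have hnt : ¬ TransPtr T.mem s :=
      not_transPtr_of_isLocalStack (hok s (by simp [hc₀])) (Or.inl hsp)
    have hsh : opShift cfg.δ T.mem s τ = cfg.δ := by
      rw [opShift, getOpShift, if_neg]
      rintro (h | h)
      · exact hnt h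
      · exact hτ h
    have hpd := (h.mem s c₀ hc₀).ptrDiff_eq_zero hnt
    have hR := h.regs _ _ hb
    have hbt : b.t.IsZero := hacc.1
    have t0 : (R .rsp).2 = false := hbt.snd_eq_false (h.regTaint _ _ hb)
    have t0' : (R' .rsp).2 = false := hR.1.trans t0
    obtain ⟨p1, p2⟩ := hR.eval hacc.2.1
    obtain ⟨B, hB, hB'⟩ := hacc.eval h.ctx h.vars
    obtain rfl : A = B := Option.some.inj (hA.symm.trans hB)
    rw [p1, Option.some.injEq] at hB'
    rw [p2, Option.some.injEq] at hA
    rw [hsh, ← hB'] at h2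
    rw [← hA] at h1
    refine ⟨_, rfl, _, M', _, M, by simp [exec, t0, h1]; rfl, by simp [exec, t0', hθ, h2]; rfl,
      (h.setReg h3 h4).setReg ?_ ?_, ChangesSlots.refl _ _ _ _ _ _⟩
    · exact SimVal.of_eval rfl (by simp [Exp.eval, p1, BinOp.eval])
        (by simp [Exp.eval, p2, BinOp.eval])
    · simp
  | pushsecq r s τ => cases hs
  | popsecq r s τ => cases hs
  | jne ℓ σ => exact absurd rfl (hjne ℓ σ)
  | jmp ℓ σ => cases hs
  | callq g σcall τcall σret => exact absurd rfl (hcall _ _ _ _)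
  | retq => cases hs
  | halt => cases hs

end Sim

/-! ## Subtyping -/

section Subtyping
variable {Δ : Ctx} {ρ' ρ : Valuation}

theorem BasicSub.simVal {b₁ b₂ : Basic} (h : BasicSub Δ b₁ b₂) (hs : Sat ρ Δ) (ha : AgreeNC ρ ρ')
    {v' v : Word × Bool} (hv : SimVal b₁.e ρ' ρ v' v) : SimVal b₂.e ρ' ρ v' v := by
  refine hv.transfer ?_
  rcases h.1 with h | ⟨h1, h2⟩
  · exact Or.inl ⟨(h ρ ρ' hs ha).symm, (h ρ ρ hs (AgreeNC.refl ρ)).symm⟩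
  · exact Or.inr ⟨h2, h1 ρ ρ' hs ha⟩

theorem CellSub.simData {s₁ s₂ : Slot} {c₁ c₂ : Cell} (h : CellSub Δ s₁ c₁ s₂ c₂) (hs : Sat ρ Δ)
    (ha : AgreeNC ρ ρ') {M' M : Memory} {d : Word}
    (hd : SimData c₁.val.e ρ' ρ M' M (c₁.valid.denote ρ) d) :
    SimData c₂.val.e ρ' ρ M' M (c₂.valid.denote ρ) d := by
  refine hd.transfer (h.2.1 ρ hs) ?_
  rcases h.2.2.1 with ⟨h1, h2⟩ | ⟨h1, h2⟩ | h1
  · exact Or.inl ⟨(h1 ρ ρ' hs ha).symm, (h1 ρ ρ hs (AgreeNC.refl ρ)).symm,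
      h2.imp_right fun h => (h ρ hs).symm⟩
  · exact Or.inr (Or.inl ⟨h2, h1 ρ ρ' hs ha⟩)
  · exact Or.inr (Or.inr (h1 ρ hs))

/-- Subtyping lets the taint change only for an empty valid region, where no data can be misplaced.
-/
theorem CellSub.taint_equiv {s₁ s₂ : Slot} {c₁ c₂ : Cell} (h : CellSub Δ s₁ c₁ s₂ c₂)
    (hs : Sat ρ Δ) (hne : c₂.valid.denote ρ ≠ ∅) : c₁.val.t.Equiv c₂.val.t := by
  rcases h.2.2.2 with h | ⟨-, h⟩
  · exact h
  · exact absurd (h ρ hs) hne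

end Subtyping

/-! ## Jumps -/

theorem Rel.setCtx {cfg : MemConfig} {T : StateType} {θ : TVar → Bool} {ρ' ρ : Valuation}
    {R' R : RegFile} {M' M : Memory} (h : Rel cfg T θ ρ' ρ R' M' R M) {Δ : Ctx} (hΔ : Sat ρ Δ) :
    Rel cfg { T with ctx := Δ } θ ρ' ρ R' M' R M :=
  ⟨hΔ, h.vars, h.regs, h.regTaint, h.mem⟩

/-- The substitution fixes input variables, so slots keep their addresses, strategies and pointer
shifts. Only the types of data are reinterpreted, along the subtype relation. -/
theorem Rel.jump {cfg : MemConfig} {T B : StateType} {θ : TVar → Bool} {ρ' ρ ρ₁' ρ₁ : Valuation}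
    {R' R : RegFile} {M' M : Memory} {σ : Subst} (h : Rel cfg T θ ρ' ρ R' M' R M)
    (hok : SlotsOK T.mem) (hdisj : SlotsDisjoint T.mem ρ) (hlike : MemLike B.mem T.mem)
    (hvalid : ∀ s c, B.mem s = some c → B.ctx.Sub c.valid s.region) (hsub : StateSub T σ .var B)
    (hinput : ∀ x : Var, x.input = true → σ x = .var x)
    (hσ : ∀ x, (σ x).eval ρ = some (ρ₁ x)) (hσ' : ∀ x, (σ x).eval ρ' = some (ρ₁' x)) :
    Rel cfg B θ ρ₁' ρ₁ R' M' R M := by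
  have hin : ∀ x : Var, x.input = true → ρ₁ x = ρ x := fun x hx => by
    have := hσ x
    rw [hinput x hx] at this
    exact (Option.some.inj this).symm
  have hin' : ∀ x : Var, x.input = true → ρ₁' x = ρ' x := fun x hx => by
    have := hσ' x
    rw [hinput x hx] at this
    exact (Option.some.inj this).symm
  have hes : ∀ e : Exp, (e.subst σ).eval ρ = e.eval ρ₁ := fun e => Exp.eval_subst fun x _ => hσ x
  have hes' : ∀ e : Exp, (e.subst σ).eval ρ' = e.eval ρ₁' := fun e =>
    Exp.eval_subst fun x _ => hσ' x
  have htop : ∀ e : Exp, (e.subst σ).HasTop ↔ e.HasTop := fun e =>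
    Exp.hasTop_subst fun x => Exp.not_hasTop_of_eval (hσ x)
  have hctx : Sat ρ₁ B.ctx := (Sat.subst_iff fun _ _ x _ => hσ x).1 (hsub.ctx ρ h.ctx)
  refine ⟨hctx, fun x hx => ?_, fun r b₂ hb₂ => ?_, fun r b₂ hb₂ ht => ?_, fun s c₂ hc₂ => ?_⟩
  · have := hsub.nonChange x hx ρ ρ' h.ctx h.vars
    rw [hσ, hσ'] at this
    exact Option.some.inj this
  · obtain ⟨b₁, hb₁, hbs⟩ := hsub.regs r b₂ hb₂
    have := hbs.simVal h.ctx h.vars (h.regs r b₁ hb₁)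
    refine this.transfer (Or.inl ⟨?_, ?_⟩)
    · exact (hes' _).symm
    · exact (hes _).symm
  · obtain ⟨b₁, hb₁, hbs⟩ := hsub.regs r b₂ hb₂
    have := hbs.2 θ (h.regTaint r b₁ hb₁ ht)
    simpa [Basic.subst, Taint.subst_var] using this
  · obtain ⟨c₀, hc₀⟩ := hlike.exists hc₂
    have hs := hok s (by simp [hc₀])
    have hTP : TransPtr B.mem s ↔ TransPtr T.mem s := hlike.transPtr_iff (hlike.slotsOK hok)
    have hrel : SlotRel cfg B.mem θ ρ₁' ρ₁ s c₂ :=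
      (h.mem s c₀ hc₀).toSlotRel.congr hs hTP (hlike.taint s c₂ c₀ hc₂ hc₀)
        (fun x hx => hin x (hs.input x hx)) fun x hx => hin' x (hs.input x hx)
    have hv := hvalid s c₂ hc₂ ρ₁ hctx
    obtain ⟨s₁, c₁, hc₁, hcov, hcs⟩ := hsub.mem s c₂ hc₂
    have hXv : (c₂.subst σ .var).valid.denote ρ = c₂.valid.denote ρ₁ :=
      Region.denote_subst fun x _ => hσ x
    by_cases hne : c₂.valid.denote ρ₁ = ∅
    · refine ⟨hrel, hv, ?_, Or.inl hne⟩
      rw [hne]; simp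
    · have hte := hcs.taint_equiv h.ctx (by rwa [hXv])
      simp only [Cell.subst, Basic.subst, Taint.subst_var] at hte
      -- Subtyping gives data in some covering slot `s₁`. An initialized address lies in both `s`
      -- and `s₁`, so disjointness of the slots identifies them.
      obtain ⟨x, hx⟩ := Set.nonempty_iff_ne_empty.2 hne
      have hxs := hv hx
      have hx₁ := hcov.1 ρ h.ctx (by rwa [Region.denote_subst fun x _ => hσ x])
      rw [Slot.denote_congr fun x hx => hin x (hs.input x hx)] at hxs
      obtain rfl := hdisj.eq (by simp [hc₀]) (by simp [hc₁]) hxs hx₁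
      have hm := h.mem s c₁ hc₁
      refine ⟨hrel, hv, fun x hx ht => ?_, ?_⟩
      · rw [← hte θ]
        rw [← hXv] at hx
        exact hm.taint x (hcs.2.1 ρ h.ctx hx) ht
      · have hd := hcs.simData h.ctx h.vars hm.data
        rw [hXv] at hd
        have hsh : slotShift cfg B.mem ρ₁' ρ₁ s c₂ = slotShift cfg T.mem ρ' ρ s c₁ := by
          rw [slotShift, slotShift, getOpShift_congr hTP hte.symm,
            ptrDiff_congr (fun x hx => hin x (hs.input x hx)) fun x hx => hin' x (hs.input x hx)]
        rw [hsh]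
        exact hd.transfer subset_rfl (Or.inl ⟨(hes' _).symm, (hes _).symm, Or.inr rfl⟩)

section Sim
variable {cfg : MemConfig} {addr addr' : PC → Word} {P P' : Program} {𝒯 : ProgType}

theorem TypedAt.exists_block {pc : PC} {T E X : StateType} {i : Inst} {I : List Inst}
    (ht : TypedAt P 𝒯 pc T E X i I) {ℓ : Label} {B : StateType} (hB : 𝒯 pc.fn ℓ = some B) :
    (P pc.fn ℓ).isSome ∧ MemLike B.mem T.mem ∧
      ∀ s c, B.mem s = some c → B.ctx.Sub c.valid s.region :=
  ⟨(ht.func.dom ℓ).2 (by simp [hB]), (ht.func.memLike hB).trans ht.mem.symm,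
    ht.func.validSub ℓ B hB⟩

/-- The states after a jump are related. -/
theorem SimAt.jump {R' R : RegFile} {M' M : Memory} {fr' fr : Frame}
    {Φ' Φ : List Frame} {T E X : StateType} {i : Inst} {I : List Inst}
    (hC : Transforms cfg 𝒯 P P')
    (h : SimAt cfg addr addr' P P' 𝒯 R' M' (fr' :: Φ') R M (fr :: Φ))
    (hh : SimHelper cfg P P' 𝒯 T R' M' fr' R M fr) (ht : TypedAt P 𝒯 fr.pc T E X i I)
    {Δ : Ctx} (hΔ : Sat fr.val Δ) {ℓ : Label} {σ : Subst}
    (hj : JumpOK 𝒯 fr.pc.fn { T with ctx := Δ } ℓ σ) :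
    (P fr.pc.fn ℓ).isSome ∧
    SimAt cfg addr addr' P P' 𝒯 R' M'
      ({ fr' with pc := ⟨fr'.pc.fn, ℓ, 0⟩, σb := fr'.inst σ } :: Φ') R M
      ({ fr with pc := ⟨fr.pc.fn, ℓ, 0⟩, σb := fr.inst σ } :: Φ) := by
  obtain ⟨B, hB, hinput, hnt, hdom, hsub⟩ := hj
  obtain ⟨hP, hlike, hvalid⟩ := ht.exists_block hB
  refine ⟨hP, ?_⟩
  have hfn := hh.pc.1
  have hval : ∀ (fr : Frame) (x : Var), (σ x).eval fr.val =
      some (Frame.val { fr with pc := ⟨fr.pc.fn, ℓ, 0⟩, σb := fr.inst σ } x) := by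
    intro fr x
    by_cases hx : x.input = true
    · rw [hinput x hx]
      simp [Exp.eval, Frame.val, hx]
    · rw [Frame.eval_inst (hnt x)]
      simp [Frame.val, hx]
  have hrel := (hh.rel.setCtx hΔ).jump ht.slotsOK (ht.slotsDisjoint hh.rel.ctx) hlike hvalid hsub
    hinput (hval fr) (hval fr')
  refine h.relocate hh.type (Rel.simHelper hrel ?_ (stateTypeAt_zero hP hB) hh.taints
    (hlike.slotsOK ht.slotsOK)) rfl rfl rfl rfl hlike (fun _ _ => rfl) fun _ _ => rfl
  simp only [hfn]
  exact hC.simPC_zero hP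

theorem SimAt.simStep_jmp {R' R : RegFile} {M' M : Memory} {fr' fr : Frame}
    {Φ' Φ : List Frame} {T E X : StateType} {I : List Inst} {ℓ : Label} {σ : Subst}
    (hC : Transforms cfg 𝒯 P P')
    (h : SimAt cfg addr addr' P P' 𝒯 R' M' (fr' :: Φ') R M (fr :: Φ))
    (hh : SimHelper cfg P P' 𝒯 T R' M' fr' R M fr) (ht : TypedAt P 𝒯 fr.pc T E X (.jmp ℓ σ) I) :
    SimStep cfg addr addr' P P' 𝒯 ⟨R', M', fr' :: Φ'⟩ ⟨R, M, fr :: Φ⟩ := by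
  obtain rfl := ht.last rfl
  obtain ⟨hP, hs⟩ := h.jump hC hh ht hh.rel.ctx (Δ := T.ctx) ht.typed
  obtain ⟨is, I', -, h2, h3, h4, -⟩ := ht.simPC hh.pc
  cases h2
  have hP' : (P' fr'.pc.fn ℓ).isSome := by rw [hh.pc.1]; exact hC.isSome hP
  exact ⟨fr, Φ, _, _, _, _, rfl, ht.getInst, h3, ⟨fr, Φ, rfl, ht.getInst, if_pos hP⟩,
    Steps.cons ⟨fr', Φ', rfl, getInst_of_seqAt h4, if_pos hP'⟩ (Steps.nil _), hs⟩

/-- The type of the flag is `NonChange`, so the flag is the same in both runs and they branch alike.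
-/
theorem SimAt.simStep_jne {R' R : RegFile} {M' M : Memory} {fr' fr : Frame}
    {Φ' Φ : List Frame} {T E X : StateType} {I : List Inst} {ℓ : Label} {σ : Subst}
    (hC : Transforms cfg 𝒯 P P')
    (h : SimAt cfg addr addr' P P' 𝒯 R' M' (fr' :: Φ') R M (fr :: Φ))
    (hh : SimHelper cfg P P' 𝒯 T R' M' fr' R M fr) (ht : TypedAt P 𝒯 fr.pc T E X (.jne ℓ σ) I) :
    SimStep cfg addr addr' P P' 𝒯 ⟨R', M', fr' :: Φ'⟩ ⟨R, M, fr :: Φ⟩ := by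
  obtain ⟨hI, T₁, hT₁⟩ := ht.step (by simp)
  have hT₁' := hT₁
  have hr := hh.rel
  obtain ⟨z, hz, hT₁⟩ := Option.bind_eq_some_iff.1 hT₁
  obtain ⟨⟨hzt, ⟨e, he, hnc⟩, hj⟩, hT₁⟩ := Option.ite_none_right_eq_some.1 hT₁
  cases hT₁
  have hv := hr.regs _ _ hz
  have t0 : (R .zf).2 = false := hzt.snd_eq_false (hr.regTaint _ _ hz)
  have t0' : (R' .zf).2 = false := hv.1.trans t0
  have hnz : NonChange T.ctx z.e := fun ρ ρ' h1 h2 => by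
    rw [he]
    simp only [Exp.eval, hnc ρ ρ' h1 h2]
  have heq : R' .zf = R .zf := hv.eq_of_nonChange hr.ctx hr.vars hnz
  have hze : z.e.eval fr.val = none ∨ z.e.eval fr.val = some (R .zf).1 := by
    rcases hv.2 with ⟨h, -⟩ | ⟨-, -, h⟩
    · exact Or.inl (Exp.eval_eq_none.2 h)
    · exact Or.inr h
  by_cases hb : (R .zf).1 = 0
  -- The branch is taken on flag 0; the constraint `z.e = 0` then has value 1, or no value if `z.e`
  -- is unknown.
  · have hΔ : Sat fr.val (insert (Exp.bin .eq z.e (.const 0)) T.ctx) := by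
      rintro c (rfl | hc) v hcv
      · rcases hze with hze | hze
        · simp [Exp.eval, hze] at hcv
        · simp only [Exp.eval, hze, hb, Option.bind_some, Option.map_some,
            Option.some.injEq] at hcv
          subst hcv
          simp [BinOp.eval, boolWord]
      · exact hr.ctx c hc v hcv
    obtain ⟨hP, hs⟩ := h.jump hC hh ht hΔ hj
    obtain ⟨is, I', -, h2, h3, h4, -⟩ := ht.simPC hh.pc
    cases h2
    have hP' : (P' fr'.pc.fn ℓ).isSome := by rw [hh.pc.1]; exact hC.isSome hP
    refine ⟨fr, Φ, _, _, ⟨R, M, { fr with pc := ⟨fr.pc.fn, ℓ, 0⟩, σb := fr.inst σ } :: Φ⟩,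
      ⟨R', M', { fr' with pc := ⟨fr'.pc.fn, ℓ, 0⟩, σb := fr'.inst σ } :: Φ'⟩, rfl, ht.getInst, h3,
      ⟨fr, Φ, rfl, ht.getInst, ?_⟩, Steps.cons ⟨fr', Φ', rfl, getInst_of_seqAt h4, ?_⟩ (Steps.nil _), hs⟩
    · rw [exec, if_pos t0, if_neg (by simpa using hb), if_pos hP]
    · rw [exec, if_pos t0', if_neg (by simpa [heq] using hb), if_pos hP']
  · refine h.simStep_of_fallsThrough hh ht hI hT₁' rfl ⟨R', M', R, M, ?_, ?_, hr.setCtx ?_,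
      ChangesSlots.refl _ _ _ _ _ _⟩
    · rw [exec, if_pos t0, if_pos hb]
    · rw [exec, if_pos t0', if_pos (by rwa [heq])]
    · rintro c (rfl | hc) v hcv
      · rcases hze with hze | hze
        · rw [hze] at hcv; cases hcv
        · rw [hze] at hcv
          cases hcv
          exact hb
      · exact hr.ctx c hc v hcv

end Sim

/-! ## The slots of caller and callee -/

theorem findSlot_spec {Δ : Ctx} {ℳ : MemType} {σ : Subst} {s p : Slot}
    (h : findSlot Δ ℳ σ s = some p) : (ℳ p).isSome ∧ Covers Δ σ s p := by
  unfold findSlot at h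
  split_ifs at h with hh
  cases h
  exact Classical.choose_spec hh

/-- Valuations `ρ`, `ρ'` of the caller and `κ`, `κ'` of the callee at a call. -/
structure CallRel (cfg : MemConfig) (T E X : StateType) (b : Basic) (σcall : Subst)
    (τcall : TSubst) (σret : Var → Option Var) (θ : TVar → Bool) (ρ' ρ κ' κ : Valuation) :
    Prop where
  caller : ∀ p c, T.mem p = some c → SlotRel cfg T.mem θ ρ' ρ p c
  ctx : Sat ρ T.ctx
  vars : AgreeNC ρ ρ'
  okT : SlotsOK T.mem
  disj : SlotsDisjoint T.mem ρ
  okE : SlotsOK E.mem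
  callOK : CallOK T b E X σcall τcall σret
  trans : CallTransOK cfg.δ T E σcall τcall
  val : ∀ x : Var, x.input = true → (σcall x).eval ρ = some (κ x)
  val' : ∀ x : Var, x.input = true →
    (shiftSubst cfg.δ (shiftedPtrs T E σcall τcall) σcall x).eval ρ' = some (κ' x)

namespace CallRel
variable {cfg : MemConfig} {T E X : StateType} {b : Basic} {σcall : Subst} {τcall : TSubst}
  {σret : Var → Option Var} {θ : TVar → Bool} {ρ' ρ κ' κ : Valuation} {s p : Slot} {c cp : Cell}

theorem denote (h : CallRel cfg T E X b σcall τcall σret θ ρ' ρ κ' κ) (hs : (E.mem s).isSome) :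
    (s.region.subst σcall).denote ρ = s.region.denote κ :=
  Region.denote_subst fun x hx => h.val x ((h.okE s hs).input x (s.region_vars hx))

theorem exists_slot (h : CallRel cfg T E X b σcall τcall σret θ ρ' ρ κ' κ)
    (hs : E.mem s = some c) :
    ∃ p cp, findSlot T.ctx T.mem σcall s = some p ∧ T.mem p = some cp ∧
      (p.IsSpill → T.ctx.IsEmpty (c.valid.subst σcall)) ∧
      (¬ TransPtr E.mem s → ¬ TransPtr T.mem p) := by
  obtain ⟨p, h1, h2, h3⟩ := h.trans.slots s c hs
  obtain ⟨cp, hcp⟩ := Option.isSome_iff_exists.1 (findSlot_spec h1).1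
  exact ⟨p, cp, h1, hcp, h2, h3⟩

theorem region_subset (h : CallRel cfg T E X b σcall τcall σret θ ρ' ρ κ' κ)
    (hs : (E.mem s).isSome) (hp : findSlot T.ctx T.mem σcall s = some p) :
    s.region.denote κ ⊆ p.region.denote ρ := by
  rw [← h.denote hs]
  exact (findSlot_spec hp).2.1 ρ h.ctx

/-- Membership is witnessed by some slot with the given base, but any slot with that base decides
it: strategies depend on the base, the caller's slots found for them share a base, and TransPtr
slots with a common base have equal taints. -/
theorem mem_shiftedPtrs_iff (hs : E.mem s = some c)
    (hp : findSlot T.ctx T.mem σcall s = some p) :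
    s.base ∈ shiftedPtrs T E σcall τcall ↔
      TransPtr E.mem s ∧ ¬ TransPtr T.mem p ∧ ¬ (c.val.t.subst τcall).IsZero := by
  constructor
  · rintro ⟨s₃, c₃, p₃, h1, h2, h3, h4, h5, h6⟩
    have hb : p₃.base = p.base := by
      have e1 := (findSlot_spec h4).2.2
      rw [h2, (findSlot_spec hp).2.2] at e1
      exact (Option.some.inj e1).symm
    refine ⟨h3.congr_base h2.symm, fun ht => h5 (ht.congr_base hb), ?_⟩
    rwa [((h3.2 s₃ c₃ s c h1 hs rfl h2.symm).subst τcall).isZero_iff] at h6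
  · rintro ⟨h1, h2, h3⟩
    exact ⟨s, c, p, hs, rfl, h1, hp, h2, h3⟩

-- The argument has a `NonChange` offset from the base pointer of the caller's slot and so moves
-- with it; the transformed annotation may add δ on top.
open Classical in
theorem ptrDiff_eq (h : CallRel cfg T E X b σcall τcall σret θ ρ' ρ κ' κ)
    (hs : (E.mem s).isSome) (hp : findSlot T.ctx T.mem σcall s = some p) :
    ptrDiff κ' κ s = ptrDiff ρ' ρ p +
      if s.base ∈ shiftedPtrs T E σcall τcall then cfg.δ else 0 := by
  have hok := h.okE s hs
  have hin := hok.input _ s.base_mem_vars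
  obtain ⟨y, hy, hnc⟩ := h.callOK.ptr s.base hin hok.ptr
  rw [(findSlot_spec hp).2.2] at hy
  cases hy
  obtain ⟨u', hu'⟩ := Exp.exists_eval (h.callOK.noTop s.base) ρ'
  have hu := h.val _ hin
  have hk := h.val' _ hin
  have hnc := hnc ρ ρ' h.ctx h.vars
  simp only [Exp.eval, hu, hu', Option.bind_some, Option.map_some, BinOp.eval,
    Option.some.injEq] at hnc
  unfold shiftSubst at hk
  unfold ptrDiff
  split_ifs at hk ⊢ with hz
  · simp only [Exp.eval, hu', Option.bind_some, Option.map_some, BinOp.eval,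
      Option.some.injEq] at hk
    rw [← hk, sub_eq_iff_eq_add.1 hnc]
    abel
  · rw [hu', Option.some.injEq] at hk
    rw [← hk, sub_eq_iff_eq_add.1 hnc]
    abel

/-- The subtype relation of the slots of callee and caller. -/
theorem cellSub (h : CallRel cfg T E X b σcall τcall σret θ ρ' ρ κ' κ) (hs : E.mem s = some c)
    (hp : findSlot T.ctx T.mem σcall s = some p) (hcp : T.mem p = some cp)
    (hne : (s.region.denote κ).Nonempty) :
    CellSub T.ctx p cp s (c.subst σcall τcall) := by
  obtain ⟨s₁, c₁, h1, h2, h3⟩ := h.callOK.sub.mem s c hs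
  change T.mem s₁ = some c₁ at h1
  obtain ⟨x, hx⟩ := hne
  have hxp := h.region_subset (by simp [hs]) hp hx
  have hx1 := h2.1 ρ h.ctx (by rwa [h.denote (by simp [hs])])
  -- The slot supplied by subtyping and the one chosen by `findSlot` share an address, hence
  -- coincide.
  obtain rfl := h.disj.eq (by simp [h1]) (by simp [hcp]) hx1 hxp
  rw [h1] at hcp
  cases hcp
  exact h3

/-- Placement is inherited from the containing caller slot. The pointer shift is admissible in each
combination: inherited if both slots are TransPtr, the newly added 0 or δ if only the callee's is,
and 0 if the callee's slot, and therefore the caller's, is TransOp. -/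
theorem slotRel (h : CallRel cfg T E X b σcall τcall σret θ ρ' ρ κ' κ) (hs : E.mem s = some c)
    {θ₁ : TVar → Bool} (hθ : ∀ x, θ₁ x = (τcall x).eval θ) :
    SlotRel cfg E.mem θ₁ κ' κ s c := by
  obtain rfl : θ₁ = fun x => (τcall x).eval θ := funext hθ
  have hs' : (E.mem s).isSome := by simp [hs]
  obtain ⟨p, cp, hp, hcp, -, hTP⟩ := h.exists_slot hs
  have hP := h.caller p cp hcp
  have hsub := h.region_subset hs' hp
  have hspill : s.IsSpill → s.region.denote κ ⊆ cfg.stackPub := by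
    intro hsp
    -- The slot given by subtyping is used here rather than `p`, because it is known to be a spill
    -- slot when `s` is.
    obtain ⟨s₁, c₁, h1, h2, h3⟩ := h.callOK.sub.mem s c hs
    have := h2.1 ρ h.ctx
    rw [h.denote hs'] at this
    exact this.trans ((h.caller s₁ c₁ h1).spill (h3.1 hsp))
  have htaint : (s.region.denote κ).Nonempty → ¬ p.IsSpill →
      cp.val.t.eval θ = c.val.t.eval fun x => (τcall x).eval θ := by
    intro hne hns
    rcases (h.cellSub hs hp hcp hne).2.2.2 with h1 | ⟨h1, -⟩
    · rw [h1 θ]; exact Taint.eval_subst _ _ _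
    · exact absurd h1 hns
  refine ⟨hP.place.mono hsub, hspill, fun hne hpub => ?_, fun ht => ?_, ?_⟩
  · obtain ⟨x, hx⟩ := hne
    have hxs := MemConfig.notMem_stack_of_otherPub (hpub hx)
    have hns : ¬ p.IsSpill := fun hsp => hxs (Or.inl (hP.spill hsp (hsub hx)))
    rw [← htaint ⟨x, hx⟩ hns]
    refine hP.pub ⟨x, hsub hx⟩ ?_
    rcases hP.place with h1 | h1 | h1
    · exact absurd (Or.inl (h1 (hsub hx))) hxs
    · exact h1
    · exact absurd (h1 (hsub hx)) (Set.disjoint_left.1 cfg.other_disj (hpub hx))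
  · exact ⟨hsub.trans (hP.op (hTP ht)).1, h.trans.strategy s c hs ht⟩
  · rw [h.ptrDiff_eq hs' hp, mem_shiftedPtrs_iff hs hp]
    by_cases ht : TransPtr E.mem s
    · by_cases htp : TransPtr T.mem p
      · rw [if_neg fun hh => hh.2.1 htp, add_zero]
        have hptr := hP.ptr
        unfold getPtrShift at hptr ⊢
        by_cases hst : p.region.denote ρ ⊆ cfg.stackPub ∪ cfg.stackSec
        · simp only [htp, hst, not_true, or_false, if_false] at hptr
          simp only [ht, hsub.trans hst, not_true, or_false, if_false]
          split_ifs with hc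
          · obtain ⟨hc1, hc2⟩ := hc
            have hns : ¬ p.IsSpill := fun hsp =>
              not_transPtr_of_isLocalStack (h.okT p (by simp [hcp])) (Or.inl hsp) htp
            rw [if_pos ⟨(htaint hc2 hns).trans hc1, hc2.mono hsub⟩] at hptr
            exact hptr
          · split_ifs at hptr
            · exact Or.inr hptr
            · exact hptr
        · rw [if_pos (Or.inr hst)] at hptr
          rw [Set.mem_singleton_iff] at hptr
          rw [hptr]
          -- The caller's slot is outside the stacks and unshifted. The part owned by the callee can
          -- lie in the stacks only if it is empty, and then the shift 0 is admissible.
          by_cases hss : s.region.denote κ ⊆ cfg.stackPub ∪ cfg.stackSec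
          · have he : ¬ (s.region.denote κ).Nonempty := by
              rintro ⟨x, hx⟩
              rcases hP.place with h1 | h1 | h1
              · exact hst fun y hy => Or.inl (h1 hy)
              · exact MemConfig.notMem_stack_of_otherPub (h1 (hsub hx)) (hss hx)
              · exact MemConfig.notMem_stack_of_otherSec (h1 (hsub hx)) (hss hx)
            simp [ht, hss, he]
          · simp [hss]
      · have hss : s.region.denote κ ⊆ cfg.stackPub ∪ cfg.stackSec := fun x hx =>
          Or.inl ((hP.op htp).1 (hsub hx))
        rw [hP.ptrDiff_eq_zero htp, zero_add]
        simp only [getPtrShift, ht, htp, hss, not_true, or_false, if_false, not_false_iff,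
          true_and]
        -- If the instantiated taint is zero, no shift is added and the slot is untainted; otherwise
        -- δ is added, which is admissible whether or not the taint evaluates to true.
        by_cases hz : (c.val.t.subst τcall).IsZero
        · have : c.val.t.eval (fun x => (τcall x).eval θ) = false := by
            rw [← Taint.eval_subst]; exact hz θ
          simp [hz, this]
        · have hshift : TransPtr E.mem s ∧ ¬ TransPtr T.mem p ∧ ¬ (c.val.t.subst τcall).IsZero :=
            ⟨ht, htp, hz⟩
          rw [if_pos hshift]
          split_ifs <;> simp
    · rw [if_neg fun hh => ht hh.1, hP.ptrDiff_eq_zero (hTP ht)]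
      simp [getPtrShift, ht]

/-- Data in a slot of the callee is moved as in the slot of the caller. -/
theorem slotShift_eq (h : CallRel cfg T E X b σcall τcall σret θ ρ' ρ κ' κ) (hs : E.mem s = some c)
    (hp : findSlot T.ctx T.mem σcall s = some p) (hcp : T.mem p = some cp)
    (hl : ¬ s.IsLocalStack) (ht : cp.val.t.Equiv (c.val.t.subst τcall)) :
    slotShift cfg E.mem κ' κ s c = slotShift cfg T.mem ρ' ρ p cp := by
  have hs' : (E.mem s).isSome := by simp [hs]
  have hP := h.caller p cp hcp
  have hTP : ¬ TransPtr E.mem s → ¬ TransPtr T.mem p := by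
    obtain ⟨q, h1, -, h2⟩ := h.trans.slots s c hs
    rw [hp] at h1
    cases h1
    exact h2
  rw [slotShift, slotShift, h.ptrDiff_eq hs' hp, mem_shiftedPtrs_iff hs hp, getOpShift, getOpShift,
    ht.isZero_iff]
  by_cases hE : TransPtr E.mem s
  · by_cases hT : TransPtr T.mem p
    · simp [hE, hT]
    -- The pointer shift of the callee takes the place of the operand shift of the caller; both are
    -- δ exactly if the taint is not zero.
    · by_cases hz : (c.val.t.subst τcall).IsZero <;> simp [hE, hT, hz]
  · have hT := hTP hE
    rw [hP.ptrDiff_eq_zero hT]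
    -- An external TransOp slot has constant taint, so instantiating it does not affect whether it
    -- is zero, and both functions shift their operands alike.
    rcases h.trans.strategy s c hs hE with h1 | h1 | h1
    · exact absurd h1 hl
    · have : (c.val.t.subst τcall).IsZero := fun θ => by rw [Taint.eval_subst, h1]; rfl
      simp [hE, hT, h1, this]
    · have h2 : ¬ (c.val.t.subst τcall).IsZero := fun hz => by
        have := hz fun _ => false
        rw [Taint.eval_subst, h1] at this
        cases this
      have h3 : ¬ c.val.t.IsZero := fun hz => by
        have := hz fun _ => false
        rw [h1] at this
        cases this
      simp [hE, hT, h2, h3]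

end CallRel

/-! ## Function entry -/

theorem GPR.mem_all (r : GPR) : r ∈ GPR.all := by cases r <;> decide

theorem GPR.nodup_all : GPR.all.Nodup := by decide

/-- Executing the instructions that shift registers. -/
theorem steps_shift (cfg : MemConfig) (addr : PC → Word) (P : Program) (d : Word) (M : Memory)
    (fr : Frame) (Φ : List Frame) (L : List GPR) (hL : L.Nodup) (R : RegFile) (I : List Inst)
    (hseq : seqAt P fr.pc = some (L.map (fun r => Inst.addq (.imm d) (.reg r)) ++ I)) :
    ∃ R₁, Steps cfg addr P ⟨R, M, fr :: Φ⟩ (L.map fun r => Inst.addq (.imm d) (.reg r))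
        ⟨R₁, M, { fr with pc := { fr.pc with idx := fr.pc.idx + L.length } } :: Φ⟩ ∧
      (∀ r ∈ L, R₁ (.gp r) = ((R (.gp r)).1 + d, (R (.gp r)).2)) ∧
      (∀ r, r ∉ L → R₁ (.gp r) = R (.gp r)) ∧ (L = [] → R₁ = R) := by
  induction L generalizing R fr with
  | nil => exact ⟨R, Steps.nil _, by simp, fun _ _ => rfl, fun _ => rfl⟩
  | cons q L ih =>
    rw [List.nodup_cons] at hL
    -- `addq` overwrites the zero flag too, so the flag is only known to survive when the list is
    -- empty.
    set R₀ : RegFile := (R.set (.gp q) ((R (.gp q)).1 + d, (R (.gp q)).2 || false)).set .zf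
      (flagVal ((R (.gp q)).1 + d, (R (.gp q)).2 || false)) with hR₀
    obtain ⟨R₁, h1, h2, h3, -⟩ := ih { fr with pc := fr.pc.next } hL.2 R₀ (seqAt_next hseq)
    have hq : R₀ (.gp q) = ((R (.gp q)).1 + d, (R (.gp q)).2) := by
      simp [hR₀, RegFile.set]
    have hr : ∀ r, r ≠ q → R₀ (.gp r) = R (.gp r) := fun r hr => by
      simp [hR₀, RegFile.set, hr]
    refine ⟨R₁, Steps.cons ⟨fr, Φ, rfl, getInst_of_seqAt hseq, rfl⟩ ?_, ?_, ?_, by simp⟩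
    · convert h1 using 5
      simp [PC.next]
      omega
    · intro r hrm
      rcases List.mem_cons.1 hrm with rfl | hrm
      · rw [h3 r hL.1, hq]
      · rw [h2 r hrm, hr r fun h => hL.1 (h ▸ hrm)]
    · intro r hrm
      rw [List.mem_cons, not_or] at hrm
      rw [h3 r hrm.2, hr r hrm.1]

theorem Steps.append {cfg : MemConfig} {addr : PC → Word} {P : Program} {S S₁ S₂ : State}
    {I J : List Inst} (h : Steps cfg addr P S I S₁) (h' : Steps cfg addr P S₁ J S₂) :
    Steps cfg addr P S (I ++ J) S₂ := by
  induction h with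
  | nil S => exact h'
  | cons h _ ih => exact Steps.cons h (ih h')

/-! ### The data of the callee at entry -/

section Enter
variable {cfg : MemConfig} {P P' : Program} {𝒯 : ProgType} {g : FName} {T E X : StateType}
  {b : Basic} {σcall : Subst} {τcall : TSubst} {σret : Var → Option Var} {θ θ₁ : TVar → Bool}
  {ρ' ρ κ' κ : Valuation} {R' R R₂' : RegFile} {M' M : Memory}

theorem CallRel.sat_entry (h : CallRel cfg T E X b σcall τcall σret θ ρ' ρ κ' κ)
    (hF : FuncTyped P 𝒯 g E X) : Sat κ E.ctx :=
  (Sat.subst_iff fun c hc x hx => h.val x (hF.entryInput x (Or.inl ⟨c, hc, hx⟩))).1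
    (h.callOK.sub.ctx ρ h.ctx)

/-- Shifted pointers are unmarked, so on marked variables the transformed annotation is the original
one, whose instances are `NonChange`. -/
theorem CallRel.agreeNC (h : CallRel cfg T E X b σcall τcall σret θ ρ' ρ κ' κ)
    (hb : ∀ x : Var, x.input = false → κ' x = κ x) : AgreeNC κ κ' := by
  intro x hx
  by_cases hin : x.input = true
  · have hk := h.val' x hin
    rw [shiftSubst, if_neg fun hz => by simp [h.trans.nonChange x hz] at hx] at hk
    have := h.callOK.sub.nonChange x hx ρ ρ' h.ctx h.vars
    rw [h.val x hin, hk] at this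
    exact Option.some.inj this
  · exact hb x (by simpa using hin)

theorem holdsPtr_exists {δ : Word} {r : Reg} (h : CallTransOK δ T E σcall τcall)
    (hr : HoldsPtr E (shiftedPtrs T E σcall τcall) r) :
    ∃ q, r = .gp q ∧ Reg.calleeSaved r = false := by
  obtain ⟨x, hx, t, ht⟩ := hr
  obtain ⟨q, t', h1, h2, h3, h4⟩ := h.reg x hx
  exact ⟨q, h4 r t ht, h4 r t ht ▸ h3⟩

/-- Registers and memory at function entry. -/
theorem Rel.enter (h : Rel cfg T θ ρ' ρ R' M' R M)
    (hc : CallRel cfg T E X b σcall τcall σret θ ρ' ρ κ' κ) (hF : FuncTyped P 𝒯 g E X)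
    (hκb : ∀ x : Var, x.input = false → κ' x = κ x)
    (hθ : ∀ x, θ₁ x = (τcall x).eval θ) {A : Word} (hA : b.e.eval ρ = some A)
    (hA' : b.e.eval ρ' = some A)
    (hR₂ : ∀ q, HoldsPtr E (shiftedPtrs T E σcall τcall) (.gp q) →
      R₂' (.gp q) = ((R' (.gp q)).1 + cfg.δ, (R' (.gp q)).2))
    (hR₂' : ∀ q, ¬ HoldsPtr E (shiftedPtrs T E σcall τcall) (.gp q) →
      R₂' (.gp q) = R' (.gp q))
    (hzf : (∀ q, ¬ HoldsPtr E (shiftedPtrs T E σcall τcall) (.gp q)) → R₂' = R') (w' w : Word) :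
    Rel cfg E θ₁ κ' κ (R₂'.set .rsp (A - 8, false)) (M'.write (A - 8) (w', false))
      (R.set .rsp (A - 8, false)) (M.write (A - 8) (w, false)) := by
  obtain rfl : θ₁ = fun x => (τcall x).eval θ := funext hθ
  set Z := shiftedPtrs T E σcall τcall with hZ
  have hsat := hc.sat_entry hF
  have hcall := hc.callOK
  have hpush : Rel cfg (pushedType T b) θ ρ' ρ (R'.set .rsp (A - 8, false)) M'
      (R.set .rsp (A - 8, false)) M :=
    h.setReg (b := ⟨b.e.sub (.const 8), b.t⟩)
      (SimVal.of_eval rfl (by simp [Exp.eval, hA', BinOp.eval]) (by simp [Exp.eval, hA, BinOp.eval]))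
      (by simp)
  have hregvars : ∀ r b₂, E.regs r = some b₂ → ∀ x ∈ b₂.e.vars, x.input = true :=
    fun r b₂ hb₂ x hx => hF.entryInput x (Or.inr (Or.inl ⟨r, b₂, hb₂, hx⟩))
  have hmemvars : ∀ s c, E.mem s = some c → (∀ x ∈ c.valid.vars, x.input = true) ∧
      ∀ x ∈ c.val.e.vars, x.input = true :=
    fun s c hc => ⟨fun x hx => hF.entryInput x (Or.inr (Or.inr ⟨s, c, hc, Or.inr (Or.inl hx)⟩)),
      fun x hx => hF.entryInput x (Or.inr (Or.inr ⟨s, c, hc, Or.inr (Or.inr hx)⟩))⟩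
  refine ⟨hsat, hc.agreeNC hκb, fun r b₂ hb₂ => ?_, fun r b₂ hb₂ ht => ?_, fun s c hs => ?_⟩
  · obtain ⟨b₁, hb₁, hbs⟩ := hcall.sub.regs r b₂ hb₂
    have hv : SimVal (b₂.e.subst σcall) ρ' ρ _ _ :=
      hbs.simVal h.ctx h.vars (hpush.regs r b₁ hb₁)
    have he : b₂.e.eval κ = (b₂.e.subst σcall).eval ρ :=
      (Exp.eval_subst fun x hx => hc.val x (hregvars r b₂ hb₂ x hx)).symm
    have he' : b₂.e.eval κ' = (b₂.e.subst (shiftSubst cfg.δ Z σcall)).eval ρ' :=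
      (Exp.eval_subst fun x hx => hc.val' x (hregvars r b₂ hb₂ x hx)).symm
    by_cases hr : HoldsPtr E Z r
    -- Such a register has received an extra δ, exactly as the annotation of its pointer has. It is
    -- not callee-saved, so it is not `rsp`.
    · obtain ⟨q, rfl, hcs⟩ := holdsPtr_exists hc.trans hr
      have hne : Reg.gp q ≠ .rsp := fun h => by rw [h] at hcs; cases hcs
      have hR := hR₂ q hr
      obtain ⟨x, hx, t, hxt⟩ := hr
      rw [hxt] at hb₂
      cases hb₂
      simp only [RegFile.set, Function.update_of_ne hne] at hv ⊢
      obtain ⟨v1, v2⟩ := hv.eval (hcall.noTop x)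
      refine SimVal.of_eval (by rw [hR]; exact hv.1) ?_ (he.trans v2)
      rw [he', hR]
      change (σcall x).eval ρ' = _ at v1
      simp [Exp.subst, shiftSubst, hx, Exp.eval, v1, BinOp.eval]
    · have hreg : R₂'.set .rsp (A - 8, false) r = R'.set .rsp (A - 8, false) r := by
        by_cases hrsp : r = .rsp
        · subst hrsp
          simp [RegFile.set]
        · simp only [RegFile.set, Function.update_of_ne hrsp]
          cases r with
          | gp q => exact hR₂' q hr
          | zf =>
            -- If the entry type mentions the flag, no pointer is shifted; then no `addq` was
            -- executed and the registers are untouched.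
            rw [hzf]
            rintro q ⟨x, hx, -⟩
            rw [hc.trans.flag ⟨x, hx⟩] at hb₂
            cases hb₂
      rw [hreg]
      exact hv.transfer (Or.inl ⟨he'.trans (hc.trans.otherRegs r b₂ hb₂ hr ρ'), he⟩)
  · obtain ⟨b₁, hb₁, hbs⟩ := hcall.sub.regs r b₂ hb₂
    have := hbs.2 θ (hpush.regTaint r b₁ hb₁ ht)
    rwa [Basic.subst, Taint.eval_subst] at this
  · have hrel := hc.slotRel hs hθ
    have hv := hF.validSub .entry E hF.entry s c hs κ hsat
    by_cases hne : c.valid.denote κ = ∅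
    · exact ⟨hrel, hv, by rw [hne]; simp, Or.inl hne⟩
    · have hXv : (c.valid.subst σcall).denote ρ = c.valid.denote κ :=
        Region.denote_subst fun x hx => hc.val x ((hmemvars s c hs).1 x hx)
      obtain ⟨p, cp, hp, hcp, hsp, -⟩ := hc.exists_slot hs
      -- Only initialized data matters. It excludes spill slots of the caller and local slots of the
      -- callee, both of which are uninitialized here; what remains is covered by
      -- `CallRel.slotShift_eq`.
      have hsp : ¬ p.IsSpill := fun h' => hne (by rw [← hXv]; exact hsp h' ρ h.ctx)
      have hloc : ¬ s.IsLocalStack := fun h' =>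
        hne (hF.localInvalid E (Or.inl rfl) s c hs h' κ hsat)
      obtain ⟨x₀, hx₀⟩ := Set.nonempty_iff_ne_empty.2 hne
      have hcs := hc.cellSub hs hp hcp ⟨x₀, hv hx₀⟩
      have hte := hcs.taint_equiv h.ctx (by simpa [Cell.subst, hXv] using hne)
      have hm := h.mem p cp hcp
      have hsub : c.valid.denote κ ⊆ cp.valid.denote ρ := by
        have := hcs.2.1 ρ h.ctx
        rwa [Cell.subst, hXv] at this
      obtain ⟨sr, cr, r1, r2, r3, r4, r5⟩ := hcall.eval_retSlot h.ctx hA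
      -- The slot of the return address is uninitialized, while `p` holds the data at `x₀`. Hence
      -- writing the return address spares this data, also after relocation.
      have hpr : p ≠ sr := by
        rintro rfl
        rw [hcp] at r1
        cases r1
        rw [r4] at hsub
        exact hsub hx₀
      have hdis := hc.disj p sr (by simp [hcp]) (by simp [r1]) hpr
      have hsr := hc.caller sr cr r1
      have hM : ∀ x ∈ c.valid.denote κ, M.write (A - 8) (w, false) x = M x := fun x hx => by
        refine Memory.write_of_notMem fun hxr => ?_
        rw [← r3] at hxr
        exact Set.eq_empty_iff_forall_notMem.1 hdis x ⟨hm.validSub (hsub hx), hxr⟩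
      have hM' : ∀ x ∈ c.valid.denote κ, M'.write (A - 8) (w', false)
          (x + slotShift cfg T.mem ρ' ρ p cp) = M' (x + slotShift cfg T.mem ρ' ρ p cp) :=
        fun x hx => by
        refine Memory.write_of_notMem fun hxr => ?_
        rw [← r3] at hxr
        refine MemConfig.ShiftOK.ne hm.place hsr.place hm.shiftOK (Or.inl rfl) hdis
          (hm.validSub (hsub hx)) hxr ?_
        rw [add_zero]
      refine ⟨hrel, hv, fun x hx ht => ?_, ?_⟩
      · rw [hM x hx] at ht
        have := hm.taint x (hsub hx) ht
        rw [hte θ] at this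
        simpa [Cell.subst, Basic.subst, Taint.eval_subst] using this
      · have hd := hcs.simData h.ctx h.vars hm.data
        rw [Cell.subst, hXv] at hd
        rw [hc.slotShift_eq hs hp hcp hloc hte]
        refine (hd.congr hM hM').transfer subset_rfl (Or.inl ⟨?_, ?_, Or.inr rfl⟩)
        · refine (Exp.eval_subst fun x hx => hc.val' x ((hmemvars s c hs).2 x hx)).symm.trans ?_
          exact hc.trans.mem s c hs ρ'
        · exact (Exp.eval_subst fun x hx => hc.val x ((hmemvars s c hs).2 x hx)).symm

end Enter

/-! ### The call instruction -/

section Sim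
variable {cfg : MemConfig} {addr addr' : PC → Word} {P P' : Program} {𝒯 : ProgType}

theorem transInst_callq {δ : Word} {T : StateType} {g : FName} {σcall : Subst} {τcall : TSubst}
    {σret : Var → Option Var} {E : StateType} {is : List Inst} (hE : 𝒯 g .entry = some E)
    (h : transInst δ 𝒯 T (.callq g σcall τcall σret) = some is) :
    CallTransOK δ T E σcall τcall ∧
      is = shiftInsts δ E (shiftedPtrs T E σcall τcall) ++
        [.callq g (shiftSubst δ (shiftedPtrs T E σcall τcall) σcall) τcall σret] := by
  obtain ⟨E', hE', h⟩ := Option.bind_eq_some_iff.1 h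
  rw [hE] at hE'
  cases hE'
  obtain ⟨h1, h⟩ := Option.ite_none_right_eq_some.1 h
  cases h
  exact ⟨h1, rfl⟩

theorem not_hasTop_shiftSubst {δ : Word} {Z : Set Var} {σ : Subst} {x : Var}
    (h : ¬ (σ x).HasTop) : ¬ (shiftSubst δ Z σ x).HasTop := by
  unfold shiftSubst
  split_ifs
  · simpa [Exp.HasTop] using h
  · exact h

theorem SimHelper.callRel {R' R : RegFile} {M' M : Memory} {fr' fr : Frame} {T E₀ X₀ E X : StateType}
    {i : Inst} {I : List Inst} {g : FName} {b : Basic} {σcall : Subst} {τcall : TSubst}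
    {σret : Var → Option Var} {κ' κ : Valuation}
    (hh : SimHelper cfg P P' 𝒯 T R' M' fr' R M fr) (ht : TypedAt P 𝒯 fr.pc T E₀ X₀ i I)
    (hF : FuncTyped P 𝒯 g E X) (hok : CallOK T b E X σcall τcall σret)
    (htr : CallTransOK cfg.δ T E σcall τcall)
    (hκ : ∀ x : Var, x.input = true → κ x = fr.inst σcall x)
    (hκ' : ∀ x : Var, x.input = true →
      κ' x = fr'.inst (shiftSubst cfg.δ (shiftedPtrs T E σcall τcall) σcall) x) :
    CallRel cfg T E X b σcall τcall σret fr.θ fr'.val fr.val κ' κ where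
  caller p c hc := (hh.rel.mem p c hc).toSlotRel
  ctx := hh.rel.ctx
  vars := hh.rel.vars
  okT := ht.slotsOK
  disj := ht.slotsDisjoint hh.rel.ctx
  okE := hF.slots
  callOK := hok
  trans := htr
  val x hx := by rw [hκ x hx]; exact Frame.eval_inst (hok.noTop x)
  val' x hx := by rw [hκ' x hx]; exact Frame.eval_inst (not_hasTop_shiftSubst (hok.noTop x))

/-- The new frame is related by `Rel.enter`. The caller need not be related anew after the shifting
instructions: the relation records it as it was before them, at the first instruction of the
transformed call. -/
theorem SimAt.simStep_callq {R' R : RegFile} {M' M : Memory} {fr' fr : Frame}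
    {Φ' Φ : List Frame} {T E₀ X₀ : StateType} {I : List Inst} {g : FName} {σcall : Subst}
    {τcall : TSubst} {σret : Var → Option Var} (hC : Transforms cfg 𝒯 P P')
    (h : SimAt cfg addr addr' P P' 𝒯 R' M' (fr' :: Φ') R M (fr :: Φ))
    (hh : SimHelper cfg P P' 𝒯 T R' M' fr' R M fr)
    (ht : TypedAt P 𝒯 fr.pc T E₀ X₀ (.callq g σcall τcall σret) I) :
    SimStep cfg addr addr' P P' 𝒯 ⟨R', M', fr' :: Φ'⟩ ⟨R, M, fr :: Φ⟩ := by
  obtain ⟨hI, T₁, hT₁⟩ := ht.step (by simp)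
  obtain ⟨b, E, X, hb, hE, hX, hg, hok, -⟩ := exists_callOK hT₁
  have hF := h.progTyped.funcTyped hE hX
  have hPg : (P g .entry).isSome := (hF.dom .entry).2 (by simp [hE])
  have hr := hh.rel
  obtain ⟨is, I', -, htr, htrAt, hseq, -⟩ := ht.simPC hh.pc
  obtain ⟨htrOK, rfl⟩ := transInst_callq hE htr
  set Z := shiftedPtrs T E σcall τcall with hZ
  set σ' := shiftSubst cfg.δ Z σcall with hσ'
  classical
  obtain ⟨L, hL, hLn⟩ : ∃ L : List GPR, shiftInsts cfg.δ E Z =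
      L.map (fun r => Inst.addq (.imm cfg.δ) (.reg r)) ∧ L.Nodup ∧
      ∀ q, q ∈ L ↔ HoldsPtr E Z (.gp q) :=
    ⟨_, rfl, GPR.nodup_all.filter _, fun q => by simp [GPR.mem_all]⟩
  obtain ⟨hnd, hLm⟩ := hLn
  rw [hL] at hseq htrAt
  rw [List.append_assoc] at hseq
  obtain ⟨R₂', s1, s2, s3, s4⟩ := steps_shift cfg addr' P' cfg.δ M' fr' Φ' L hnd R' _ hseq
  set pr : Frame := { fr' with pc := { fr'.pc with idx := fr'.pc.idx + L.length } } with hpr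
  have hi' : getInst P' pr.pc = some (.callq g σ' τcall σret) := by
    have := seqAt_add hseq
    rw [List.length_map] at this
    exact getInst_of_seqAt this
  obtain ⟨A, hA, hA'⟩ := hok.eval_rsp hr.ctx hr.vars
  have hv := hr.regs _ _ hb
  have hnb := Exp.not_hasTop_of_eval hA
  obtain ⟨v1, v2⟩ := hv.eval hnb
  have e0 : (R .rsp).1 = A := by rw [hA] at v2; exact (Option.some.inj v2).symm
  have e0' : (R' .rsp).1 = A := by rw [hA'] at v1; exact (Option.some.inj v1).symm
  have t0 : (R .rsp).2 = false := hok.rspTaint.snd_eq_false (hr.regTaint _ _ hb)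
  -- `rsp` is callee-saved and registers of shifted pointers are not.
  have hR₂rsp : R₂' .rsp = R' .rsp := by
    refine s3 _ fun hm => ?_
    obtain ⟨-, -, hcs⟩ := holdsPtr_exists htrOK ((hLm _).1 hm)
    cases hcs
  have t0' : (R₂' .rsp).2 = false := by rw [hR₂rsp]; exact hv.1.trans t0
  set fc : Frame := ⟨⟨g, .entry, 0⟩, fr.inst σcall, fun x => (τcall x).eval fr.θ, fun _ => 0⟩
    with hfc
  set fc' : Frame := ⟨⟨g, .entry, 0⟩, fr'.inst σ', fun x => (τcall x).eval fr'.θ, fun _ => 0⟩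
    with hfc'
  have hcr : CallRel cfg T E X b σcall τcall σret fr.θ fr'.val fr.val fc'.val fc.val :=
    hh.callRel ht hF hok htrOK (fun x hx => by simp [Frame.val, hx, hfc]) fun x hx => by
      simp [Frame.val, hx, hfc', hσ', hZ]
  have hrel := hr.enter (θ₁ := fc.θ) (R₂' := R₂') hcr hF
    (fun x hx => by simp [Frame.val, hx, hfc, hfc']) (fun x => rfl) hA hA'
    (fun q hq => s2 q ((hLm q).2 hq)) (fun q hq => s3 q fun hm => hq ((hLm q).1 hm))
    (fun hn => s4 (List.eq_nil_iff_forall_not_mem.2 fun q hq => hn q ((hLm q).1 hq)))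
    (addr' pr.pc.next) (addr fr.pc.next)
  have hT : stateTypeAt P 𝒯 fc.pc = some E := stateTypeAt_zero hPg hE
  have hhc : SimHelper cfg P P' 𝒯 E (R₂'.set .rsp (A - 8, false))
      (M'.write (A - 8) (addr' pr.pc.next, false)) fc' (R.set .rsp (A - 8, false))
      (M.write (A - 8) (addr fr.pc.next, false)) fc :=
    hrel.simHelper (hC.simPC_zero hPg) hT (by simp [hfc, hfc', hh.taints]) hF.slots
  have hsp : fc.σf .sp = A - 8 := Frame.inst_eq (hok.eval_sp hF hr.ctx (AgreeNC.refl _) hA)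
  have hret : fc.retRegion = interval (A - 8) (A - 8 + 8) := by rw [Frame.retRegion, hsp]
  have hM : ∀ x, x ∉ getDom E.mem fc.val ∪ fc.retRegion →
      M.write (A - 8) (addr fr.pc.next, false) x = M x := fun x hx =>
    Memory.write_of_notMem fun hm => hx (Or.inr (hret ▸ hm))
  have hM' : ∀ x, x ∉ getShiftedDom cfg.δ E.mem fc'.val fc.val ∪ fc.retRegion →
      M'.write (A - 8) (addr' pr.pc.next, false) x = M' x := fun x hx =>
    Memory.write_of_notMem fun hm => hx (Or.inr (hret ▸ hm))
  have hwf : WellFormedAt cfg addr P 𝒯 (R.set .rsp (A - 8, false))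
      (M.write (A - 8) (addr fr.pc.next, false)) (fc :: fr :: Φ) :=
    WellFormedAt.call h.progTyped hg hT hhc.typed (by rw [hsp, Memory.read_write]) hM ht.getInst
      (fun _ _ => rfl) (fun _ => rfl) h.head.1
  have hsim := SimAt.call (addr' := addr') (p' := pr) (pc₀ := fr'.pc) hhc hwf hi'
    (fun _ _ => rfl) (fun _ => rfl) htrAt (by simp [hpr]) h (by rw [hsp, Memory.read_write])
    (by rw [hsp, Memory.read_write]) hM hM'
  refine ⟨fr, Φ, _, _, ⟨R.set .rsp (A - 8, false), M.write (A - 8) (addr fr.pc.next, false),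
    fc :: fr :: Φ⟩, ⟨R₂'.set .rsp (A - 8, false), M'.write (A - 8) (addr' pr.pc.next, false),
    fc' :: pr :: Φ'⟩, rfl, ht.getInst, htrAt, ⟨fr, Φ, rfl, ht.getInst, ?_⟩, s1.append (Steps.cons ⟨pr, Φ', rfl, hi', ?_⟩ (Steps.nil _)), hsim⟩
  · rw [exec, if_pos ⟨t0, hPg⟩, e0]
  · rw [exec, if_pos ⟨t0', hC.isSome hPg⟩]
    dsimp only
    rw [hR₂rsp, e0']
    rfl

end Sim

/-! ## Function return -/

theorem updateMem_cases {Δ Δ₂ : Ctx} {ℳ ℳ₁ : MemType} {σcall σ : Subst} {στ : TSubst} {q : Slot}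
    {c c₀ : Cell} (h : updateMem Δ Δ₂ ℳ σcall σ στ ℳ₁ q = some c) (h₀ : ℳ q = some c₀) :
    (c = c₀ ∧ (q.IsSpill ∨ ∀ s, ¬ Updates Δ ℳ σcall ℳ₁ q s)) ∨
    ∃ s c₁, ¬ q.IsSpill ∧ Updates Δ ℳ σcall ℳ₁ q s ∧ ℳ₁ s = some c₁ ∧
      c.valid = updValid c₀ (s.region.subst σ) (c₁.subst σ στ) ∧ c.val.t = c₀.val.t ∧
      (Δ₂.Same c.valid (c₁.valid.subst σ) ∧ c.val.e = c₁.val.e.subst σ ∨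
        ¬ Δ₂.Same c.valid (c₁.valid.subst σ) ∧ c.val.e = .top) := by
  simp only [updateMem, h₀, Option.map_some, Option.some.injEq] at h
  by_cases hq : ¬ q.IsSpill ∧ ∃ s, Updates Δ ℳ σcall ℳ₁ q s
  · rw [dif_pos hq] at h
    have hs := Classical.choose_spec hq.2
    set s := Classical.choose hq.2
    obtain ⟨c₁, hc₁⟩ := Option.isSome_iff_exists.1 hs.1
    refine Or.inr ⟨s, c₁, hq.1, hs, hc₁, ?_⟩
    rw [hc₁] at h
    simp only at h
    split_ifs at h with hsame
    · subst h
      exact ⟨rfl, rfl, Or.inl ⟨hsame, rfl⟩⟩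
    · subst h
      exact ⟨rfl, rfl, Or.inr ⟨hsame, rfl⟩⟩
  · rw [dif_neg hq] at h
    refine Or.inl ⟨h.symm, ?_⟩
    by_cases hsp : q.IsSpill
    · exact Or.inl hsp
    · exact Or.inr fun s hs => hq ⟨hsp, s, hs⟩

/-- Writes of the transformed callee count as writes inside the caller's slots. A TransPtr slot
inside a TransOp one is moved by 0 or δ, and both translates are reserved for the caller's slot. -/
theorem CallRel.possibleSlot_subset {cfg : MemConfig} {T E X : StateType} {b : Basic}
    {σcall : Subst} {τcall : TSubst} {σret : Var → Option Var} {θ : TVar → Bool}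
    {ρ' ρ κ' κ : Valuation} {s p : Slot}
    (h : CallRel cfg T E X b σcall τcall σret θ ρ' ρ κ' κ) (hs : (E.mem s).isSome)
    (hp : findSlot T.ctx T.mem σcall s = some p) :
    getPossibleSlot cfg.δ E.mem κ' κ s ⊆ getPossibleSlot cfg.δ T.mem ρ' ρ p := by
  obtain ⟨c, hc⟩ := Option.isSome_iff_exists.1 hs
  obtain ⟨q, cp, hq, hcp, -, hTP⟩ := h.exists_slot hc
  obtain rfl : q = p := Option.some.inj (hq.symm.trans hp)
  have hsub := h.region_subset hs hp
  have hpd := h.ptrDiff_eq hs hp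
  unfold getPossibleSlot
  intro x hx
  by_cases ht : TransPtr E.mem s
  · rw [if_pos ht] at hx
    have hx := hsub hx
    by_cases htp : TransPtr T.mem q
    · rw [if_pos htp]
      rw [if_neg fun hh => ((CallRel.mem_shiftedPtrs_iff hc hp).1 hh).2.1 htp, add_zero] at hpd
      rwa [hpd] at hx
    · rw [if_neg htp]
      rw [(h.caller q cp hcp).ptrDiff_eq_zero htp, zero_add] at hpd
      split_ifs at hpd
      · rw [hpd] at hx
        exact Or.inr hx
      · rw [hpd, sub_zero] at hx
        exact Or.inl hx
  · rw [if_neg ht] at hx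
    rw [if_neg (hTP ht)]
    exact hx.imp (fun h => hsub h) fun h => hsub h

theorem CallOK.not_hasTop_retSubst {T E X : StateType} {b : Basic} {σcall : Subst} {τcall : TSubst}
    {σret : Var → Option Var} (h : CallOK T b E X σcall τcall σret) (x : Var) :
    ¬ (retSubst σcall σret x).HasTop := by
  unfold retSubst
  split_ifs
  · exact h.noTop x
  · cases σret x <;> exact fun h => h

/-- Valuations of the caller after a return. -/
structure RetVal (σret : Var → Option Var) (κ ρ ρ₁ : Valuation) : Prop where
  ret : ∀ x y, σret x = some y → ρ₁ y = κ x
  other : ∀ y, (∀ x, σret x ≠ some y) → ρ₁ y = ρ y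

/-! ### The data of the caller after a return -/

section Leave
variable {cfg : MemConfig} {P P' : Program} {𝒯 : ProgType} {g : FName} {T E X : StateType}
  {b : Basic} {σcall : Subst} {τcall : TSubst} {σret : Var → Option Var} {θ θ₁ : TVar → Bool}
  {ρ' ρ κ' κ ρ₁' ρ₁ : Valuation} {R' R Rp' Rp : RegFile} {M' M Mp' Mp : Memory}

/-- The targets of `σret` are fresh for the caller's state type, so its types keep their meaning. -/
theorem CallOK.retVal_eq (h : CallOK T b E X σcall τcall σret) (hr : RetVal σret κ ρ ρ₁)
    {x : Var} (hx : x ∈ T.vars) : ρ₁ x = ρ x :=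
  hr.other x fun y hy => (h.retFresh y x hy).1 hx

theorem CallOK.retVal_input (h : CallOK T b E X σcall τcall σret) (hr : RetVal σret κ ρ ρ₁)
    {x : Var} (hx : x.input = true) : ρ₁ x = ρ x :=
  hr.other x fun y hy => by simp [(h.retBlock y x hy).2.1] at hx

theorem CallOK.eval_call (h : CallOK T b E X σcall τcall σret) (hr : RetVal σret κ ρ ρ₁)
    {x : Var} (hx : x.input = true) :
    (retSubst σcall σret x).eval ρ₁ = (σcall x).eval ρ := by
  rw [retSubst, if_pos hx]
  exact Exp.eval_congr fun y hy => hr.other y fun z hz => (h.retFresh z y hz).2 x hx hy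

theorem CallOK.eval_block (h : CallOK T b E X σcall τcall σret) (hr : RetVal σret κ ρ ρ₁)
    {x : Var} (hX : x ∈ X.vars) (hx : x.input = false) :
    (retSubst σcall σret x).eval ρ₁ = some (κ x) := by
  obtain ⟨y, hy⟩ := Option.isSome_iff_exists.1 (h.retDom x hX hx)
  rw [retSubst, if_neg (by simp [hx]), hy]
  exact congrArg some (hr.ret x y hy)

/-- Registers and memory after a return. -/
theorem Rel.leave (hp : Rel cfg T θ ρ' ρ Rp' Mp' Rp Mp) (hx : Rel cfg X θ₁ κ' κ R' M' R M)
    (hc : CallRel cfg T E X b σcall τcall σret θ ρ' ρ κ' κ) (hF : FuncTyped P 𝒯 g E X)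
    (hr : RetVal σret κ ρ ρ₁) (hr' : RetVal σret κ' ρ' ρ₁') (hθ : ∀ x, θ₁ x = (τcall x).eval θ)
    {A : Word} (hA : b.e.eval ρ = some A) (hA' : b.e.eval ρ' = some A)
    (hb : T.regs .rsp = some b)
    (hM : ∀ x, x ∉ getDom X.mem κ ∪ interval (A - 8) (A - 8 + 8) → M x = Mp x)
    (hM' : ∀ x, x ∉ getShiftedDom cfg.δ X.mem κ' κ ∪ interval (A - 8) (A - 8 + 8) →
      M' x = Mp' x) :
    Rel cfg (callType T b X σcall τcall σret) θ ρ₁' ρ₁ (R'.set .rsp (A, false)) M'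
      (R.set .rsp (A, false)) M := by
  obtain rfl : θ₁ = fun x => (τcall x).eval θ := funext hθ
  have hok := hc.callOK
  set Z := shiftedPtrs T E σcall τcall with hZ
  set r := retSubst σcall σret with hrdef
  -- the callee's variables, as seen from the caller
  have hK : ∀ x ∈ X.vars, (r x).eval ρ₁ = some (κ x) := fun x hxX => by
    by_cases hin : x.input = true
    · rw [hok.eval_call hr hin, hc.val x hin]
    · exact hok.eval_block hr hxX (by simpa using hin)
  -- The type after the return uses the original `σcall`, which describes the arguments of the
  -- transformed callee except for shifted pointers.
  have hKz : ∀ x ∈ X.vars, (x.input = true → x ∉ Z) → (r x).eval ρ₁' = some (κ' x) :=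
    fun x hxX hz => by
    by_cases hin : x.input = true
    · have := hc.val' x hin
      rw [shiftSubst, if_neg (hz hin)] at this
      rw [hok.eval_call hr' hin, this]
    · exact hok.eval_block hr' hxX (by simpa using hin)
  classical
  -- This is the callee's valuation as the original annotation gives it in the transformed caller,
  -- and `κ` off `X.vars`. It may differ from `κ'` on shifted pointers but agrees with `κ` on marked
  -- variables, so `NonChange` types have the same value under `κ`, `κ'` and `κ₂`.
  set κ₂ : Valuation := fun x => if x ∈ X.vars then ((r x).eval ρ₁').getD 0 else κ x with hκ₂
  have hK' : ∀ x ∈ X.vars, (r x).eval ρ₁' = some (κ₂ x) := fun x hxX => by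
    obtain ⟨v, hv⟩ := Exp.exists_eval (hok.not_hasTop_retSubst x) ρ₁'
    change (r x).eval ρ₁' = some v at hv
    simp [hκ₂, hxX, hv]
  have hKa : AgreeNC κ κ₂ := fun x hnc => by
    by_cases hxX : x ∈ X.vars
    · have h1 := hKz x hxX fun _ hz => by simp [hc.trans.nonChange x hz] at hnc
      rw [hK' x hxX, Option.some.injEq] at h1
      rw [h1]
      exact hx.vars x hnc
    · simp [hκ₂, hxX]
  have hE1 : ∀ e : Exp, (∀ x ∈ e.vars, x ∈ X.vars) → (e.subst r).eval ρ₁ = e.eval κ :=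
    fun e he => Exp.eval_subst fun x hx => hK x (he x hx)
  have hE2 : ∀ e : Exp, (∀ x ∈ e.vars, x ∈ X.vars) → NonChange X.ctx e →
      (e.subst r).eval ρ₁' = e.eval κ' ∧ e.eval κ' = e.eval κ := fun e he hn => by
    have h1 : (e.subst r).eval ρ₁' = e.eval κ₂ := Exp.eval_subst fun x hx => hK' x (he x hx)
    have h2 := hn κ κ' hx.ctx hx.vars
    exact ⟨by rw [h1, hn κ κ₂ hx.ctx hKa, h2], h2⟩
  have hTe : ∀ e : Exp, (∀ x ∈ e.vars, x ∈ T.vars) → e.eval ρ₁ = e.eval ρ ∧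
      e.eval ρ₁' = e.eval ρ' := fun e he =>
    ⟨Exp.eval_congr fun x hx => hok.retVal_eq hr (he x hx),
      Exp.eval_congr fun x hx => hok.retVal_eq hr' (he x hx)⟩
  have hagree : AgreeNC ρ₁ ρ₁' := fun y hy => by
    by_cases hex : ∃ x, σret x = some y
    · obtain ⟨x, hxy⟩ := hex
      rw [hr.ret x y hxy, hr'.ret x y hxy]
      exact hx.vars x ((hok.retBlock x y hxy).2.2 hy)
    · have hex : ∀ x, σret x ≠ some y := fun x hxy => hex ⟨x, hxy⟩
      rw [hr.other y hex, hr'.other y hex]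
      exact hp.vars y hy
  have hsat : Sat ρ₁ (callCtx T X r) := by
    rintro c (hcm | hcm) v hv
    · refine hp.ctx c hcm v ?_
      rw [← hv]
      exact (hTe c fun x hx => Or.inl ⟨c, hcm, hx⟩).1.symm
    · exact (Sat.subst_iff fun c hc x hx => hK x (Or.inl ⟨c, hc, hx⟩)).2 hx.ctx c hcm v hv
  refine ⟨hsat, hagree, fun q c hq => ?_, fun q c hq ht => ?_, fun q c hq => ?_⟩
  · by_cases hqr : q = .rsp
    · subst hqr
      simp only [callType, RegType.set, Function.update_self, Option.some.injEq] at hq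
      subst hq
      simp only [RegFile.set, Function.update_self]
      obtain ⟨e1, e2⟩ := hTe b.e fun x hx => Or.inr (Or.inl ⟨_, _, hb, hx⟩)
      exact SimVal.of_eval rfl (e2.trans hA') (e1.trans hA)
    · simp only [callType, RegType.set, Function.update_of_ne hqr] at hq
      obtain ⟨c₁, hc₁, rfl⟩ := Option.map_eq_some_iff.1 hq
      simp only [RegFile.set, Function.update_of_ne hqr]
      have hv := hx.regs q c₁ hc₁
      have hvars : ∀ x ∈ c₁.e.vars, x ∈ X.vars := fun x hx => Or.inr (Or.inl ⟨q, c₁, hc₁, hx⟩)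
      refine hv.transfer (Or.inl ⟨?_, hE1 _ hvars⟩)
      cases hcs : q.calleeSaved with
      | true =>
        -- The type of `q` is the same variable at entry. If that pointer were shifted, its only
        -- register at entry would not be callee-saved.
        obtain ⟨x, t, h1, h2⟩ := hF.calleeSaved q hcs
        rw [hc₁] at h2
        cases h2
        refine Exp.eval_subst fun y hy => hKz y (hvars y hy) fun _ hz => ?_
        obtain rfl : y = x := hy
        obtain ⟨q', t', -, -, h3, h4⟩ := hc.trans.reg y hz
        rw [h4 q _ h1, h3] at hcs
        cases hcs
      | false => exact (hE2 _ hvars (hF.exitRegs q c₁ hc₁ hcs)).1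
  · by_cases hqr : q = .rsp
    · subst hqr
      simp [RegFile.set] at ht
    · simp only [callType, RegType.set, Function.update_of_ne hqr] at hq
      obtain ⟨c₁, hc₁, rfl⟩ := Option.map_eq_some_iff.1 hq
      simp only [RegFile.set, Function.update_of_ne hqr] at ht
      rw [Basic.subst, Taint.eval_subst]
      exact hx.regTaint q c₁ hc₁ ht
  · change updateMem T.ctx (callCtx T X r) T.mem σcall r τcall X.mem q = some c at hq
    have hlike : MemLike (callType T b X σcall τcall σret).mem T.mem :=
      updateMem_memLike _ _ _ _ _ _ _
    have hXE : MemLike X.mem E.mem := hF.memLike hF.exit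
    obtain ⟨c₀, hc₀⟩ := hlike.exists hq
    have hsl := hc.okT q (by simp [hc₀])
    have hTP : TransPtr (callType T b X σcall τcall σret).mem q ↔ TransPtr T.mem q :=
      hlike.transPtr_iff (hlike.slotsOK hc.okT)
    have hin : ∀ x ∈ q.vars, ρ₁ x = ρ x := fun x hx => hok.retVal_input hr (hsl.input x hx)
    have hin' : ∀ x ∈ q.vars, ρ₁' x = ρ' x := fun x hx => hok.retVal_input hr' (hsl.input x hx)
    have hm := hp.mem q c₀ hc₀
    have hrel : SlotRel cfg (callType T b X σcall τcall σret).mem θ ρ₁' ρ₁ q c :=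
      hm.toSlotRel.congr hsl hTP (hlike.taint q c c₀ hq hc₀) hin hin'
    have hreg : q.region.denote ρ₁ = q.region.denote ρ := Slot.denote_congr hin
    have hv₀ : c₀.valid.denote ρ₁ = c₀.valid.denote ρ := Region.denote_congr fun x hx =>
      hok.retVal_eq hr (Or.inr (Or.inr ⟨q, c₀, hc₀, Or.inr (Or.inl hx)⟩))
    obtain ⟨e1, e2⟩ := hTe c₀.val.e fun x hx => Or.inr (Or.inr ⟨q, c₀, hc₀, Or.inr (Or.inr hx)⟩)
    have hshift : c.val.t = c₀.val.t →
        slotShift cfg (callType T b X σcall τcall σret).mem ρ₁' ρ₁ q c =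
          slotShift cfg T.mem ρ' ρ q c₀ := fun ht => by
      rw [slotShift, slotShift, getOpShift_congr (c₁ := c) (c := c₀) hTP (fun θ => by rw [ht]),
        ptrDiff_congr hin hin']
    -- data that the callee does not own
    have hkeep : ∀ x ∈ c₀.valid.denote ρ,
        (∀ s, Updates T.ctx T.mem σcall X.mem q s → x ∉ s.region.denote κ) →
        M x = Mp x ∧ M' (x + slotShift cfg T.mem ρ' ρ q c₀) =
          Mp' (x + slotShift cfg T.mem ρ' ρ q c₀) := by
      intro x hxv hno
      have hxq := hm.validSub hxv
      obtain ⟨sr, cr, r1, r2, r3, r4, r5⟩ := hok.eval_retSlot hp.ctx hA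
      -- The slot of the return address has no valid address, but `x` is valid in `q`.
      have hqr : q ≠ sr := by
        rintro rfl
        rw [hc₀] at r1
        cases r1
        rw [r4] at hxv
        exact hxv
      have hdis := hc.disj q sr (by simp [hc₀]) (by simp [r1]) hqr
      have hnot : ∀ s, (X.mem s).isSome → x ∉ s.region.denote κ := fun s hs hxs => by
        obtain ⟨p, hfp⟩ := hok.update.found s hs
        have hps := (findSlot_spec hfp).1
        obtain rfl : p = q := hc.disj.eq hps (by simp [hc₀])
          (hc.region_subset ((hXE.dom s).1 hs) hfp hxs) hxq
        exact hno s ⟨hs, hfp⟩ hxs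
      refine ⟨hM x ?_, hM' _ ?_⟩
      · rintro (⟨s, hs, hxs⟩ | hxr)
        · exact hnot s hs hxs
        · rw [← r3] at hxr
          exact Set.eq_empty_iff_forall_notMem.1 hdis x ⟨hxq, hxr⟩
      · rintro (⟨s, hs, hxs⟩ | hxr)
        · obtain ⟨cs, hcs⟩ := Option.isSome_iff_exists.1 hs
          have hsrel := hx.mem s cs hcs
          obtain ⟨d, y, hd, hy, hxy⟩ := hsrel.exists_of_mem_possibleSlot hxs
          -- Disjointness is applied to the single address `x`, since the whole of `q` may well
          -- contain slots of the callee.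
          have hsing : ({x} : Set Word) ⊆ q.region.denote ρ := Set.singleton_subset_iff.2 hxq
          refine MemConfig.ShiftOK.ne (hm.place.mono hsing) hsrel.place (hm.shiftOK.mono hsing) hd
            ?_ (Set.mem_singleton x) hy hxy
          exact Set.singleton_inter_eq_empty.2 (hnot s hs)
        · rw [← r3] at hxr
          refine MemConfig.ShiftOK.ne hm.place (hp.mem sr cr r1).place hm.shiftOK (Or.inl rfl) hdis
            hxq hxr ?_
          rw [add_zero]
    rcases updateMem_cases hq hc₀ with ⟨rfl, hno⟩ | ⟨s, c₁, hsp, hups, hc₁, hvalid, hct, he⟩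
    · refine ⟨hrel, by rw [hv₀, hreg]; exact hm.validSub, ?_, ?_⟩
      all_goals
        by_cases hne : c.valid.denote ρ₁ = ∅
        · first | exact Or.inl hne | (rw [hne]; simp)
        -- A spill slot lent to the callee is uninitialized, so nonempty data means that no callee
        -- slot was inside it.
        have hno : ∀ s, ¬ Updates T.ctx T.mem σcall X.mem q s := by
          rcases hno with hno | hno
          · intro s hs
            obtain ⟨cs, hcs⟩ := Option.isSome_iff_exists.1 hs.1
            exact hne ((hok.update.spill q c s cs hc₀ hs hcs hno).1 ρ₁ hsat)
          · exact hno
        rw [hv₀]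
      · intro x hx ht
        rw [(hkeep x hx fun s hs => absurd hs (hno s)).1] at ht
        exact hm.taint x hx ht
      · rw [hshift rfl]
        refine (hm.data.congr (fun x hx => ?_) fun x hx => ?_).transfer subset_rfl
          (Or.inl ⟨e2, e1, Or.inr rfl⟩)
        · exact (hkeep x hx fun s hs => absurd hs (hno s)).1
        · exact (hkeep x hx fun s hs => absurd hs (hno s)).2
    · obtain ⟨hssp, hte, hnc⟩ := hok.update.nonSpill q c₀ s c₁ hc₀ hups hc₁ hsp
      have hXs : (E.mem s).isSome := (hXE.dom s).1 hups.1
      have hmx := hx.mem s c₁ hc₁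
      have hsreg : (s.region.subst r).denote ρ₁ = s.region.denote κ :=
        Region.denote_subst fun x hx =>
          hK x (Or.inr (Or.inr ⟨s, c₁, hc₁, Or.inl (s.region_vars hx)⟩))
      have hv₁ : (c₁.valid.subst r).denote ρ₁ = c₁.valid.denote κ :=
        Region.denote_subst fun x hx => hK x (Or.inr (Or.inr ⟨s, c₁, hc₁, Or.inr (Or.inl hx)⟩))
      have hev : ∀ x ∈ c₁.val.e.vars, x ∈ X.vars := fun x hx =>
        Or.inr (Or.inr ⟨s, c₁, hc₁, Or.inr (Or.inr hx)⟩)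
      have hX : c.valid.denote ρ₁ =
          (c₀.valid.denote ρ \ s.region.denote κ) ∪ c₁.valid.denote κ := by
        rw [hvalid]
        simp only [updValid, Region.denote, Cell.subst]
        rw [hv₀, hsreg, hv₁]
      have hregs : s.region.denote κ ⊆ q.region.denote ρ := hc.region_subset hXs hups.2
      have hold : ∀ x ∈ c₀.valid.denote ρ \ s.region.denote κ, M x = Mp x ∧
          M' (x + slotShift cfg T.mem ρ' ρ q c₀) = Mp' (x + slotShift cfg T.mem ρ' ρ q c₀) :=
        fun x hx => hkeep x hx.1 fun s' hs' => by
          rw [hok.update.unique q s' s hsp hs' hups]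
          exact hx.2
      -- The distance of the callee's data is reinterpreted as the caller's. Local slots are empty
      -- at exit, and outside spill slots the exit taint is the entry taint, so the equality from
      -- the call applies.
      have hd₁ : SimData c₁.val.e κ' κ M' M (c₁.valid.denote κ)
          (slotShift cfg T.mem ρ' ρ q c₀) := by
        by_cases hne : c₁.valid.denote κ = ∅
        · exact Or.inl hne
        · obtain ⟨cE, hcE⟩ := Option.isSome_iff_exists.1 hXs
          have hEt : c₁.val.t.Equiv cE.val.t := hXE.taint s c₁ cE hc₁ hcE hssp
          have hloc : ¬ s.IsLocalStack := fun hl =>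
            hne (hF.localInvalid X (Or.inr rfl) s c₁ hc₁ hl κ hx.ctx)
          rw [← hc.slotShift_eq hcE hups.2 hc₀ hloc (hte.trans (hEt.subst τcall))]
          have := hmx.data
          rw [slotShift, getOpShift_congr (hXE.transPtr_iff (hXE.slotsOK hc.okE)) hEt] at this
          exact this
      have hnc₁ : c₁.valid.denote κ ≠ ∅ → NonChange X.ctx c₁.val.e := fun hne =>
        (hF.exitMem s c₁ hc₁).resolve_left fun he => hne (he κ hx.ctx)
      refine ⟨hrel, ?_, ?_, ?_⟩
      · rw [hX, hreg]
        exact Set.union_subset (Set.sdiff_subset.trans hm.validSub) (hmx.validSub.trans hregs)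
      · rw [hX, hct]
        rintro x (hxo | hxn) ht
        · rw [(hold x hxo).1] at ht
          exact hm.taint x hxo.1 ht
        · have := hmx.taint x hxn ht
          rw [hte θ, Taint.eval_subst]
          exact this
      · rw [hshift hct]
        rcases he with ⟨hsame, he⟩ | ⟨hsame, he⟩
        · rw [he, hsame ρ₁ hsat, hv₁]
          refine hd₁.transfer subset_rfl ?_
          by_cases hne : c₁.valid.denote κ = ∅
          · exact Or.inr (Or.inr hne)
          · exact Or.inl ⟨(hE2 _ hev (hnc₁ hne)).1, hE1 _ hev, Or.inr rfl⟩
        · rw [hX]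
          rw [hvalid] at hsame
          -- A cell merged from old and returned data has type `top`, so equal bytes are needed. The
          -- old part has them by the premise of `updateMem`, the returned part because exit types
          -- are `NonChange`.
          obtain ⟨n0, -⟩ := hnc hsame
          refine SimData.of_bytes_eq (by rw [he]; trivial) ?_
          rintro x (hxo | hxn)
          · rw [(hold x hxo).1, (hold x hxo).2]
            refine hm.data.bytes_eq ?_ x hxo.1
            rw [← e1, ← e2]
            exact n0 ρ₁ ρ₁' hsat hagree
          · exact hd₁.bytes_eq (hE2 _ hev (hnc₁ (Set.nonempty_iff_ne_empty.1 ⟨x, hxn⟩))).2 x hxn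

end Leave

/-- `retq` occurs only in the exit block, which consists of that one instruction, so the state type
there is the exit type. In `main` the exit block is `halt` instead. -/
theorem TypedAt.retq {P : Program} {𝒯 : ProgType} {pc : PC} {T E X : StateType} {I : List Inst}
    (h : TypedAt P 𝒯 pc T E X .retq I) : pc.fn ≠ .main ∧ T = X := by
  have hi := h.getInst
  have hT := h.type
  have hret := h.func.retBlock
  have hno := h.func.noExit pc.lbl
  obtain ⟨f, ℓ, n⟩ := pc
  unfold Octal.getInst at hi
  obtain ⟨J, hJ, hi⟩ := Option.bind_eq_some_iff.1 hi
  obtain rfl : ℓ = .ret := by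
    by_contra hne
    exact (hno J hJ hne).1 (List.mem_of_getElem? hi)
  rw [hret] at hJ
  cases hJ
  cases n with
  | succ n => simp at hi
  | zero =>
    simp only [List.getElem?_cons_zero, Option.some.injEq] at hi
    have hf : f ≠ .main := by
      rintro rfl
      simp at hi
    rw [stateTypeAt_zero (by simp [hret]) h.func.exit] at hT
    exact ⟨hf, (Option.some.inj hT).symm⟩

/-- Injectivity of `σret` makes the preimage chosen in `retVals` the right one. -/
theorem Frame.retVal {σret : Var → Option Var} {fr p : Frame} {pc : PC}
    (hblock : ∀ x y, σret x = some y → x.input = false ∧ y.input = false)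
    (hinj : ∀ x x' y, σret x = some y → σret x' = some y → x = x') :
    RetVal σret fr.val p.val (Frame.val { p with pc := pc, σb := retVals fr.σb p.σb σret }) where
  ret x y hxy := by
    obtain ⟨h1, h2⟩ := hblock x y hxy
    have hex : ∃ x, σret x = some y := ⟨x, hxy⟩
    simp only [Frame.val, h1, h2, Bool.false_eq_true, if_false, retVals]
    rw [dif_pos hex, hinj _ _ y (Classical.choose_spec hex) hxy]
  other y hy := by
    have hex : ¬ ∃ x, σret x = some y := fun ⟨x, hx⟩ => hy x hx
    simp only [Frame.val, retVals]
    rw [dif_neg hex]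

/-! ### The return instruction -/

section Sim
variable {cfg : MemConfig} {addr addr' : PC → Word} {P P' : Program} {𝒯 : ProgType}

/-- The call stack still holds the relation of the callers at the time of the call. `Rel.leave`
combines its data with that of the callee, and `SimAt.relocate` replaces the caller's frame by the
one after the call. -/
theorem SimAt.simStep_retq {R' R : RegFile} {M' M : Memory} {fr' fr : Frame}
    {Φ' Φ : List Frame} {T E X : StateType} {I : List Inst}
    (h : SimAt cfg addr addr' P P' 𝒯 R' M' (fr' :: Φ') R M (fr :: Φ))
    (hh : SimHelper cfg P P' 𝒯 T R' M' fr' R M fr) (ht : TypedAt P 𝒯 fr.pc T E X .retq I) :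
    SimStep cfg addr addr' P P' 𝒯 ⟨R', M', fr' :: Φ'⟩ ⟨R, M, fr :: Φ⟩ := by
  obtain ⟨hfn, rfl⟩ := ht.retq
  obtain ⟨is, I', -, htr, htrAt, hseq, -⟩ := ht.simPC hh.pc
  cases htr
  cases h with
  | base _ hw =>
    cases hw with
    | base a1 a2 => exact absurd a2 hfn
  | @call _ _ Rp' Rp _ _ Mp' Mp _ _ p' p Φ' Φ T₀ σcall' τcall' σret' pc₀ is hh₀ hw a1 a2 a3 a4 a5
      a6 a7 a8 a9 a10 =>
    obtain rfl : T₀ = T := Option.some.inj (hh₀.type.symm.trans hh.type)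
    cases hw with
    | @call _ _ _ _ _ _ _ _ σcall τcall σret b1 b2 b3 b4 b5 b6 b7 b8 b9 b10 =>
      obtain ⟨-, Tp, hp⟩ := a6.head
      obtain ⟨E₀, X₀, i, J, htp⟩ := b1.exists_typedAt hp.type
      obtain rfl : i = _ := Option.some.inj (htp.getInst.symm.trans b7)
      obtain ⟨hJ, T₁, hT₁⟩ := htp.step (by simp)
      obtain ⟨b, E', X', hb, hE, hX, -, hok, rfl⟩ := exists_callOK hT₁
      obtain rfl : E' = E := Option.some.inj (hE.symm.trans ht.func.entry)
      obtain rfl : X' = T₀ := Option.some.inj (hX.symm.trans ht.func.exit)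
      obtain ⟨js, J', -, k2, k3, k4, k5⟩ := htp.simPC hp.pc
      obtain rfl : is = js := Option.some.inj (a4.symm.trans k3)
      obtain ⟨htrOK, his⟩ := transInst_callq hE k2
      obtain ⟨hTn, hpcn⟩ := k5 _ hT₁ hJ
      -- The call is the last of the `is.length` transformed instructions, at offset `is.length -
      -- 1`; the nonempty form of `is` is needed for the natural subtraction.
      have hlen : p'.pc.next = { pc₀ with idx := pc₀.idx + is.length } := by
        rw [a5, his]
        simp [PC.next]
        omega
      have hinst : getInst P' p'.pc = some (.callq fr.pc.fn
          (shiftSubst cfg.δ (shiftedPtrs Tp E' σcall τcall) σcall) τcall σret) := by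
        change seqAt P' pc₀ = _ at k4
        rw [his, List.append_assoc] at k4
        have := seqAt_add k4
        rw [a5, his]
        simpa using getInst_of_seqAt this
      have hσeq := a1
      rw [hinst] at hσeq
      simp only [Option.some.injEq, Inst.callq.injEq] at hσeq
      obtain ⟨-, rfl, rfl, rfl⟩ := hσeq
      have hF := ht.func
      have hcr : CallRel cfg Tp E' X' b σcall τcall σret p.θ p'.val p.val fr'.val fr.val :=
        hp.callRel htp hF hok htrOK (fun x hx => by rw [fr.val_of_input hx, b8 x hx]) fun x hx => by
          rw [fr'.val_of_input hx, a2 x hx]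
          rfl
      obtain ⟨A, hA, hA'⟩ := hok.eval_rsp hp.rel.ctx hp.rel.vars
      have hsp : fr.σf .sp = A - 8 := by
        rw [b8 .sp rfl]
        exact Frame.inst_eq (hok.eval_sp hF hp.rel.ctx (AgreeNC.refl _) hA)
      have hrr : fr.retRegion = interval (A - 8) (A - 8 + 8) := by rw [Frame.retRegion, hsp]
      have hleave := hp.rel.leave hh.rel hcr hF
        (Frame.retVal (pc := p.pc.next) (fun x y hxy => ⟨(hok.retBlock x y hxy).1,
          (hok.retBlock x y hxy).2.1⟩) hok.retInj)
        (Frame.retVal (p := { p' with pc := pc₀ }) (pc := p'.pc.next)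
          (fun x y hxy => ⟨(hok.retBlock x y hxy).1,
          (hok.retBlock x y hxy).2.1⟩) hok.retInj) b9 hA hA' hb (hrr ▸ a9) (hrr ▸ a10)
      have hlike : MemLike (callType Tp b X' σcall τcall σret).mem Tp.mem := (stepType_inv hT₁).2
      have hh₁ : SimHelper cfg P P' 𝒯 (callType Tp b X' σcall τcall σret)
          (R'.set .rsp (A, false)) M'
          { p' with pc := p'.pc.next, σb := retVals fr'.σb p'.σb σret }
          (R.set .rsp (A, false)) M
          { p with pc := p.pc.next, σb := retVals fr.σb p.σb σret } :=
        Rel.simHelper (fr := { p with pc := p.pc.next, σb := retVals fr.σb p.σb σret })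
          (fr' := { p' with pc := p'.pc.next, σb := retVals fr'.σb p'.σb σret }) hleave
          (by rw [hlen]; exact hpcn) hTn hp.taints (hlike.slotsOK htp.slotsOK)
      obtain ⟨sr, cr, r1, r2, r3, -⟩ := hok.eval_retSlot hp.rel.ctx hA
      have hXE : MemLike X'.mem E'.mem := hF.memLike hF.exit
      -- Seen from the caller, the whole run of the callee changed memory only inside the caller's
      -- slots: the callee's slots lie in them, and the return address occupies one.
      have hsim := a6.relocate hp.type hh₁ rfl rfl rfl rfl hlike
        (fun x hx => a9 x ?_) (fun x hx => a10 x ?_)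
      rotate_left
      · rintro (⟨s, hs, hxs⟩ | hxr)
        · obtain ⟨q, hq⟩ := hok.update.found s hs
          exact hx ⟨q, (findSlot_spec hq).1, hcr.region_subset ((hXE.dom s).1 hs) hq hxs⟩
        · rw [hrr, ← r3] at hxr
          exact hx ⟨sr, by simp [r1], hxr⟩
      · rintro (⟨s, hs, hxs⟩ | hxr)
        · obtain ⟨q, hq⟩ := hok.update.found s hs
          rw [getPossibleSlot_congr (hXE.transPtr_iff (hXE.slotsOK hcr.okE)) (fun _ _ => rfl)
            fun _ _ => rfl] at hxs
          exact hx ⟨q, (findSlot_spec hq).1, hcr.possibleSlot_subset ((hXE.dom s).1 hs) hq hxs⟩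
        · rw [hrr, ← r3] at hxr
          -- This slot has base `sp` and is TransOp, so its unshifted addresses are among its
          -- possible ones.
          refine hx ⟨sr, by simp [r1], ?_⟩
          rw [getPossibleSlot, if_neg fun h => h.1 r2]
          exact Or.inl hxr
      obtain ⟨t₀, t₁, -, hXr, -, ht₁⟩ := hF.rsp
      have hv := hh.rel.regs _ _ hXr
      obtain ⟨v1, v2⟩ := hv.eval (fun h => h)
      have g0 : (R .rsp).2 = false := ht₁.snd_eq_false (hh.rel.regTaint _ _ hXr)
      have g0' : (R' .rsp).2 = false := hv.1.trans g0
      have e0 : (R .rsp).1 = fr.σf .sp := (Option.some.inj v2).symm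
      have e0' : (R' .rsp).1 = fr.σf .sp :=
        (Option.some.inj v1).symm.trans (hh.rel.vars .sp rfl)
      have hA8 : A - 8 + 8 = A := by abel
      refine ⟨fr, p :: Φ, _, _, ⟨R.set .rsp (A, false), M,
        { p with pc := p.pc.next, σb := retVals fr.σb p.σb σret } :: Φ⟩,
        ⟨R'.set .rsp (A, false), M',
        { p' with pc := p'.pc.next, σb := retVals fr'.σb p'.σb σret } :: Φ'⟩, rfl, ht.getInst,
        htrAt, ⟨fr, p :: Φ, rfl, ht.getInst, ?_⟩,
        Steps.cons ⟨fr', p' :: Φ', rfl, getInst_of_seqAt hseq, ?_⟩ (Steps.nil _), hsim⟩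
      · simp only [exec, b7]
        rw [if_pos ⟨g0, by rw [e0, a7]⟩, e0, hsp, hA8]
      · simp only [exec, hinst]
        rw [if_pos ⟨g0', by rw [e0', a8]⟩, e0', hsp, hA8]

end Sim

/-! ### Assembling the cases -/

section Main
variable {cfg : MemConfig} {addr addr' : PC → Word} {P P' : Program} {𝒯 : ProgType}

theorem SimAt.terminal_or_simStep {R' R : RegFile} {M' M : Memory} {fr' fr : Frame}
    {Φ' Φ : List Frame} (hC : Transforms cfg 𝒯 P P')
    (h : SimAt cfg addr addr' P P' 𝒯 R' M' (fr' :: Φ') R M (fr :: Φ)) :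
    (Terminal P ⟨R, M, fr :: Φ⟩ ∧ Terminal P' ⟨R', M', fr' :: Φ'⟩) ∨
      SimStep cfg addr addr' P P' 𝒯 ⟨R', M', fr' :: Φ'⟩ ⟨R, M, fr :: Φ⟩ := by
  obtain ⟨-, T, hh⟩ := h.head
  obtain ⟨E, X, i, I, ht⟩ := h.progTyped.exists_typedAt hh.type
  by_cases h₁ : i = .halt
  · subst h₁
    obtain ⟨is, I', -, htr, -, hseq, -⟩ := ht.simPC hh.pc
    cases htr
    exact .inl ⟨⟨fr, Φ, rfl, ht.getInst⟩, fr', Φ', rfl, getInst_of_seqAt hseq⟩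
  right
  by_cases h₂ : i = .retq
  · subst h₂
    exact h.simStep_retq hh ht
  by_cases h₃ : ∃ ℓ σ, i = .jmp ℓ σ
  · obtain ⟨ℓ, σ, rfl⟩ := h₃
    exact h.simStep_jmp hC hh ht
  by_cases h₄ : ∃ ℓ σ, i = .jne ℓ σ
  · obtain ⟨ℓ, σ, rfl⟩ := h₄
    exact h.simStep_jne hC hh ht
  by_cases h₅ : ∃ g σcall τcall σret, i = .callq g σcall τcall σret
  · obtain ⟨g, σcall, τcall, σret, rfl⟩ := h₅
    exact h.simStep_callq hC hh ht
  push Not at h₃ h₄ h₅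
  obtain ⟨hI, T₁, hT₁⟩ := ht.step (by cases i <;> simp_all)
  obtain ⟨i', htr, hf⟩ := hh.fallsThrough Φ' Φ ht hT₁ h₄ h₅
  exact h.simStep_of_fallsThrough hh ht hI hT₁ htr hf

end Main

end Octal

theorem mainTheorem2 (cfg : Octal.MemConfig) (P P' : Octal.Program) (𝒯 : Octal.ProgType)
    (addr addr' : Octal.PC → Octal.Word) (hC : Octal.Transforms cfg 𝒯 P P')
    (S S' : Octal.State) (hS : Octal.WellFormed cfg addr P 𝒯 S)
    (hsim : Octal.Sim cfg addr addr' P P' 𝒯 S' S) :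
    (Octal.Terminal P S ∧ Octal.Terminal P' S') ∨
    ∃ (fr : Octal.Frame) (Φ : List Octal.Frame) (inst : Octal.Inst) (is : List Octal.Inst)
      (S₁ S₁' : Octal.State),
      S.Φ = fr :: Φ ∧ Octal.getInst P fr.pc = some inst ∧
      Octal.transInstAt cfg P 𝒯 fr.pc = some is ∧
      Octal.Step cfg addr P S inst S₁ ∧ Octal.Steps cfg addr' P' S' is S₁' ∧
      Octal.Sim cfg addr addr' P P' 𝒯 S₁' S₁ := by
  obtain ⟨R, M, Φ⟩ := S
  obtain ⟨R', M', Φ'⟩ := S'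
  have h : Octal.SimAt cfg addr addr' P P' 𝒯 R' M' Φ' R M Φ := hsim
  -- Only the shape of the call stacks is needed: in either case both are nonempty.
  cases h with
  | base h₁ h₂ => exact Octal.SimAt.terminal_or_simStep hC hsim
  | call => exact Octal.SimAt.terminal_or_simStep hC hsim
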